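/- Let $m>1$ be an integer with $m\not\equiv 2\pmod 4$, and write $m=q_1q_2\cdots q_t$ with pairwise coprime prime powers $q_i$, taken in an arbitrary but fixed order (so each $q_i>2$); let $p_i$ be the prime dividing $q_i$. For $n\ge 1$ let $G_n=\mathrm{Gal}(\mathbb{Q}(\zeta_n)/\mathbb{Q})$, let $\sigma_{n,s}\in G_n$ be the automorphism raising each $n$-th root of unity to its $s$-th power, let $N_n=\sum_{\tau\in G_n}\tau$, and for $a\in\mathbb{Z}$ put $$\theta_n(a)=\sum_{0<s\le n,\ (s,n)=1}\Big\langle -\frac{as}{n}\Big\rangle\,\sigma_{n,s}^{-1}\in\mathbb{Q}[G_n],$$ where $\langle x\rangle=x-\lfloor x\rfloor$. For $d\mid n$ let $\mathrm{res}_{n,d}:\mathbb{Q}[G_n]\to\mathbb{Q}[G_d]$ be the ring homomorphism induced by restriction of automorphisms, and let $\mathrm{cor}_{n,d}:\mathbb{Q}[G_d]\to\mathbb{Q}[G_n]$ be the linear map $\tau\mapsto\sum_{\sigma|_{\mathbb{Q}(\zeta_d)}=\tau}\sigma$. Let $S'_m$ be the additive subgroup of $\mathbb{Q}[G_m]$ generated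 by all elements $\mathrm{cor}_{m,(m,n)}\big(\mathrm{res}_{n,(m,n)}(\theta_n(a))\big)$ with $a,n\in\mathbb{Z}$, $n>0$. Let $M_m$ be the set of all integers $a$ with $0<a<m$ and $\big(a,\tfrac{m}{(a,m)}\big)=1$ such that * for all $i$, if $q_i\nmid a$ then $a\not\equiv-(a,m)\pmod{q_i}$; * if $a\nmid m$ and $k=\max\{i: a\not\equiv(a,m)\pmod{q_i}\}$, then $\big\langle\tfrac{a}{(a,m)q_k}\big\rangle<\tfrac12$; * if $a\mid m$, then the number of $i$ with $q_i\nmid a$ is odd. Put $$M'_m=\Big\{a\in M_m:\ \tfrac{m}{q_i}\nmid a\text{ for all }i\Big\}\cup\bigcup_{i=1}^t\Big\{\tfrac{mb}{q_i}:\ 1\le b\le\tfrac{\varphi(q_i)}2\Big\}.$$ For $0<b<m$ let $J'_b=\{i: q_i\nmid b\}\neq\emptyset$ and $r_b=\prod_{q_i\mid b}q_i$, and define $\alpha_m(b)$ as follows. * If $|J'_b|>1$, let $u=q_{\min J'_b}$, $v=\tfrac{m}{ur_b}$ and choose $x,y\in\mathbb{Z}$ with $ux+vy=-1$; then $\alpha_m(b)=\theta_m(b)+\theta_m(bux)+\theta_m(bvy)-N_m$,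 which does not depend on the choice of $x,y$. * If $J'_b=\{j\}$ and $b\ne\tfrac m{q_j}$, then $\alpha_m(b)=\theta_m(-b)+\theta_m\big(b-\tfrac m{q_j}\big)+\theta_m\big(\tfrac m{q_j}\big)-N_m$. * If $b=\tfrac m{q_j}$, then $\alpha_m(b)=2\theta_m\big(\tfrac{m\varphi(q_j)}{2q_j}\big)+\theta_m\big(\tfrac m{p_j}\big)-N_m$. Then each of the two families $$\{\alpha_m(b):\ b\in M'_m,\ |J'_b|>1\}\cup\{\theta_m(b):\ b\in M'_m,\ |J'_b|=1\}\cup\{\tfrac12N_m\},$$ $$\big\{\alpha_m(b):\ b\in M'_m\setminus\{\tfrac m{q_1},\dots,\tfrac m{q_t}\}\big\}\cup\big\{\theta_m(\tfrac m{q_1}),\dots,\theta_m(\tfrac m{q_t}),\tfrac12N_m\big\}$$ is a $\mathbb{Z}$-basis of $S'_m$. Moreover, for every $0<b<m$ the element $\alpha_m(b)$ is short, i.e. all its coefficients lie in $\{0,1\}$. -/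

import Mathlib

noncomputable section

namespace Stickelberger

/-! ### Cyclotomic fields, their Galois groups, and the group rings -/

/-- The `m`-th cyclotomic field `ℚ(ζ_m)`, `ζ_m = e^{2πi/m}`, as a subfield of `ℂ`. -/
abbrev cycField (m : ℕ) : IntermediateField ℚ ℂ :=
  IntermediateField.adjoin ℚ {Complex.exp (2 * Real.pi * Complex.I / m)}

instance (m : ℕ) [NeZero m] : IsCyclotomicExtension {m} ℚ (cycField m) :=
  by
    have hζ := Complex.isPrimitiveRoot_exp m (NeZero.ne m)
    change IsCyclotomicExtension {m} ℚ (cycField m).toSubalgebra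
    rw [IntermediateField.adjoin_simple_toSubalgebra_of_isAlgebraic
      (hζ.isIntegral (NeZero.pos m)).tower_top.isAlgebraic]
    exact hζ.adjoin_isCyclotomicExtension ℚ

instance (m : ℕ) [NeZero m] : NumberField (cycField m) :=
  IsCyclotomicExtension.numberField {m} ℚ (cycField m)

instance (m : ℕ) [NeZero m] : IsGalois ℚ (cycField m) :=
  IsCyclotomicExtension.isGalois {m} ℚ (cycField m)

instance (m n : ℕ) [NeZero m] : NeZero (Nat.gcd m n) :=
  ⟨(Nat.gcd_pos_of_pos_left n (NeZero.pos m)).ne'⟩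

/-- The Galois group `G_m` of the `m`-th cyclotomic field over `ℚ`. -/
abbrev GG (m : ℕ) : Type := Gal(cycField m/ℚ)

/-- The rational group ring `ℚ[G_m]`. -/
abbrev QG (m : ℕ) : Type := MonoidAlgebra ℚ (GG m)

/-- The automorphism `σ_s` of the `m`-th cyclotomic field raising every `m`-th root of unity to
its `s`-th power, for `s` coprime to `m` (and the identity, by convention, for other `s`). -/
def sigma (m : ℕ) [NeZero m] (s : ℕ) : GG m :=
  if h : s.Coprime m then
    (IsCyclotomicExtension.Rat.galEquivZMod m (cycField m)).symm (ZMod.unitOfCoprime s h)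
  else 1

theorem sigma_apply (m : ℕ) [NeZero m] {s : ℕ} (hs : s.Coprime m) {x : cycField m}
    (hx : x ^ m = 1) : sigma m s x = x ^ s := by
  rw [IsCyclotomicExtension.Rat.galEquivZMod_apply_of_pow_eq m _ _ hx, sigma, dif_pos hs,
    MulEquiv.apply_symm_apply, ZMod.coe_unitOfCoprime, ZMod.val_natCast]
  conv_rhs => rw [← Nat.mod_add_div s m, pow_add, pow_mul, hx, one_pow, mul_one]

/-- `θ_m(a) = ∑_{0 < s ≤ m, (s,m) = 1} ⟨-as/m⟩ σ_s⁻¹`. -/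
def theta (m : ℕ) [NeZero m] (a : ℤ) : QG m :=
  ∑ s ∈ (Finset.Icc 1 m).filter (fun s => s.Coprime m),
    MonoidAlgebra.single (sigma m s)⁻¹ (Int.fract (-((a : ℚ) * (s : ℚ)) / (m : ℚ)))

/-- The absolute norm element `N_m = ∑_τ τ`. -/
def normElt (m : ℕ) [NeZero m] : QG m :=
  ∑ τ : GG m, MonoidAlgebra.single τ 1

/-- An element is short if all its coefficients lie in `{0, 1}`. -/
def IsShort {m : ℕ} (x : QG m) : Prop :=
  ∀ σ : GG m, x.coeff σ = 0 ∨ x.coeff σ = 1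

/-! ### Restriction, corestriction, and the group `S'_m` -/

theorem cycField_le {d m : ℕ} [NeZero m] (h : d ∣ m) : cycField d ≤ cycField m := by
  obtain ⟨k, rfl⟩ := h
  have hk : (k : ℂ) ≠ 0 := by
    have := NeZero.ne (d * k)
    exact_mod_cast (mul_ne_zero_iff.mp this).2
  refine IntermediateField.adjoin_le_iff.mpr (Set.singleton_subset_iff.mpr ?_)
  have h1 : Complex.exp (2 * Real.pi * Complex.I / d) =
      Complex.exp (2 * Real.pi * Complex.I / ((d * k : ℕ) : ℂ)) ^ k := by
    rw [← Complex.exp_nat_mul]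
    congr 1
    push_cast
    by_cases hd : (d : ℂ) = 0
    · simp [hd]
    · field_simp
  rw [SetLike.mem_coe, h1]
  exact pow_mem (IntermediateField.mem_adjoin_simple_self ℚ _) k

/-- The restriction homomorphism `Gal(F/k) → Gal(E/k)` along an embedding `f : E → F` over `k`, with
`E / k` normal: `f (σ|_E x) = σ (f x)`. -/
def restrictHom {k E F : Type*} [Field k] [Field E] [Field F] [Algebra k E] [Algebra k F]
    (f : E →ₐ[k] F) [Normal k E] : Gal(F/k) →* Gal(E/k) :=
  letI : Algebra E F := f.toRingHom.toAlgebra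
  haveI : IsScalarTower k E F := IsScalarTower.of_algebraMap_eq fun x => (f.commutes x).symm
  AlgEquiv.restrictNormalHom E

theorem restrictHom_commutes {k E F : Type*} [Field k] [Field E] [Field F] [Algebra k E]
    [Algebra k F] (f : E →ₐ[k] F) [Normal k E] (σ : Gal(F/k)) (x : E) :
    f (restrictHom f σ x) = σ (f x) := by
  let _ : Algebra E F := f.toRingHom.toAlgebra
  have _ : IsScalarTower k E F := IsScalarTower.of_algebraMap_eq fun x => (f.commutes x).symm
  exact AlgEquiv.restrictNormal_commutes σ E x

/-- The inclusion of subfields `E ≤ F` of a field of characteristic zero, as a map of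
`ℚ`-algebras. -/
def ratIncl {L : Type*} [Field L] [CharZero L] {E F : IntermediateField ℚ L} (h : E ≤ F) :
    E →ₐ[ℚ] F :=
  (IntermediateField.inclusion h).toRingHom.toRatAlgHom

theorem coe_ratIncl {L : Type*} [Field L] [CharZero L] {E F : IntermediateField ℚ L} (h : E ≤ F)
    (x : E) : ((ratIncl h x : F) : L) = x := rfl

/-- The restriction homomorphism `G_m → G_d`, `σ ↦ σ|_{ℚ(ζ_d)}`, for `d ∣ m`. -/
def galRes {d m : ℕ} [NeZero d] [NeZero m] (h : d ∣ m) : GG m →* GG d :=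
  restrictHom (ratIncl (cycField_le h))

theorem coe_galRes_apply {d m : ℕ} [NeZero d] [NeZero m] (h : d ∣ m) (σ : GG m)
    (x : cycField d) :
    ((galRes h σ x : cycField d) : ℂ) = (σ ⟨x, cycField_le h x.2⟩ : cycField m) := by
  have e : ratIncl (cycField_le h) x = ⟨x, cycField_le h x.2⟩ :=
    Subtype.ext (coe_ratIncl (cycField_le h) x)
  rw [← e, ← restrictHom_commutes, coe_ratIncl]
  rw [galRes]

/-- The restriction map `ℚ[G_m] → ℚ[G_d]`, for `d ∣ m`. -/
def res {d m : ℕ} [NeZero d] [NeZero m] (h : d ∣ m) : QG m →+* QG d :=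
  MonoidAlgebra.mapDomainRingHom ℚ (galRes h)

open Classical in
/-- The corestriction map `ℚ[G_d] → ℚ[G_m]`, for `d ∣ m`: the linear map with
`τ ↦ ∑_{σ|_{ℚ(ζ_d)} = τ} σ`. -/
def cor {d m : ℕ} [NeZero d] [NeZero m] (h : d ∣ m) (x : QG d) : QG m :=
  ∑ τ : GG d, x.coeff τ •
    ∑ σ ∈ Finset.univ.filter (fun σ : GG m => galRes h σ = τ), MonoidAlgebra.single σ 1

/-- The elements `θ_n^{(m)}(a) = cor (res θ_n(a))`, through the `(m, n)`-th cyclotomic field. -/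
def thetaLift (m n : ℕ) [NeZero m] [NeZero n] (a : ℤ) : QG m :=
  cor (Nat.gcd_dvd_left m n) (res (Nat.gcd_dvd_right m n) (theta n a))

/-- Sinnott's group `S'_m`: the additive subgroup of `ℚ[G_m]` generated by all
`θ_n^{(m)}(a)`, where `a` and `n > 0` are integers. -/
def SPrime (m : ℕ) [NeZero m] : AddSubgroup (QG m) :=
  AddSubgroup.closure {x | ∃ (n : ℕ) (_ : NeZero n) (a : ℤ), x = thetaLift m n a}

/-! ### The index sets -/

/-- `m = q_1 ⋯ q_t` is the factorization of `m` into pairwise coprime prime powers, in an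
arbitrary but fixed order. -/
structure IsPrimePowerFactorization (m : ℕ) {t : ℕ} (q : Fin t → ℕ) : Prop where
  isPrimePow : ∀ i, IsPrimePow (q i)
  coprime : ∀ i j, i ≠ j → Nat.Coprime (q i) (q j)
  prod_eq : ∏ i, q i = m

section IndexSets

variable (m : ℕ) {t : ℕ} (q : Fin t → ℕ)

/-- `J_b = {i : q_i ∣ b}`. -/
def J (b : ℕ) : Finset (Fin t) := Finset.univ.filter (fun i => q i ∣ b)

/-- `J'_b = {i : q_i ∤ b}`. -/
def J' (b : ℕ) : Finset (Fin t) := Finset.univ.filter (fun i => ¬ q i ∣ b)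

/-- `r_b = ∏_{i ∈ J_b} q_i`. -/
def r (b : ℕ) : ℕ := ∏ i ∈ J q b, q i

/-- The set `X_m`. -/
def X : Set ℕ := {a | 0 < a ∧ a < m ∧ Nat.Coprime a (m / Nat.gcd a m)}

/-- The set `M_m`. -/
def M : Set ℕ := {a | a ∈ X m ∧
  (∀ i, ¬ q i ∣ a → ¬ (a : ℤ) ≡ -(Nat.gcd a m : ℤ) [ZMOD (q i : ℤ)]) ∧
  (¬ a ∣ m → ∀ k, IsGreatest {i | ¬ a ≡ Nat.gcd a m [MOD q i]} k →
    Int.fract ((a : ℚ) / ((Nat.gcd a m : ℚ) * (q k : ℚ))) < 1 / 2) ∧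
  (a ∣ m → Odd (J' q a).card)}

/-- The set `M'_m`. -/
def M' : Set ℕ :=
  {a | a ∈ M m q ∧ ∀ i, ¬ m / q i ∣ a} ∪
  ⋃ i, {a | ∃ b, 1 ≤ b ∧ b ≤ Nat.totient (q i) / 2 ∧ a = m / q i * b}

end IndexSets

/-! ### The elements `α_m(b)` -/

/-- `α_m(b)`, for `0 < b < m` (the value for other `b` is irrelevant). Here `j = min J'_b`.
If `|J'_b| > 1`, then `u = q_j`, `v = m / (u r_b)`, and `x`, `y` are Bézout coefficients with
`u x + v y = -1`; see `alpha_eq_of_bezout` for the independence of their choice.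
If `J'_b = {j}`, then `b = (m / q_j) c`, and the cases `c = 1` and `c > 1` are distinguished. The
prime dividing `q_j` is `(q j).minFac`. -/
def alpha (m : ℕ) [NeZero m] {t : ℕ} (q : Fin t → ℕ) (b : ℕ) : QG m :=
  if h : (J' q b).Nonempty then
    let j : Fin t := (J' q b).min' h
    if 1 < (J' q b).card then
      let u : ℕ := q j
      let v : ℕ := m / (u * r q b)
      let x : ℤ := -Nat.gcdA u v
      let y : ℤ := -Nat.gcdB u v
      theta m b + theta m ((b : ℤ) * u * x) + theta m ((b : ℤ) * v * y) - normElt m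
    else if b = m / q j then
      (2 : ℕ) • theta m ((m / q j * (Nat.totient (q j) / 2) : ℕ) : ℤ)
        + theta m ((m / (q j).minFac : ℕ) : ℤ) - normElt m
    else
      theta m (-(b : ℤ)) + theta m ((b : ℤ) - ((m / q j : ℕ) : ℤ))
        + theta m ((m / q j : ℕ) : ℤ) - normElt m
  else 0

theorem theta_congr (m : ℕ) [NeZero m] {a b : ℤ} (h : a ≡ b [ZMOD m]) :
    theta m a = theta m b := by
  obtain ⟨c, hc⟩ := h.dvd
  have hm : (m : ℚ) ≠ 0 := Nat.cast_ne_zero.mpr (NeZero.ne m)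
  refine Finset.sum_congr rfl fun s _ => ?_
  congr 1
  rw [Int.fract_eq_fract]
  refine ⟨c * s, ?_⟩
  have hb : (b : ℚ) = a + m * c := by
    have : b = a + m * c := by linarith
    exact_mod_cast this
  rw [hb]
  push_cast
  field_simp
  ring

theorem J'_nonempty {m t : ℕ} {q : Fin t → ℕ} (hq : IsPrimePowerFactorization m q) {b : ℕ}
    (hb : 0 < b) (hbm : b < m) : (J' q b).Nonempty := by
  by_contra hne
  have hall : ∀ i, q i ∣ b := by
    intro i
    by_contra hi
    exact hne ⟨i, by simp [J', hi]⟩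
  have hdvd : m ∣ b := by
    rw [← hq.prod_eq]
    exact Finset.prod_dvd_of_isRelPrime
      (fun i _ j _ hij => Nat.coprime_iff_isRelPrime.mp (hq.coprime i j hij)) (fun i _ => hall i)
  exact absurd (Nat.le_of_dvd hb hdvd) (not_le.mpr hbm)

theorem alpha_eq_of_bezout {m : ℕ} [NeZero m] {t : ℕ} {q : Fin t → ℕ}
    (hq : IsPrimePowerFactorization m q) {b : ℕ} (h : (J' q b).Nonempty)
    (hcard : 1 < (J' q b).card) {u v : ℕ} (hu : u = q ((J' q b).min' h))
    (hv : v = m / (u * r q b)) {x y : ℤ} (hxy : (u : ℤ) * x + v * y = -1) :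
    alpha m q b =
      theta m b + theta m ((b : ℤ) * u * x) + theta m ((b : ℤ) * v * y) - normElt m := by
  have hrb : r q b ∣ b := Finset.prod_dvd_of_isRelPrime
    (fun i _ j _ hij => Nat.coprime_iff_isRelPrime.mp (hq.coprime i j hij))
    (fun i hi => by simpa [J] using hi)
  have hurm : u * r q b ∣ m := by
    have hnot : (J' q b).min' h ∉ J q b := by
      have := Finset.min'_mem _ h
      intro hmem
      exact (Finset.mem_filter.mp this).2 (Finset.mem_filter.mp hmem).2
    have h1 : u * r q b = ∏ i ∈ insert ((J' q b).min' h) (J q b), q i := by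
      rw [Finset.prod_insert hnot, hu, r]
    rw [h1, ← hq.prod_eq]
    exact Finset.prod_dvd_prod_of_subset _ _ _ (Finset.subset_univ _)
  have huv : ((u : ℤ) * r q b * v) = m := by
    have := Nat.mul_div_cancel' hurm
    rw [← hv] at this
    exact_mod_cast this
  have hcop : IsCoprime (u : ℤ) v := ⟨-x, -y, by linarith⟩
  have hgcd : Nat.gcd u v = 1 := Nat.isCoprime_iff_coprime.mp hcop
  have hbz := Nat.gcd_eq_gcd_ab u v
  rw [hgcd] at hbz
  push_cast at hbz
  obtain ⟨c, hc⟩ := hrb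
  have hcz : (b : ℤ) = r q b * c := by exact_mod_cast hc
  have hx : (v : ℤ) ∣ x - -Nat.gcdA u v :=
    hcop.symm.dvd_of_dvd_mul_left ⟨-(y + Nat.gcdB u v), by linear_combination hxy - hbz⟩
  have hy : (u : ℤ) ∣ y - -Nat.gcdB u v :=
    hcop.dvd_of_dvd_mul_left ⟨-(x + Nat.gcdA u v), by linear_combination hxy - hbz⟩
  have e1 : theta m ((b : ℤ) * u * -Nat.gcdA u v) = theta m ((b : ℤ) * u * x) := by
    apply theta_congr
    obtain ⟨k, hk⟩ := hx
    refine Int.modEq_iff_dvd.mpr ⟨c * k, ?_⟩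
    rw [← huv]
    linear_combination ((b : ℤ) * u) * hk + ((u : ℤ) * v * k) * hcz
  have e2 : theta m ((b : ℤ) * v * -Nat.gcdB u v) = theta m ((b : ℤ) * v * y) := by
    apply theta_congr
    obtain ⟨k, hk⟩ := hy
    refine Int.modEq_iff_dvd.mpr ⟨c * k, ?_⟩
    rw [← huv]
    linear_combination ((b : ℤ) * v) * hk + ((u : ℤ) * v * k) * hcz
  rw [alpha, dif_pos h]
  simp only [if_pos hcard]
  rw [← hu, ← hv, e1, e2]

end Stickelberger

end

open Stickelberger

set_option linter.unusedSectionVars false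

noncomputable section

namespace Stickelberger

/-! ### Symbols, distribution relations and their states -/

/-! Write an element of ℚ[G_m] as the function sending u ∈ (ℤ/m)ˣ to the coefficient of σ_u⁻¹. Then
N_m is the constant 1, and for m ∤ a the element θ_m(a) is ψ(a) + ½·1, with ψ(a) the odd function u
↦ saw(-au). Fibre sums of ψ between levels are integral combinations of values of ψ, so all of S'_m
lands in the ℤ-span of ½·1 and the ψ(a) (`coeffFn_mem_of_mem_SPrime`). Over ℚ this lattice has rank
at least φ(m)/2 + 1: since L(1,χ) ≠ 0 for odd χ, no nonzero odd function is orthogonal to all ψ(a)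
(`totient_add_two_le_two_mul_finrank`). Hence a family in S'_m is a basis once it generates the
lattice over ℤ and has at most φ(m)/2 + 1 members (`exists_basis`).

Generation. The distribution relation of the sawtooth reduces everything to residues whose
coordinate modulo each q_i is 0 or a unit; these are encoded as symbols. Induct on the support B of
a symbol. Modulo smaller supports, the sum over all unit values of one coordinate vanishes, which
eliminates the value -1; oddness then moves the last coordinate other than 0 and 1 into a half
system. There remain the symbols with entries ±1 on B, all equal up to sign to the symbol 1_B. For
|B| odd, 1_B belongs to the index set.

For |B| even, oddness only yields 2ψ(1_B), and an odd multiple is needed as well. It comes from the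
Tate cohomology of complex conjugation J on symbols modulo relations: the norm in one coordinate is
injective modulo relations (`mem_KS_of_coordNorm_mem`), the cohomology vanishes once a coordinate is
confined to units (`exists_trace_of_eigen`), and the Galois tuples act trivially on it. Adding
coordinates one by one produces a J-eigenvector of sign (-1)^|B| with an odd number of terms having
entries ±1 on B (`exists_eigen_of_odd_parity`). For |B| even an odd distribution kills this vector,
and that is the missing relation.

Count. Multiplying the last nontrivial coordinate by -1 leaves the index set, so it has at most
(∏(φ(q_i) - 1) - (-1)^|B|)/2 symbols of support B, the products over i ∈ B; summed over B this gives
φ(m)/2 (`two_mul_ncard_M'_le`).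

The elements α. The three arguments of θ in α_m(b) sum to 0 modulo m, so each coefficient is 1 or 2
minus 1, which is shortness. For |J'_b| > 1 the two auxiliary arguments have smaller support, so
α_m(b) can replace θ_m(b) in the induction; for |J'_b| = 1 the α_m(b) yield the θ_m(b) recursively
from θ_m(m/q_j). -/

/-- Tuples whose `i`-th coordinate is either `0` or an element of the group `G i`. -/
abbrev Symb {ι : Type*} (G : ι → Type*) : Type _ := ∀ i, WithZero (G i)

/-- The data of a distribution on symbols: an involution `j`, half systems `H` for it, and the two
twists occurring in the norm relations. -/
structure DistData {ι : Type*} (G : ι → Type*) [∀ i, CommGroup (G i)] where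
  /-- the involution, acting as complex conjugation -/
  j : ∀ i, G i
  /-- first twist -/
  A : ι → ∀ i, G i
  /-- second twist -/
  B : ι → ∀ i, G i
  /-- half systems -/
  H : ∀ i, Set (G i)
  j_mul : ∀ i, j i * j i = 1
  mem_H : ∀ i g, g ∈ H i ↔ j i * g ∉ H i

/-- The state of a coordinate: only units, only zero, or both, subject to the norm relation. -/
inductive CoordState
  | unit
  | zero
  | both

section Dist

variable {ι : Type*} [Fintype ι] [DecidableEq ι] {G : ι → Type*} [∀ i, CommGroup (G i)]

/-- Twisting a symbol by a tuple of group elements. -/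
def twist (σ : ∀ i, G i) (c : Symb G) : Symb G := fun i => (σ i : WithZero (G i)) * c i

theorem twist_apply (σ : ∀ i, G i) (c : Symb G) (i : ι) : twist σ c i = σ i * c i := rfl

theorem twist_eq_zero {σ : ∀ i, G i} {c : Symb G} {i : ι} : twist σ c i = 0 ↔ c i = 0 := by
  simp [twist]

theorem twist_twist (σ τ : ∀ i, G i) (c : Symb G) : twist σ (twist τ c) = twist (σ * τ) c := by
  ext1 i; simp [twist, mul_assoc]

theorem one_twist (c : Symb G) : twist 1 c = c := by
  ext1 i; simp [twist]

theorem twist_update (σ : ∀ i, G i) (c : Symb G) (k : ι) (x : WithZero (G k)) :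
    twist σ (Function.update c k x) = Function.update (twist σ c) k (σ k * x) := by
  ext1 i
  by_cases h : i = k
  · subst h; simp [twist]
  · simp [twist, h]

/-- The action of a tuple on formal sums of symbols. -/
def act (σ : ∀ i, G i) : (Symb G →₀ ℤ) →ₗ[ℤ] (Symb G →₀ ℤ) := Finsupp.lmapDomain ℤ ℤ (twist σ)

theorem act_single (σ : ∀ i, G i) (c : Symb G) (n : ℤ) :
    act σ (Finsupp.single c n) = Finsupp.single (twist σ c) n := by
  simp [act, Finsupp.mapDomain_single]

theorem act_act (σ τ : ∀ i, G i) (x : Symb G →₀ ℤ) : act σ (act τ x) = act (σ * τ) x := by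
  induction x using Finsupp.induction_linear with
  | zero => simp
  | add x y hx hy => simp [hx, hy]
  | single c n => simp [act_single, twist_twist]

theorem act_comm (σ τ : ∀ i, G i) (x : Symb G →₀ ℤ) : act σ (act τ x) = act τ (act σ x) := by
  rw [act_act, act_act, mul_comm]

theorem one_act (x : Symb G →₀ ℤ) : act 1 x = x := by
  induction x using Finsupp.induction_linear with
  | zero => simp
  | add x y hx hy => simp [hx, hy]
  | single c n => simp [act_single, one_twist]

variable [∀ i, Fintype (G i)]

/-- The norm in the `k`-th coordinate, on formal sums of symbols. -/
def coordNorm (k : ι) : (Symb G →₀ ℤ) →ₗ[ℤ] (Symb G →₀ ℤ) :=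
  Finsupp.linearCombination ℤ
    (fun c => ∑ g : G k, Finsupp.single (Function.update c k (g : WithZero (G k))) (1 : ℤ))

theorem coordNorm_single (k : ι) (c : Symb G) :
    coordNorm k (Finsupp.single c 1) =
      ∑ g : G k, Finsupp.single (Function.update c k (g : WithZero (G k))) (1 : ℤ) := by
  simp [coordNorm]

theorem finsupp_linearMap_ext {M : Type*} [AddCommGroup M] {f g : (Symb G →₀ ℤ) →ₗ[ℤ] M}
    (h : ∀ c, f (Finsupp.single c 1) = g (Finsupp.single c 1)) (x : Symb G →₀ ℤ) : f x = g x := by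
  have : f = g := Finsupp.lhom_ext' fun c => LinearMap.ext_ring (by simpa using h c)
  rw [this]

theorem coordNorm_act (k : ι) (σ : ∀ i, G i) (x : Symb G →₀ ℤ) :
    coordNorm k (act σ x) = act σ (coordNorm k x) := by
  rw [← LinearMap.comp_apply, ← LinearMap.comp_apply]
  refine finsupp_linearMap_ext (fun c => ?_) x
  simp only [LinearMap.comp_apply, act_single, coordNorm_single, map_sum, twist_update]
  rw [← Equiv.sum_comp (Equiv.mulLeft (σ k))]
  refine Finset.sum_congr rfl fun g _ => ?_
  rw [Equiv.coe_mulLeft, WithZero.coe_mul]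

theorem coordNorm_coordNorm {k l : ι} (hkl : k ≠ l) (x : Symb G →₀ ℤ) :
    coordNorm k (coordNorm l x) = coordNorm l (coordNorm k x) := by
  rw [← LinearMap.comp_apply, ← LinearMap.comp_apply (coordNorm l)]
  refine finsupp_linearMap_ext (fun c => ?_) x
  rw [LinearMap.comp_apply, LinearMap.comp_apply, coordNorm_single, coordNorm_single, map_sum,
    map_sum]
  simp_rw [coordNorm_single]
  rw [Finset.sum_comm]
  refine Finset.sum_congr rfl fun g _ => Finset.sum_congr rfl fun h _ => ?_
  rw [Function.update_comm hkl]

/-- `act` of an element supported in the `k`-th coordinate is absorbed by the norm. -/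
theorem act_mulSingle_coordNorm (k : ι) (g : G k) (x : Symb G →₀ ℤ) :
    act (Pi.mulSingle k g) (coordNorm k x) = coordNorm k x := by
  rw [← LinearMap.comp_apply]
  refine finsupp_linearMap_ext (fun c => ?_) x
  simp only [LinearMap.comp_apply, coordNorm_single, map_sum, act_single]
  refine Fintype.sum_equiv (Equiv.mulLeft g) _ _ (fun h => ?_)
  congr 1
  ext1 i
  by_cases hi : i = k
  · subst hi; simp [twist]
  · simp [twist, hi]

/-- The symbols compatible with a state. -/
def symb (G : ι → Type*) (s : ι → CoordState) : Set (Symb G) :=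
  {c | ∀ i, (s i = .unit → c i ≠ 0) ∧ (s i = .zero → c i = 0)}

/-- Formal sums of symbols compatible with a state. -/
def PS (G : ι → Type*) (s : ι → CoordState) : Submodule ℤ (Symb G →₀ ℤ) :=
  Finsupp.supported ℤ ℤ (symb G s)

namespace DistData

variable (D : DistData G)

/-- The difference of the two twists. -/
def delta (k : ι) : (Symb G →₀ ℤ) →ₗ[ℤ] (Symb G →₀ ℤ) := act (D.A k) - act (D.B k)

/-- The relation attached to the `k`-th coordinate. -/
def relMap (k : ι) : (Symb G →₀ ℤ) →ₗ[ℤ] (Symb G →₀ ℤ) := coordNorm k - D.delta k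

/-- The submodule of relations for a state. -/
def KS (s : ι → CoordState) : Submodule ℤ (Symb G →₀ ℤ) :=
  Submodule.span ℤ {x | ∃ k c, s k = .both ∧ c ∈ symb G s ∧ c k = 0 ∧
    x = D.relMap k (Finsupp.single c 1)}

end DistData

theorem symb_update_unit {s : ι → CoordState} {k : ι} (hk : s k = .both) {c : Symb G} :
    c ∈ symb G (Function.update s k .unit) ↔ c ∈ symb G s ∧ c k ≠ 0 := by
  constructor
  · intro h
    refine ⟨fun i => ?_, (h k).1 (by simp)⟩
    by_cases hi : i = k
    · subst hi; simp [hk]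
    · simpa [hi] using h i
  · rintro ⟨h, hc⟩ i
    by_cases hi : i = k
    · subst hi; simp [hc]
    · simpa [hi] using h i

theorem symb_update_zero {s : ι → CoordState} {k : ι} (hk : s k = .both) {c : Symb G} :
    c ∈ symb G (Function.update s k .zero) ↔ c ∈ symb G s ∧ c k = 0 := by
  constructor
  · intro h
    refine ⟨fun i => ?_, (h k).2 (by simp)⟩
    by_cases hi : i = k
    · subst hi; simp [hk]
    · simpa [hi] using h i
  · rintro ⟨h, hc⟩ i
    by_cases hi : i = k
    · subst hi; simp [hc]
    · simpa [hi] using h i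

theorem twist_mem_symb {s : ι → CoordState} {σ : ∀ i, G i} {c : Symb G} :
    twist σ c ∈ symb G s ↔ c ∈ symb G s := by
  simp [symb, twist_eq_zero]

theorem single_mem_PS {s : ι → CoordState} {c : Symb G} (h : c ∈ symb G s) (n : ℤ) :
    Finsupp.single c n ∈ PS G s := Finsupp.single_mem_supported ℤ n h

theorem PS_induction {s : ι → CoordState} {Q : Submodule ℤ (Symb G →₀ ℤ)}
    (h : ∀ c ∈ symb G s, Finsupp.single c 1 ∈ Q) : PS G s ≤ Q := by
  rw [PS, Finsupp.supported_eq_span_single, Submodule.span_le]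
  rintro _ ⟨c, hc, rfl⟩
  exact h c hc

theorem coordNorm_mem_PS {s : ι → CoordState} {k : ι} {x : Symb G →₀ ℤ}
    (hx : x ∈ PS G (Function.update s k .zero)) :
    coordNorm k x ∈ PS G (Function.update s k .unit) := by
  suffices h : PS G (Function.update s k .zero) ≤
      (PS G (Function.update s k .unit)).comap (coordNorm k) from h hx
  refine PS_induction fun c hc => ?_
  rw [Submodule.mem_comap, coordNorm_single]
  refine Submodule.sum_mem _ fun g _ => single_mem_PS (fun i => ?_) 1
  by_cases hi : i = k
  · subst hi; simp
  · simpa [hi] using hc i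

theorem act_mem_PS {s : ι → CoordState} {x : Symb G →₀ ℤ} (σ : ∀ i, G i)
    (hx : x ∈ PS G s) : act σ x ∈ PS G s := by
  suffices h : PS G s ≤ (PS G s).comap (act σ) from h hx
  refine PS_induction fun c hc => ?_
  rw [Submodule.mem_comap, act_single]
  exact single_mem_PS (twist_mem_symb.mpr hc) 1

theorem PS_update_unit_le {s : ι → CoordState} {k : ι} (hk : s k = .both) :
    PS G (Function.update s k .unit) ≤ PS G s :=
  Finsupp.supported_mono fun _ hc => ((symb_update_unit hk).mp hc).1

theorem PS_update_zero_le {s : ι → CoordState} {k : ι} (hk : s k = .both) :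
    PS G (Function.update s k .zero) ≤ PS G s :=
  Finsupp.supported_mono fun _ hc => ((symb_update_zero hk).mp hc).1

theorem exists_PS_decomp {s : ι → CoordState} {k : ι} (hk : s k = .both) {x : Symb G →₀ ℤ}
    (hx : x ∈ PS G s) : ∃ a ∈ PS G (Function.update s k .unit),
      ∃ z ∈ PS G (Function.update s k .zero), x = a + z := by
  suffices h : PS G s ≤ PS G (Function.update s k .unit) ⊔ PS G (Function.update s k .zero) by
    obtain ⟨a, ha, z, hz, e⟩ := Submodule.mem_sup.mp (h hx)
    exact ⟨a, ha, z, hz, e.symm⟩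
  refine PS_induction fun c hc => ?_
  by_cases h : c k = 0
  · exact Submodule.mem_sup_right (single_mem_PS ((symb_update_zero hk).mpr ⟨hc, h⟩) 1)
  · exact Submodule.mem_sup_left (single_mem_PS ((symb_update_unit hk).mpr ⟨hc, h⟩) 1)

theorem PS_decomp_unique {s : ι → CoordState} {k : ι} {a a' z z' : Symb G →₀ ℤ}
    (ha : a ∈ PS G (Function.update s k .unit)) (ha' : a' ∈ PS G (Function.update s k .unit))
    (hz : z ∈ PS G (Function.update s k .zero)) (hz' : z' ∈ PS G (Function.update s k .zero))
    (h : a + z = a' + z') : a = a' ∧ z = z' := by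
  have hd : Disjoint (PS G (Function.update s k .unit)) (PS G (Function.update s k .zero)) := by
    refine Finsupp.disjoint_supported_supported (Set.disjoint_left.mpr fun c h1 h2 => ?_)
    exact (h1 k).1 (by simp) ((h2 k).2 (by simp))
  have e : a - a' = z' - z := by
    rw [sub_eq_sub_iff_add_eq_add, h, add_comm]
  have h0 : a - a' = 0 := Submodule.disjoint_def.mp hd _ (Submodule.sub_mem _ ha ha')
    (e ▸ Submodule.sub_mem _ hz' hz)
  exact ⟨sub_eq_zero.mp h0, (sub_eq_zero.mp (e ▸ h0)).symm⟩

namespace DistData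

variable {D : DistData G}

theorem relMap_act (k : ι) (σ : ∀ i, G i) (x : Symb G →₀ ℤ) :
    D.relMap k (act σ x) = act σ (D.relMap k x) := by
  simp [relMap, delta, coordNorm_act, act_comm _ σ]

theorem coordNorm_relMap {k l : ι} (hkl : k ≠ l) (x : Symb G →₀ ℤ) :
    coordNorm k (D.relMap l x) = D.relMap l (coordNorm k x) := by
  simp [relMap, delta, coordNorm_act, coordNorm_coordNorm hkl]

theorem relMap_mem_KS {s : ι → CoordState} {k : ι} (hk : s k = .both) {y : Symb G →₀ ℤ}
    (hy : y ∈ PS G (Function.update s k .zero)) : D.relMap k y ∈ D.KS s := by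
  suffices h : PS G (Function.update s k .zero) ≤ (D.KS s).comap (D.relMap k) from h hy
  refine PS_induction fun c hc => Submodule.subset_span ?_
  rw [symb_update_zero hk] at hc
  exact ⟨k, c, hk, hc.1, hc.2, rfl⟩

theorem KS_update_unit_le {s : ι → CoordState} {k : ι} (hk : s k = .both) :
    D.KS (Function.update s k .unit) ≤ D.KS s := by
  refine Submodule.span_mono ?_
  rintro _ ⟨l, c, hl, hc, hcl, rfl⟩
  have hlk : l ≠ k := by rintro rfl; simp at hl
  exact ⟨l, c, by simpa [hlk] using hl, ((symb_update_unit hk).mp hc).1, hcl, rfl⟩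

theorem KS_update_zero_le {s : ι → CoordState} {k : ι} (hk : s k = .both) :
    D.KS (Function.update s k .zero) ≤ D.KS s := by
  refine Submodule.span_mono ?_
  rintro _ ⟨l, c, hl, hc, hcl, rfl⟩
  have hlk : l ≠ k := by rintro rfl; simp at hl
  exact ⟨l, c, by simpa [hlk] using hl, ((symb_update_zero hk).mp hc).1, hcl, rfl⟩

theorem act_mem_KS {s : ι → CoordState} (σ : ∀ i, G i) {x : Symb G →₀ ℤ} (hx : x ∈ D.KS s) :
    act σ x ∈ D.KS s := by
  suffices h : D.KS s ≤ (D.KS s).comap (act σ) from h hx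
  refine Submodule.span_le.mpr ?_
  rintro _ ⟨l, c, hl, hc, hcl, rfl⟩
  rw [SetLike.mem_coe, Submodule.mem_comap, ← relMap_act, act_single]
  exact Submodule.subset_span ⟨l, _, hl, twist_mem_symb.mpr hc, twist_eq_zero.mpr hcl, rfl⟩

theorem KS_le_PS (s : ι → CoordState) : D.KS s ≤ PS G s := by
  refine Submodule.span_le.mpr ?_
  rintro _ ⟨l, c, hl, hc, hcl, rfl⟩
  have h0 : Finsupp.single c 1 ∈ PS G (Function.update s l .zero) :=
    single_mem_PS ((symb_update_zero hl).mpr ⟨hc, hcl⟩) 1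
  have h1 : Finsupp.single c (1 : ℤ) ∈ PS G s := single_mem_PS hc 1
  exact Submodule.sub_mem _ (PS_update_unit_le hl (coordNorm_mem_PS h0))
    (Submodule.sub_mem _ (act_mem_PS _ h1) (act_mem_PS _ h1))

theorem coordNorm_mem_KS {s : ι → CoordState} {k : ι} {x : Symb G →₀ ℤ}
    (hx : x ∈ D.KS (Function.update s k .zero)) :
    coordNorm k x ∈ D.KS (Function.update s k .unit) := by
  suffices h : D.KS (Function.update s k .zero) ≤
      (D.KS (Function.update s k .unit)).comap (coordNorm k) from h hx
  refine Submodule.span_le.mpr ?_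
  rintro _ ⟨l, c, hl, hc, hcl, rfl⟩
  have hlk : l ≠ k := by rintro rfl; simp at hl
  rw [SetLike.mem_coe, Submodule.mem_comap, coordNorm_relMap hlk.symm, coordNorm_single, map_sum]
  refine Submodule.sum_mem _ fun g _ => Submodule.subset_span ⟨l, _, ?_, ?_, ?_, rfl⟩
  · simpa [hlk] using hl
  · intro i
    by_cases hi : i = k
    · subst hi; simp
    · simpa [hi] using hc i
  · simpa [hlk] using hcl

/-- A relation in a coordinate other than k preserves whether the k-th coordinate vanishes; one in
coordinate k has unit part N y and zero part -δ y. A relation thus splits into a unit-state and a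
zero-state component linked only by y, and the inductions below compare these components. -/
theorem exists_KS_decomp {s : ι → CoordState} {k : ι} (hk : s k = .both) {x : Symb G →₀ ℤ}
    (hx : x ∈ D.KS s) : ∃ a ∈ D.KS (Function.update s k .unit),
      ∃ z ∈ D.KS (Function.update s k .zero), ∃ y ∈ PS G (Function.update s k .zero),
        x = (a + coordNorm k y) + (z - D.delta k y) := by
  suffices h : D.KS s ≤ (D.KS (Function.update s k .unit) ⊔ D.KS (Function.update s k .zero)) ⊔
      (PS G (Function.update s k .zero)).map (D.relMap k) by
    obtain ⟨b, hb, _, ⟨y, hy, rfl⟩, e⟩ := Submodule.mem_sup.mp (h hx)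
    obtain ⟨a, ha, z, hz, rfl⟩ := Submodule.mem_sup.mp hb
    refine ⟨a, ha, z, hz, y, hy, ?_⟩
    rw [← e, relMap, LinearMap.sub_apply]
    abel
  refine Submodule.span_le.mpr ?_
  rintro _ ⟨l, c, hl, hc, hcl, rfl⟩
  by_cases hlk : l = k
  · subst hlk
    exact Submodule.mem_sup_right ⟨_, single_mem_PS ((symb_update_zero hk).mpr ⟨hc, hcl⟩) 1, rfl⟩
  · refine Submodule.mem_sup_left ?_
    by_cases h : c k = 0
    · exact Submodule.mem_sup_right (Submodule.subset_span
        ⟨l, c, by simpa [hlk] using hl, (symb_update_zero hk).mpr ⟨hc, h⟩, hcl, rfl⟩)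
    · exact Submodule.mem_sup_left (Submodule.subset_span
        ⟨l, c, by simpa [hlk] using hl, (symb_update_unit hk).mpr ⟨hc, h⟩, hcl, rfl⟩)

theorem delta_mem_PS {s : ι → CoordState} (k : ι) {x : Symb G →₀ ℤ} (hx : x ∈ PS G s) :
    D.delta k x ∈ PS G s := Submodule.sub_mem _ (act_mem_PS _ hx) (act_mem_PS _ hx)

theorem delta_mem_KS {s : ι → CoordState} (k : ι) {x : Symb G →₀ ℤ} (hx : x ∈ D.KS s) :
    D.delta k x ∈ D.KS s := Submodule.sub_mem _ (act_mem_KS _ hx) (act_mem_KS _ hx)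

end DistData

/-- Induction on the number of coordinates in state `both`: confining one of them to units or to
zero lowers it. -/
theorem CoordState.induction {p : (ι → CoordState) → Prop}
    (base : ∀ s, (∀ k, s k ≠ .both) → p s)
    (step : ∀ s k, s k = .both → p (Function.update s k .unit) →
      p (Function.update s k .zero) → p s) (s : ι → CoordState) : p s := by
  classical
  suffices h : ∀ n, ∀ s : ι → CoordState, (Finset.univ.filter (fun i => s i = .both)).card = n →
      p s from h _ s rfl
  intro n
  induction n with
  | zero =>
    intro s hs
    refine base s fun k hk => ?_
    rw [Finset.card_eq_zero] at hs
    have : k ∈ Finset.univ.filter (fun i => s i = CoordState.both) := by simp [hk]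
    simp [hs] at this
  | succ n ih =>
    intro s hs
    obtain ⟨k, hk⟩ := Finset.card_pos.mp (by omega :
      0 < (Finset.univ.filter (fun i => s i = CoordState.both)).card)
    have hk' : s k = .both := (Finset.mem_filter.mp hk).2
    have key : ∀ v : CoordState, v ≠ .both →
        (Finset.univ.filter (fun i => Function.update s k v i = .both)).card = n := by
      intro v hv
      have : Finset.univ.filter (fun i => Function.update s k v i = .both) =
          (Finset.univ.filter (fun i => s i = .both)).erase k := by
        ext i
        by_cases hi : i = k
        · subst hi; simp [hv]
        · simp [hi]
      rw [this, Finset.card_erase_of_mem hk, hs]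
      rfl
    exact step s k hk' (ih _ (key _ (by simp))) (ih _ (key _ (by simp)))

end Dist

/-! ### A basis of symbols modulo relations -/

section Dist

variable {ι : Type*} [Fintype ι] [DecidableEq ι] {G : ι → Type*} [∀ i, CommGroup (G i)]
  [∀ i, Fintype (G i)]

/-- The reduced symbols of a state, which form a basis modulo the relations. -/
def reducedSymb (G : ι → Type*) [∀ i, CommGroup (G i)] (s : ι → CoordState) : Set (Symb G) :=
  {c | c ∈ symb G s ∧ ∀ l, s l = .both → c l ≠ 1}

/-- The span of the reduced symbols. -/
def RS (G : ι → Type*) [∀ i, CommGroup (G i)] (s : ι → CoordState) :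
    Submodule ℤ (Symb G →₀ ℤ) := Finsupp.supported ℤ ℤ (reducedSymb G s)

theorem coordNorm_apply_one {s : ι → CoordState} {k : ι} {x : Symb G →₀ ℤ}
    (hx : x ∈ PS G (Function.update s k .zero)) {c : Symb G} (hc : c k = 0) :
    coordNorm k x (Function.update c k 1) = x c := by
  classical
  suffices h : PS G (Function.update s k .zero) ≤
      LinearMap.ker ((Finsupp.lapply (Function.update c k 1)) ∘ₗ coordNorm k -
        (Finsupp.lapply c : (Symb G →₀ ℤ) →ₗ[ℤ] ℤ)) by
    exact sub_eq_zero.mp (h hx)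
  refine PS_induction fun b hb => ?_
  have hbk : b k = 0 := (hb k).2 (by simp)
  rw [LinearMap.mem_ker, LinearMap.sub_apply, LinearMap.comp_apply, coordNorm_single,
    Finsupp.lapply_apply, Finsupp.lapply_apply, Finsupp.finsetSum_apply, sub_eq_zero]
  rw [Finset.sum_eq_single 1]
  · have hiff : Function.update b k ((1 : G k) : WithZero (G k)) = Function.update c k 1 ↔
        b = c := by
      constructor
      · intro h
        ext1 i
        by_cases hi : i = k
        · subst hi; rw [hc, hbk]
        · simpa [hi] using congrFun h i
      · rintro rfl; rw [WithZero.coe_one]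
    simp only [Finsupp.single_apply, hiff]
  · intro g _ hg
    rw [Finsupp.single_apply, if_neg]
    intro h
    have := congrFun h k
    simp only [Function.update_self] at this
    exact hg (WithZero.coe_inj.mp this)
  · simp

theorem eq_zero_of_coordNorm_eq_zero {s : ι → CoordState} {k : ι} {x : Symb G →₀ ℤ}
    (hx : x ∈ PS G (Function.update s k .zero)) (h : coordNorm k x = 0) : x = 0 := by
  ext c
  by_cases hck : c k = 0
  · rw [← coordNorm_apply_one hx hck, h]; rfl
  · by_contra hne
    have := (Finsupp.mem_supported ℤ x).mp hx (Finsupp.mem_support_iff.mpr hne)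
    exact hck ((this k).2 (by simp))

theorem coordNorm_mem_RS {s : ι → CoordState} {k : ι} {x : Symb G →₀ ℤ}
    (hx : x ∈ RS G (Function.update s k .zero)) :
    coordNorm k x ∈ RS G (Function.update s k .unit) := by
  suffices h : RS G (Function.update s k .zero) ≤
      (RS G (Function.update s k .unit)).comap (coordNorm k) from h hx
  rw [RS, Finsupp.supported_eq_span_single, Submodule.span_le]
  rintro _ ⟨c, hc, rfl⟩
  rw [SetLike.mem_coe, Submodule.mem_comap]
  change coordNorm k (Finsupp.single c 1) ∈ _
  rw [coordNorm_single]
  refine Submodule.sum_mem _ fun g _ => Finsupp.single_mem_supported ℤ _ ⟨fun i => ?_, ?_⟩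
  · by_cases hi : i = k
    · subst hi; simp
    · simpa [hi] using hc.1 i
  · intro l hl
    have hlk : l ≠ k := by rintro rfl; simp at hl
    simpa [hlk] using hc.2 l (by simpa [hlk] using hl)

namespace DistData

variable {D : DistData G}

/-- The relation in coordinate k solves for the symbol with k-th coordinate 1 in terms of the other
unit values and of symbols vanishing at k. Doing this in every coordinate leaves reduced symbols. -/
theorem PS_le_RS_sup_KS (s : ι → CoordState) : PS G s ≤ RS G s ⊔ D.KS s := by
  classical
  induction s using CoordState.induction with
  | base s h =>
    refine le_trans (Finsupp.supported_mono fun c hc => ?_) le_sup_left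
    exact ⟨hc, fun l hl => absurd hl (h l)⟩
  | step s k hk hu hz =>
    have hz' : PS G (Function.update s k .zero) ≤ RS G s ⊔ D.KS s := by
      refine hz.trans (sup_le_sup (Finsupp.supported_mono fun c hc => ?_) (KS_update_zero_le hk))
      have hck : c k = 0 := (hc.1 k).2 (by simp)
      refine ⟨((symb_update_zero hk).mp hc.1).1, fun l hl => ?_⟩
      by_cases hlk : l = k
      · subst hlk; simp [hck]
      · exact hc.2 l (by simpa [hlk] using hl)
    have hu' : PS G (Function.update s k .unit) ≤ RS G s ⊔ D.KS s := by
      refine hu.trans (sup_le ?_ ((KS_update_unit_le hk).trans le_sup_right))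
      rw [RS, Finsupp.supported_eq_span_single, Submodule.span_le]
      rintro _ ⟨c, hc, rfl⟩
      have hcs := (symb_update_unit hk).mp hc.1
      have hred : ∀ l, l ≠ k → s l = .both → c l ≠ 1 := fun l hl h =>
        hc.2 l (by simpa [hl] using h)
      by_cases h1 : c k = 1
      · set b : Symb G := Function.update c k 0 with hb
        have hbs : b ∈ symb G (Function.update s k .zero) := by
          intro i
          by_cases hi : i = k
          · subst hi; simp [hb]
          · simpa [hb, hi] using hcs.1 i
        have hrel : Finsupp.single c (1 : ℤ) = D.relMap k (Finsupp.single b 1) +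
            D.delta k (Finsupp.single b 1) - ∑ g ∈ Finset.univ.erase (1 : G k),
              Finsupp.single (Function.update c k (g : WithZero (G k))) 1 := by
          rw [relMap, LinearMap.sub_apply, sub_add_cancel, coordNorm_single, eq_sub_iff_add_eq,
            ← Finset.add_sum_erase _ _ (Finset.mem_univ (1 : G k))]
          simp only [hb, Function.update_idem]
          congr 2
          rw [WithZero.coe_one, ← h1, Function.update_eq_self]
        change Finsupp.single c (1 : ℤ) ∈ _
        rw [hrel]
        have hbP : Finsupp.single b (1 : ℤ) ∈ PS G (Function.update s k .zero) :=
          single_mem_PS hbs 1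
        refine Submodule.sub_mem _ (Submodule.add_mem _ (Submodule.mem_sup_right
          (relMap_mem_KS hk hbP)) (hz' (delta_mem_PS k hbP))) (Submodule.sum_mem _ fun g hg =>
            Submodule.mem_sup_left (Finsupp.single_mem_supported ℤ _ ⟨fun i => ?_, fun l hl => ?_⟩))
        · by_cases hi : i = k
          · subst hi; simp [hk]
          · simpa [hi] using hcs.1 i
        · by_cases hlk : l = k
          · subst hlk
            rw [Function.update_self]
            exact fun h => (Finset.mem_erase.mp hg).1 (WithZero.coe_inj.mp h)
          · simpa [hlk] using hred l hlk hl
      · refine Submodule.mem_sup_left (Finsupp.single_mem_supported ℤ _ ⟨hcs.1, fun l hl => ?_⟩)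
        by_cases hlk : l = k
        · subst hlk; exact h1
        · exact hred l hlk hl
    intro x hx
    obtain ⟨a, ha, z, hz, rfl⟩ := exists_PS_decomp hk hx
    exact Submodule.add_mem _ (hu' ha) (hz' hz)

/-- Split x at coordinate k and replace the linking vector y by a reduced y' modulo relations. By
induction the unit part of x equals N y'. A reduced x has no term with k-th coordinate 1, whereas
the coefficients of N y' there are those of y'; so y' = 0, and both parts of x vanish. -/
theorem eq_zero_of_mem_RS_of_mem_KS (s : ι → CoordState) :
    ∀ x ∈ RS G s, x ∈ D.KS s → x = 0 := by
  induction s using CoordState.induction with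
  | base s h =>
    intro x _ hx
    have : D.KS s = ⊥ := by
      rw [KS, Submodule.span_eq_bot]
      rintro _ ⟨k, c, hk, -⟩
      exact absurd hk (h k)
    simpa [this] using hx
  | step s k hk hu hz =>
    intro x hxR hxK
    obtain ⟨a, ha, z, hz', y, hy, rfl⟩ := exists_KS_decomp hk hxK
    obtain ⟨y', hy', κ, hκ, rfl⟩ := Submodule.mem_sup.mp (PS_le_RS_sup_KS (D := D) _ hy)
    have hy'P : y' ∈ PS G (Function.update s k .zero) :=
      Finsupp.supported_mono (fun c hc => hc.1) hy'
    -- split the support of `x` according to the `k`-th coordinate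
    obtain ⟨xa, hxa, xz, hxz, e⟩ : ∃ xa ∈ Finsupp.supported ℤ ℤ {c | c ∈ reducedSymb G s ∧ c k ≠ 0},
        ∃ xz ∈ Finsupp.supported ℤ ℤ {c | c ∈ reducedSymb G s ∧ c k = 0},
          (a + coordNorm k (y' + κ)) + (z - D.delta k (y' + κ)) = xa + xz := by
      have : RS G s ≤ Finsupp.supported ℤ ℤ {c | c ∈ reducedSymb G s ∧ c k ≠ 0} ⊔
          Finsupp.supported ℤ ℤ {c | c ∈ reducedSymb G s ∧ c k = 0} := by
        rw [← Finsupp.supported_union]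
        refine Finsupp.supported_mono fun c hc => ?_
        by_cases h : c k = 0
        · exact Or.inr ⟨hc, h⟩
        · exact Or.inl ⟨hc, h⟩
      obtain ⟨xa, hxa, xz, hxz, e⟩ := Submodule.mem_sup.mp (this hxR)
      exact ⟨xa, hxa, xz, hxz, e.symm⟩
    have hxaP : xa ∈ PS G (Function.update s k .unit) :=
      Finsupp.supported_mono (fun c hc => (symb_update_unit hk).mpr ⟨hc.1.1, hc.2⟩) hxa
    have hxzP : xz ∈ PS G (Function.update s k .zero) :=
      Finsupp.supported_mono (fun c hc => (symb_update_zero hk).mpr ⟨hc.1.1, hc.2⟩) hxz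
    obtain ⟨e1, e2⟩ := PS_decomp_unique
      (Submodule.add_mem _ (KS_le_PS _ ha) (coordNorm_mem_PS hy)) hxaP
      (Submodule.sub_mem _ (KS_le_PS _ hz') (delta_mem_PS k hy)) hxzP e
    have hred : ∀ c : Symb G, c ∈ symb G s → (∀ l, l ≠ k → s l = .both → c l ≠ 1) → c k ≠ 0 →
        c ∈ reducedSymb G (Function.update s k .unit) := by
      refine fun c hc h h0 => ⟨(symb_update_unit hk).mpr ⟨hc, h0⟩, fun l hl => ?_⟩
      have hlk : l ≠ k := by rintro rfl; simp at hl
      exact h l hlk (by simpa [hlk] using hl)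
    have hxaR : xa ∈ RS G (Function.update s k .unit) :=
      Finsupp.supported_mono (fun c hc => hred c hc.1.1 (fun l _ h => hc.1.2 l h) hc.2) hxa
    have hzero : xa - coordNorm k y' = 0 := by
      refine hu _ (Submodule.sub_mem _ hxaR (coordNorm_mem_RS hy')) ?_
      rw [← e1, map_add]
      have : a + (coordNorm k y' + coordNorm k κ) - coordNorm k y' = a + coordNorm k κ := by abel
      rw [this]
      exact Submodule.add_mem _ ha (coordNorm_mem_KS hκ)
    have hy0 : y' = 0 := by
      ext c
      by_cases hck : c k = 0
      · rw [← coordNorm_apply_one hy'P hck, ← sub_eq_zero.mp hzero]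
        by_contra hne
        have : Function.update c k 1 ∈ {c | c ∈ reducedSymb G s ∧ c k ≠ 0} :=
          (Finsupp.mem_supported ℤ xa).mp hxa (Finsupp.mem_support_iff.mpr hne)
        exact this.1.2 k hk (by simp)
      · by_contra hne
        have := (Finsupp.mem_supported ℤ y').mp hy'P (Finsupp.mem_support_iff.mpr hne)
        exact hck ((this k).2 (by simp))
    subst hy0
    have hxa0 : xa = 0 := by simpa using hzero
    have hxz0 : xz = 0 := by
      refine hz _ (Finsupp.supported_mono (fun c hc => (?_ : c ∈ reducedSymb G _)) hxz) ?_
      · refine ⟨(symb_update_zero hk).mpr ⟨hc.1.1, hc.2⟩, fun l hl => ?_⟩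
        have hlk : l ≠ k := by rintro rfl; simp at hl
        exact hc.1.2 l (by simpa [hlk] using hl)
      · rw [← e2, zero_add]
        exact Submodule.sub_mem _ hz' (delta_mem_KS k hκ)
    rw [e, hxa0, hxz0, add_zero]

/-- The norm is injective modulo relations: it sends reduced symbols to sums of reduced symbols,
which are independent of the relations, and it is injective before passing to the quotient. -/
theorem mem_KS_of_coordNorm_mem {s : ι → CoordState} {k : ι} {y : Symb G →₀ ℤ}
    (hy : y ∈ PS G (Function.update s k .zero))
    (h : coordNorm k y ∈ D.KS (Function.update s k .unit)) :
    y ∈ D.KS (Function.update s k .zero) := by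
  obtain ⟨y', hy', κ, hκ, rfl⟩ := Submodule.mem_sup.mp (PS_le_RS_sup_KS (D := D) _ hy)
  have hy'P : y' ∈ PS G (Function.update s k .zero) :=
    Finsupp.supported_mono (fun c hc => hc.1) hy'
  have h0 : coordNorm k y' = 0 := by
    refine eq_zero_of_mem_RS_of_mem_KS (D := D) _ _ (coordNorm_mem_RS hy') ?_
    rw [map_add] at h
    exact (Submodule.add_mem_iff_left _ (coordNorm_mem_KS hκ)).mp h
  rw [eq_zero_of_coordNorm_eq_zero hy'P h0, zero_add]
  exact hκ

end DistData

end Dist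

/-! ### Tate cohomology of the involution on symbols modulo relations -/

section Dist

variable {ι : Type*} [Fintype ι] [DecidableEq ι] {G : ι → Type*} [∀ i, CommGroup (G i)]
  [∀ i, Fintype (G i)]

namespace DistData

variable {D : DistData G}

theorem act_j_act_j (x : Symb G →₀ ℤ) : act D.j (act D.j x) = x := by
  rw [act_act, show D.j * D.j = 1 from funext D.j_mul, one_act]

theorem act_j_delta (k : ι) (x : Symb G →₀ ℤ) :
    act D.j (D.delta k x) = D.delta k (act D.j x) := by
  simp [delta, act_comm D.j]

/-- In the presence of a coordinate that takes only unit values, every eigenvector of the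
involution modulo the relations is a trace. -/
theorem exists_trace_of_eigen (s : ι → CoordState) : (∃ i, s i = .unit) → ∀ η : ℤ, η * η = 1 →
    ∀ w ∈ PS G s, act D.j w - η • w ∈ D.KS s →
      ∃ v ∈ PS G s, w - (v + η • act D.j v) ∈ D.KS s := by
  classical
  induction s using CoordState.induction with
  | base s h =>
    rintro ⟨i, hi⟩ η hη w hw hJ
    have hK : D.KS s = ⊥ := by
      rw [KS, Submodule.span_eq_bot]
      rintro _ ⟨k, c, hk, -⟩
      exact absurd hk (h k)
    rw [hK, Submodule.mem_bot, sub_eq_zero] at hJ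
    -- With no relations left and a unit coordinate i, the involution acts freely on the symbols.
    -- The half system at i selects one symbol from each orbit, and the part of w on the selected
    -- symbols has w as its trace.
    set p : Symb G → Prop := fun c => ∃ g ∈ D.H i, c i = (g : WithZero (G i)) with hp
    have hpj : ∀ c : Symb G, c i ≠ 0 → (p c ↔ ¬ p (twist D.j c)) := by
      intro c hc
      obtain ⟨g, hg⟩ := WithZero.ne_zero_iff_exists.mp hc
      have h1 : p c ↔ g ∈ D.H i := by
        simp only [hp, ← hg]
        constructor
        · rintro ⟨g', hg', e⟩; rwa [WithZero.coe_inj.mp e]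
        · exact fun h => ⟨g, h, rfl⟩
      have h2 : p (twist D.j c) ↔ D.j i * g ∈ D.H i := by
        simp only [hp, twist_apply, ← hg, ← WithZero.coe_mul]
        constructor
        · rintro ⟨g', hg', e⟩; rwa [WithZero.coe_inj.mp e]
        · exact fun h => ⟨_, h, rfl⟩
      rw [h1, h2]
      exact D.mem_H i g
    have hJapp : ∀ (x : Symb G →₀ ℤ) (c : Symb G), act D.j x c = x (twist D.j c) := by
      intro x c
      have hinv : Function.Injective (twist D.j) := by
        intro a b hab
        have := congrArg (twist D.j) hab
        rwa [twist_twist, twist_twist, show D.j * D.j = 1 from funext D.j_mul, one_twist,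
          one_twist] at this
      have e : c = twist D.j (twist D.j c) := by
        rw [twist_twist, show D.j * D.j = 1 from funext D.j_mul, one_twist]
      conv_lhs => rw [e]
      exact Finsupp.mapDomain_apply hinv x _
    have hunit : ∀ c, w c ≠ 0 → c i ≠ 0 := fun c hc =>
      (((Finsupp.mem_supported ℤ w).mp hw (Finsupp.mem_support_iff.mpr hc)) i).1 hi
    refine ⟨w.filter p, ?_, ?_⟩
    · refine (Finsupp.mem_supported ℤ _).mpr fun c hc => (Finsupp.mem_supported ℤ w).mp hw ?_
      rw [Finset.mem_coe, Finsupp.support_filter, Finset.mem_filter] at hc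
      exact hc.1
    · rw [hK, Submodule.mem_bot, sub_eq_zero]
      ext c
      have hc := hJapp w c
      rw [hJ, Finsupp.smul_apply, smul_eq_mul] at hc
      rw [Finsupp.add_apply, Finsupp.smul_apply, hJapp, Finsupp.filter_apply, Finsupp.filter_apply,
        smul_eq_mul]
      by_cases h0 : w c = 0
      · rw [← hc, h0]; simp
      · have := hpj c (hunit c h0)
        by_cases hpc : p c
        · rw [if_pos hpc, if_neg (this.mp hpc)]; simp
        · rw [if_neg hpc, if_pos (not_not.mp fun h => hpc (this.mpr h)), ← hc, ← mul_assoc, hη]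
          simp
  | step s k hk hu hz =>
    rintro ⟨i, hi⟩ η hη w hw hJ
    have hik : i ≠ k := by rintro rfl; rw [hi] at hk; cases hk
    have hη' : -η * -η = 1 := by simpa using hη
    obtain ⟨a, ha, z, hz', rfl⟩ := exists_PS_decomp hk hw
    obtain ⟨κa, hκa, κz, hκz, y, hy, e⟩ := exists_KS_decomp hk hJ
    obtain ⟨e1, e2⟩ := PS_decomp_unique
      (Submodule.sub_mem _ (act_mem_PS D.j ha) (Submodule.smul_mem _ η ha))
      (Submodule.add_mem _ (KS_le_PS _ hκa) (coordNorm_mem_PS hy))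
      (Submodule.sub_mem _ (act_mem_PS D.j hz') (Submodule.smul_mem _ η hz'))
      (Submodule.sub_mem _ (KS_le_PS _ hκz) (delta_mem_PS k hy))
      (by rw [← e, map_add, smul_add]; abel)
    -- Applying J + η to the equation for a annihilates its left side, so N(Jy + ηy) is a relation.
    -- Injectivity of the norm makes y an eigenvector of the opposite sign -η.
    have hyJ : act D.j y - (-η) • y ∈ D.KS (Function.update s k .zero) := by
      refine mem_KS_of_coordNorm_mem
        (Submodule.sub_mem _ (act_mem_PS _ hy) (Submodule.smul_mem _ _ hy)) ?_
      have : coordNorm k (act D.j y - (-η) • y) = -(act D.j κa + η • κa) := by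
        have hN : coordNorm k y = act D.j a - η • a - κa := by rw [e1]; abel
        rw [map_sub, coordNorm_act, map_smul, hN, map_sub, map_sub, map_smul, act_j_act_j]
        linear_combination (norm := module) -hη • a
      rw [this]
      exact Submodule.neg_mem _ (Submodule.add_mem _ (act_mem_KS _ hκa)
        (Submodule.smul_mem _ _ hκa))
    obtain ⟨u, hu1, hu2⟩ := hz ⟨i, by simpa [hik] using hi⟩ (-η) hη' y hy hyJ
    -- Since y ≡ u - ηJu, the vectors a + ηNu and z - ηδu are η-eigenvectors in their own states,
    -- hence traces by induction. The total correction η(Nu - δu) is itself a relation.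
    have hN1 := coordNorm_mem_KS hu2
    have hd1 := delta_mem_KS (D := D) k hu2
    obtain ⟨v1, hv1, hv1'⟩ := hu ⟨i, by simpa [hik] using hi⟩ η hη (a + η • coordNorm k u)
      (Submodule.add_mem _ ha (Submodule.smul_mem _ _ (coordNorm_mem_PS hu1))) (by
        have : act D.j (a + η • coordNorm k u) - η • (a + η • coordNorm k u) =
            κa + coordNorm k (y - (u + -η • act D.j u)) := by
          simp only [map_add, map_sub, map_smul, coordNorm_act]
          linear_combination (norm := module) e1 - hη • coordNorm k u
        rw [this]
        exact Submodule.add_mem _ hκa hN1)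
    obtain ⟨v2, hv2, hv2'⟩ := hz ⟨i, by simpa [hik] using hi⟩ η hη (z - η • D.delta k u)
      (Submodule.sub_mem _ hz' (Submodule.smul_mem _ _ (delta_mem_PS k hu1))) (by
        have : act D.j (z - η • D.delta k u) - η • (z - η • D.delta k u) =
            κz - D.delta k (y - (u + -η • act D.j u)) := by
          simp only [map_add, map_sub, map_smul, act_j_delta]
          linear_combination (norm := module) e2 + hη • D.delta k u
        rw [this]
        exact Submodule.sub_mem _ hκz hd1)
    refine ⟨v1 + v2, Submodule.add_mem _ (PS_update_unit_le hk hv1) (PS_update_zero_le hk hv2), ?_⟩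
    have : a + z - (v1 + v2 + η • act D.j (v1 + v2)) =
        (a + η • coordNorm k u - (v1 + η • act D.j v1)) +
        (z - η • D.delta k u - (v2 + η • act D.j v2)) - η • D.relMap k u := by
      rw [relMap, LinearMap.sub_apply, map_add]
      module
    rw [this]
    exact Submodule.sub_mem _ (Submodule.add_mem _ (KS_update_unit_le hk hv1')
      (KS_update_zero_le hk hv2')) (Submodule.smul_mem _ _ (relMap_mem_KS hk hu1))

/-- The submodule generated by traces and relations. -/
def traceSub (D : DistData G) (s : ι → CoordState) (η : ℤ) : Submodule ℤ (Symb G →₀ ℤ) :=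
  (PS G s).map (LinearMap.id + η • act D.j) ⊔ D.KS s

theorem mem_traceSub {s : ι → CoordState} {η : ℤ} {x : Symb G →₀ ℤ} :
    x ∈ D.traceSub s η ↔ ∃ v ∈ PS G s, x - (v + η • act D.j v) ∈ D.KS s := by
  constructor
  · intro h
    obtain ⟨_, ⟨v, hv, rfl⟩, κ, hκ, rfl⟩ := Submodule.mem_sup.mp h
    refine ⟨v, hv, ?_⟩
    simpa using hκ
  · rintro ⟨v, hv, h⟩
    refine Submodule.mem_sup.mpr ⟨_, ⟨v, hv, rfl⟩, _, h, ?_⟩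
    simp

theorem act_mem_traceSub {s : ι → CoordState} {η : ℤ} {x : Symb G →₀ ℤ} (σ : ∀ i, G i)
    (hx : x ∈ D.traceSub s η) : act σ x ∈ D.traceSub s η := by
  obtain ⟨v, hv, h⟩ := mem_traceSub.mp hx
  refine mem_traceSub.mpr ⟨act σ v, act_mem_PS σ hv, ?_⟩
  have := act_mem_KS σ h
  rwa [map_sub, map_add, map_smul, act_comm σ] at this

theorem act_mulSingle_of_mem_PS_zero {s : ι → CoordState} {k : ι} (hk : s k = .zero) (g : G k)
    {x : Symb G →₀ ℤ} (hx : x ∈ PS G s) : act (Pi.mulSingle k g) x = x := by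
  suffices h : PS G s ≤ LinearMap.ker (act (Pi.mulSingle k g) - LinearMap.id) from
    sub_eq_zero.mp (h hx)
  refine PS_induction fun c hc => ?_
  rw [LinearMap.mem_ker, LinearMap.sub_apply, act_single, LinearMap.id_apply, sub_eq_zero]
  congr 1
  ext1 i
  by_cases hi : i = k
  · subst hi; simp [twist, (hc i).2 hk]
  · simp [twist, hi]

/-- The tuples act trivially on the cohomology of the involution. -/
theorem act_sub_mem_traceSub {s : ι → CoordState} {η : ℤ} (hη : η * η = 1) {y : Symb G →₀ ℤ}
    (hy : y ∈ PS G s) (hJ : act D.j y - η • y ∈ D.KS s) (σ : ∀ i, G i) :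
    act σ y - y ∈ D.traceSub s η := by
  classical
  have hsingle : ∀ k (g : G k), act (Pi.mulSingle k g) y - y ∈ D.traceSub s η := by
    intro k g
    cases hk : s k with
    | unit =>
      have : y ∈ D.traceSub s η := mem_traceSub.mpr (exists_trace_of_eigen s ⟨k, hk⟩ η hη y hy hJ)
      exact Submodule.sub_mem _ (act_mem_traceSub _ this) this
    | zero =>
      rw [act_mulSingle_of_mem_PS_zero hk g hy, sub_self]
      exact Submodule.zero_mem _
    | both =>
      -- The zero part z is fixed by an element supported at k. On the unit part, the element minus
      -- 1 kills the norm term linking the two parts, so the difference is an eigenvector in a state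
      -- with a unit coordinate, hence a trace.
      obtain ⟨a, ha, z, hz, rfl⟩ := exists_PS_decomp hk hy
      obtain ⟨κa, hκa, κz, hκz, x, hx, e⟩ := exists_KS_decomp hk hJ
      obtain ⟨e1, e2⟩ := PS_decomp_unique
        (Submodule.sub_mem _ (act_mem_PS D.j ha) (Submodule.smul_mem _ η ha))
        (Submodule.add_mem _ (KS_le_PS _ hκa) (coordNorm_mem_PS hx))
        (Submodule.sub_mem _ (act_mem_PS D.j hz) (Submodule.smul_mem _ η hz))
        (Submodule.sub_mem _ (KS_le_PS _ hκz) (delta_mem_PS k hx))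
        (by rw [← e, map_add, smul_add]; abel)
      rw [map_add, act_mulSingle_of_mem_PS_zero (by simp) g hz, add_sub_add_right_eq_sub]
      obtain ⟨v, hv, hv'⟩ := exists_trace_of_eigen (D := D) (Function.update s k .unit)
        ⟨k, by simp⟩ η hη (act (Pi.mulSingle k g) a - a)
        (Submodule.sub_mem _ (act_mem_PS _ ha) ha) (by
          have : act D.j (act (Pi.mulSingle k g) a - a) - η • (act (Pi.mulSingle k g) a - a) =
              act (Pi.mulSingle k g) κa - κa := by
            have e3 := congrArg (act (Pi.mulSingle k g)) e1
            rw [map_sub, map_add, map_smul, act_mulSingle_coordNorm, act_comm _ D.j] at e3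
            rw [map_sub]
            linear_combination (norm := module) e3 - e1
          rw [this]
          exact Submodule.sub_mem _ (act_mem_KS _ hκa) hκa)
      exact mem_traceSub.mpr ⟨v, PS_update_unit_le hk hv, KS_update_unit_le hk hv'⟩
  have hprod : ∀ S : Finset ι, act (∏ k ∈ S, Pi.mulSingle k (σ k)) y - y ∈ D.traceSub s η := by
    intro S
    induction S using Finset.induction_on with
    | empty => simp [one_act]
    | insert k S hkS ih =>
      rw [Finset.prod_insert hkS, mul_comm, ← act_act]
      have := Submodule.add_mem _
        (act_mem_traceSub (∏ k ∈ S, Pi.mulSingle k (σ k)) (hsingle k (σ k))) ih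
      rwa [map_sub, sub_add_sub_cancel] at this
  have := hprod Finset.univ
  rwa [Finset.univ_prod_mulSingle] at this

end DistData

end Dist

/-! ### An eigenvector of the involution with odd leading parity -/

section Dist

variable {ι : Type*} [Fintype ι] [DecidableEq ι] {G : ι → Type*} [∀ i, CommGroup (G i)]
  [∀ i, Fintype (G i)]

/-- The state in which exactly the coordinates in `B` may be nonzero. -/
def stateOf (B : Finset ι) : ι → CoordState := fun i => if i ∈ B then .both else .zero

theorem update_stateOf_insert {B : Finset ι} {k : ι} (hk : k ∉ B) :
    Function.update (stateOf (insert k B)) k .zero = stateOf B := by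
  ext1 i
  by_cases hi : i = k
  · subst hi; simp [stateOf, hk]
  · simp [stateOf, hi]

namespace DistData

variable (D : DistData G)

theorem j_ne_one (i : ι) : D.j i ≠ 1 := by
  intro h
  have := D.mem_H i 1
  rw [h, mul_one] at this
  tauto

/-- The coordinates in `B` of the symbol `c` are fixed up to the involution. -/
def IsSign (B : Finset ι) (c : Symb G) : Prop :=
  ∀ i ∈ B, c i = 1 ∨ c i = (D.j i : WithZero (G i))

/-- As `IsSign`, and the `k`-th coordinate is `1`. -/
def IsSignOne (B : Finset ι) (k : ι) (c : Symb G) : Prop := c k = 1 ∧ D.IsSign B c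

open scoped Classical in
/-- The number modulo 2 of terms with all coordinates in `B` equal to `1` or `j`. -/
def parity (B : Finset ι) : (Symb G →₀ ℤ) →ₗ[ℤ] ZMod 2 :=
  Finsupp.linearCombination ℤ (fun c => if D.IsSign B c then 1 else 0)

open scoped Classical in
/-- As `parity`, but with `k`-th coordinate equal to `1`. -/
def parityOne (B : Finset ι) (k : ι) : (Symb G →₀ ℤ) →ₗ[ℤ] ZMod 2 :=
  Finsupp.linearCombination ℤ (fun c => if D.IsSignOne B k c then 1 else 0)

variable {D}

open scoped Classical in
theorem parity_single (B : Finset ι) (c : Symb G) :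
    D.parity B (Finsupp.single c 1) = if D.IsSign B c then 1 else 0 := by
  simp [parity]

open scoped Classical in
theorem parityOne_single (B : Finset ι) (k : ι) (c : Symb G) :
    D.parityOne B k (Finsupp.single c 1) = if D.IsSignOne B k c then 1 else 0 := by
  simp [parityOne]

theorem j_mul_eq_one {i : ι} {x : WithZero (G i)} :
    (D.j i : WithZero (G i)) * x = 1 ↔ x = (D.j i : WithZero (G i)) := by
  have hj : (D.j i : WithZero (G i)) * D.j i = 1 := by
    rw [← WithZero.coe_mul, D.j_mul, WithZero.coe_one]
  constructor
  · intro h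
    rw [← mul_one (D.j i : WithZero (G i)), ← h, ← mul_assoc, hj, one_mul]
  · rintro rfl; exact hj

theorem j_mul_eq_j {i : ι} {x : WithZero (G i)} :
    (D.j i : WithZero (G i)) * x = (D.j i : WithZero (G i)) ↔ x = 1 := by
  rw [mul_eq_left₀ WithZero.coe_ne_zero]

theorem isSign_twist_j {B : Finset ι} {c : Symb G} : D.IsSign B (twist D.j c) ↔ D.IsSign B c := by
  refine forall₂_congr fun i _ => ?_
  rw [twist_apply, j_mul_eq_one, j_mul_eq_j, or_comm]

theorem isSign_update_of_notMem {B : Finset ι} {k : ι} (hk : k ∉ B) {c : Symb G}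
    {x : WithZero (G k)} : D.IsSign B (Function.update c k x) ↔ D.IsSign B c := by
  refine forall₂_congr fun i hi => ?_
  have : i ≠ k := by rintro rfl; exact hk hi
  simp [this]

theorem not_isSign_of_eq_zero {B : Finset ι} {k : ι} (hk : k ∈ B) {c : Symb G} (hc : c k = 0) :
    ¬ D.IsSign B c := by
  intro h
  rcases h k hk with h | h <;> rw [hc] at h
  · exact zero_ne_one h
  · exact WithZero.coe_ne_zero h.symm

theorem parityOne_coordNorm {B : Finset ι} {k : ι} (hk : k ∉ B) (y : Symb G →₀ ℤ) :
    D.parityOne B k (coordNorm k y) = D.parity B y := by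
  classical
  rw [← LinearMap.comp_apply]
  refine finsupp_linearMap_ext (fun c => ?_) y
  rw [LinearMap.comp_apply, coordNorm_single, map_sum, parity_single, Finset.sum_eq_single 1]
  · have h1 : Function.update c k ((1 : G k) : WithZero (G k)) k = 1 := by
      rw [Function.update_self, WithZero.coe_one]
    have h2 : D.IsSignOne B k (Function.update c k ((1 : G k) : WithZero (G k))) ↔
        D.IsSign B c := by
      rw [IsSignOne, isSign_update_of_notMem hk, and_iff_right h1]
    rw [parityOne_single]
    simp only [h2]
  · intro g _ hg
    rw [parityOne_single, if_neg]
    rintro ⟨h, -⟩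
    rw [Function.update_self] at h
    exact hg (WithZero.coe_inj.mp h)
  · simp

/-- Of a symbol and its image under the involution, exactly one has k-th coordinate 1 if that
coordinate is 1 or j, and neither otherwise. The sign η is invisible modulo 2. -/
theorem parityOne_trace {B : Finset ι} {k : ι} {η : ℤ} (hη : η * η = 1)
    (v : Symb G →₀ ℤ) :
    D.parityOne B k (v + η • act D.j v) = D.parity (insert k B) v := by
  classical
  have hη2 : ((η : ℤ) : ZMod 2) = 1 := by
    rcases mul_self_eq_one_iff.mp hη with rfl | rfl <;> decide
  have : D.parityOne B k ∘ₗ (LinearMap.id + η • act D.j) = D.parity (insert k B) := by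
    refine LinearMap.ext fun x => finsupp_linearMap_ext (fun c => ?_) x
    rw [LinearMap.comp_apply, LinearMap.add_apply, LinearMap.id_apply, LinearMap.smul_apply,
      map_add, map_smul, act_single, parityOne_single, parityOne_single, parity_single,
      zsmul_eq_mul, hη2, one_mul]
    have htw : D.IsSignOne B k (twist D.j c) ↔
        c k = (D.j k : WithZero (G k)) ∧ D.IsSign B c := by
      rw [IsSignOne, isSign_twist_j, twist_apply, j_mul_eq_one]
    have hone : D.IsSignOne B k c ↔ c k = 1 ∧ D.IsSign B c := Iff.rfl
    have hins : D.IsSign (insert k B) c ↔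
        (c k = 1 ∨ c k = (D.j k : WithZero (G k))) ∧ D.IsSign B c := by
      simp [IsSign]
    have hne : ¬ (c k = 1 ∧ c k = (D.j k : WithZero (G k))) := by
      rintro ⟨h1, h2⟩
      rw [h1] at h2
      exact D.j_ne_one k (WithZero.coe_inj.mp h2.symm)
    simp only [hins, htw, hone]
    by_cases h1 : c k = 1 <;> by_cases h2 : c k = (D.j k : WithZero (G k)) <;>
      by_cases h3 : D.IsSign B c <;> simp_all
  rw [← this]
  rfl

/-- In a relation at l ∈ B, the twist terms vanish at l and are not counted, while the norm
contributes both values 1 and j at l or none: an even number in either case. -/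
theorem parityOne_KS {B : Finset ι} {k : ι} (hk : k ∉ B) {x : Symb G →₀ ℤ}
    (hx : x ∈ D.KS (Function.update (stateOf (insert k B)) k .unit)) :
    D.parityOne B k x = 0 := by
  classical
  suffices h : D.KS (Function.update (stateOf (insert k B)) k .unit) ≤
      LinearMap.ker (D.parityOne B k) from h hx
  refine Submodule.span_le.mpr ?_
  rintro _ ⟨l, c, hl, hc, hcl, rfl⟩
  have hlk : l ≠ k := by rintro rfl; simp at hl
  have hlB : l ∈ B := by
    by_contra h
    simp [stateOf, hlk, h] at hl
  have hact : ∀ σ : ∀ i, G i, D.parityOne B k (Finsupp.single (twist σ c) 1) = 0 := by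
    intro σ
    rw [parityOne_single, if_neg]
    exact fun h => not_isSign_of_eq_zero hlB (twist_eq_zero.mpr hcl) h.2
  rw [SetLike.mem_coe, LinearMap.mem_ker, relMap, delta, LinearMap.sub_apply, LinearMap.sub_apply,
    act_single, act_single, map_sub, map_sub, hact, hact, sub_zero, sub_zero, coordNorm_single,
    map_sum]
  simp_rw [parityOne_single]
  by_cases hrest : c k = 1 ∧ D.IsSign (B.erase l) c
  · have : ∀ g : G l, D.IsSignOne B k (Function.update c l (g : WithZero (G l))) ↔
        g = 1 ∨ g = D.j l := by
      intro g
      rw [IsSignOne, Function.update_of_ne hlk.symm, ← Finset.insert_erase hlB]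
      constructor
      · rintro ⟨-, h⟩
        have := h l (Finset.mem_insert_self _ _)
        rw [Function.update_self] at this
        exact this.imp (fun h => WithZero.coe_inj.mp h) (fun h => WithZero.coe_inj.mp h)
      · intro h
        refine ⟨hrest.1, fun i hi => ?_⟩
        by_cases hil : i = l
        · subst hil
          rw [Function.update_self]
          exact h.imp (fun h => by rw [h, WithZero.coe_one]) (fun h => by rw [h])
        · rw [Function.update_of_ne hil]
          exact hrest.2 i ((Finset.mem_insert.mp hi).resolve_left hil)
    simp_rw [this]
    rw [Finset.sum_ite, Finset.sum_const_zero, add_zero, Finset.sum_const]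
    have h2 : (Finset.univ.filter fun g : G l => g = 1 ∨ g = D.j l) = {1, D.j l} := by
      ext g; simp
    rw [h2, Finset.card_pair (D.j_ne_one l).symm]
    decide
  · refine Finset.sum_eq_zero fun g _ => if_neg ?_
    rintro ⟨h1, h2⟩
    refine hrest ⟨by rwa [Function.update_of_ne hlk.symm] at h1, fun i hi => ?_⟩
    have := h2 i (Finset.mem_of_mem_erase hi)
    rwa [Function.update_of_ne (Finset.ne_of_mem_erase hi)] at this

theorem parity_of_mem_PS_zero {B : Finset ι} {k : ι} {s : ι → CoordState} (hs : s k = .zero)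
    {x : Symb G →₀ ℤ} (hx : x ∈ PS G s) : D.parity (insert k B) x = 0 := by
  suffices h : PS G s ≤ LinearMap.ker (D.parity (insert k B)) from h hx
  refine PS_induction fun c hc => ?_
  rw [LinearMap.mem_ker, parity_single, if_neg]
  exact not_isSign_of_eq_zero (Finset.mem_insert_self _ _) ((hc k).2 hs)

/-- For every set of coordinates there is an eigenvector of the involution modulo relations whose
leading part has odd parity. -/
theorem exists_eigen_of_odd_parity (D : DistData G) (B : Finset ι) :
    ∃ x ∈ PS G (stateOf B), act D.j x - (-1) ^ B.card • x ∈ D.KS (stateOf B) ∧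
      D.parity B x = 1 := by
  classical
  induction B using Finset.induction_on with
  | empty =>
    refine ⟨Finsupp.single 0 1, single_mem_PS (fun i => by simp [stateOf]) 1, ?_, ?_⟩
    · rw [act_single]
      have : twist D.j (0 : Symb G) = 0 := by ext1 i; simp [twist]
      rw [this]
      simp
    · rw [parity_single, if_pos]
      simp [IsSign]
  | insert k B hk ih =>
    obtain ⟨y, hy, hJ, hpar⟩ := ih
    set η : ℤ := (-1) ^ B.card with hηdef
    have hη : η * η = 1 := by
      rw [hηdef, ← mul_pow]; simp
    set s := stateOf (insert k B) with hs
    have hsz : stateOf B = Function.update s k .zero := (update_stateOf_insert hk).symm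
    have hsk : s k = .both := by simp [hs, stateOf]
    rw [hsz] at hy hJ
    obtain ⟨w, hw, hw'⟩ := exists_trace_of_eigen (D := D) (Function.update s k .unit)
      ⟨k, by simp⟩ η hη (coordNorm k y) (coordNorm_mem_PS hy) (by
        rw [← coordNorm_act, ← map_smul, ← map_sub]
        exact coordNorm_mem_KS hJ)
    -- Tuples act trivially on the cohomology, so the two twists of y agree there and δy is a trace.
    have hdel : D.delta k y ∈ D.traceSub (Function.update s k .zero) η := by
      have := Submodule.sub_mem _ (act_sub_mem_traceSub hη hy hJ (D.A k))
        (act_sub_mem_traceSub hη hy hJ (D.B k))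
      rwa [sub_sub_sub_cancel_right] at this
    obtain ⟨u, hu, hu'⟩ := mem_traceSub.mp hdel
    -- From Ny ≡ w + ηJw and δy ≡ u + ηJu one gets J(w - u) + η(w - u) ≡ η(Ny - δy) ≡ 0, so the sign
    -- changes with each added coordinate. Parity ignores u, which vanishes at k, and the parity of
    -- w equals that of y by counting the terms of Ny with k-th coordinate 1.
    refine ⟨w - u, Submodule.sub_mem _ (PS_update_unit_le hsk hw) (PS_update_zero_le hsk hu),
      ?_, ?_⟩
    · rw [Finset.card_insert_of_notMem hk, pow_succ, ← hηdef]
      have : act D.j (w - u) - (η * -1) • (w - u) = η • (D.relMap k y -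
          (coordNorm k y - (w + η • act D.j w)) + (D.delta k y - (u + η • act D.j u))) := by
        rw [relMap, LinearMap.sub_apply, map_sub]
        linear_combination (norm := module) -hη • act D.j w + hη • act D.j u
      rw [this]
      exact Submodule.smul_mem _ _ (Submodule.add_mem _ (Submodule.sub_mem _
        (relMap_mem_KS hsk hy) (KS_update_unit_le hsk hw')) (KS_update_zero_le hsk hu'))
    · rw [map_sub, parity_of_mem_PS_zero (k := k) (by simp) hu, sub_zero,
        ← parityOne_trace hη, ← hpar, ← parityOne_coordNorm hk]
      have := parityOne_KS hk hw'
      rw [map_sub, sub_eq_zero] at this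
      exact this.symm

end DistData

end Dist

/-! ### Generation of odd distributions by the index set -/

section Generation

variable {ι : Type*} [Fintype ι] [LinearOrder ι] {G : ι → Type*} [∀ i, CommGroup (G i)]
  [∀ i, Fintype (G i)]

open scoped Classical in
/-- The set of nonzero coordinates of a symbol. -/
def symbSupp (c : Symb G) : Finset ι := Finset.univ.filter (fun i => c i ≠ 0)

theorem mem_symbSupp {c : Symb G} {i : ι} : i ∈ symbSupp c ↔ c i ≠ 0 := by
  simp [symbSupp]

theorem symbSupp_twist (σ : ∀ i, G i) (c : Symb G) : symbSupp (twist σ c) = symbSupp c := by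
  ext i; simp only [mem_symbSupp, ne_eq, twist_eq_zero]

theorem symbSupp_update_coe {c : Symb G} {i : ι} (hi : i ∈ symbSupp c) (g : G i) :
    symbSupp (Function.update c i (g : WithZero (G i))) = symbSupp c := by
  ext k
  by_cases hk : k = i
  · subst hk; simpa [mem_symbSupp] using hi
  · simp [mem_symbSupp, hk]

theorem symbSupp_update_zero_ssubset {c : Symb G} {i : ι} (hi : i ∈ symbSupp c) :
    symbSupp (Function.update c i 0) ⊂ symbSupp c := by
  refine (Finset.ssubset_iff_of_subset fun k hk => ?_).mpr ⟨i, hi, by simp [mem_symbSupp]⟩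
  by_cases hki : k = i
  · subst hki; exact hi
  · simpa [mem_symbSupp, hki] using hk

/-- The symbol with coordinates `1` on `B` and `0` elsewhere. -/
def oneSymb (G : ι → Type*) [∀ i, CommGroup (G i)] (B : Finset ι) : Symb G :=
  fun i => if i ∈ B then 1 else 0

theorem symbSupp_oneSymb (B : Finset ι) : symbSupp (oneSymb G B) = B := by
  ext i; simp [mem_symbSupp, oneSymb]

/-- The abstract index set of a basis. -/
def InM (D : DistData G) (c : Symb G) : Prop :=
  (∀ i, c i ≠ (D.j i : WithZero (G i))) ∧
  (∀ k, IsGreatest {i | c i ≠ 0 ∧ c i ≠ 1} k → ∃ g ∈ D.H k, c k = (g : WithZero (G k))) ∧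
  ((∀ i, c i = 0 ∨ c i = 1) → Odd (symbSupp c).card)

/-- An odd distribution on symbols, with values in an abelian group without `2`-torsion. -/
structure IsOddDistribution {V : Type*} [AddCommGroup V] (D : DistData G) (Ψ : Symb G → V) :
    Prop where
  odd : ∀ c, Ψ (twist D.j c) = -Ψ c
  rel : ∀ k c, c k = 0 → ∑ g : G k, Ψ (Function.update c k (g : WithZero (G k))) =
    Ψ (twist (D.A k) c) - Ψ (twist (D.B k) c)
  two : ∀ v : V, v + v = 0 → v = 0

namespace IsOddDistribution

variable {V : Type*} [AddCommGroup V] {D : DistData G} {Ψ : Symb G → V}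
  (h : IsOddDistribution D Ψ) {W : Submodule ℤ V} {B : Finset ι}
  (hlow : ∀ c, symbSupp c ⊂ B → Ψ c ∈ W)
  (hM : ∀ c, symbSupp c = B → InM D c → Ψ c ∈ W)

include h hlow

/-- The norm relation turns the sum over unit values at i into two values at symbols vanishing at i,
which have smaller support. -/
theorem sum_update_mem {c : Symb G} (hc : symbSupp c = B) {i : ι} (hi : i ∈ B) :
    ∑ g : G i, Ψ (Function.update c i (g : WithZero (G i))) ∈ W := by
  have h1 := h.rel i (Function.update c i 0) (by simp)
  simp only [Function.update_idem] at h1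
  have hss : symbSupp (Function.update c i 0) ⊂ B := by
    rw [← hc]; exact symbSupp_update_zero_ssubset (hc ▸ hi)
  rw [h1]
  exact Submodule.sub_mem _ (hlow _ (by rwa [symbSupp_twist]))
    (hlow _ (by rwa [symbSupp_twist]))

/-- Entries j away from k are removed one at a time by the norm relation, each replaced by the
remaining unit values. The k-th entry is never touched, so it can serve as a marker. -/
theorem mem_of_forall_no_j {k : ι} {x : WithZero (G k)}
    (hx : ∀ c, symbSupp c = B → c k = x → (∀ i, i ≠ k → c i ≠ (D.j i : WithZero (G i))) → Ψ c ∈ W)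
    (c : Symb G) (hc : symbSupp c = B) (hck : c k = x) : Ψ c ∈ W := by
  classical
  suffices H : ∀ n, ∀ c : Symb G, symbSupp c = B → c k = x →
      (Finset.univ.filter (fun i => i ≠ k ∧ c i = (D.j i : WithZero (G i)))).card = n → Ψ c ∈ W from
    H _ c hc hck rfl
  intro n
  induction n with
  | zero =>
    intro c hc hck hn
    refine hx c hc hck fun i hi hij => ?_
    have := Finset.filter_eq_empty_iff.mp (Finset.card_eq_zero.mp hn) (Finset.mem_univ i)
    exact this ⟨hi, hij⟩
  | succ n ih =>
    intro c hc hck hn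
    obtain ⟨i, hi⟩ := Finset.card_pos.mp (by omega : 0 < (Finset.univ.filter
      (fun i => i ≠ k ∧ c i = (D.j i : WithZero (G i)))).card)
    obtain ⟨hik, hij⟩ := (Finset.mem_filter.mp hi).2
    have hiB : i ∈ symbSupp c := by rw [mem_symbSupp, hij]; exact WithZero.coe_ne_zero
    have hsum := h.sum_update_mem hlow hc (hc ▸ hiB)
    rw [← Finset.add_sum_erase _ _ (Finset.mem_univ (D.j i)), ← hij,
      Function.update_eq_self] at hsum
    refine (Submodule.add_mem_iff_left _ (Submodule.sum_mem _ fun g hg => ?_)).mp hsum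
    refine ih _ ((symbSupp_update_coe hiB g).trans hc)
      (by rw [Function.update_of_ne hik.symm, hck]) ?_
    have hset : (Finset.univ.filter (fun l => l ≠ k ∧
        Function.update c i (g : WithZero (G i)) l = (D.j l : WithZero (G l)))) =
        (Finset.univ.filter (fun i => i ≠ k ∧ c i = (D.j i : WithZero (G i)))).erase i := by
      ext l
      by_cases hl : l = i
      · subst hl
        have hne : (g : WithZero (G l)) ≠ (D.j l : WithZero (G l)) := fun e =>
          (Finset.mem_erase.mp hg).1 (WithZero.coe_inj.mp e)
        simp [hne]
      · simp [hl]
    rw [hset, Finset.card_erase_of_mem hi, hn]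
    rfl

include hM

/-- Downward induction on the last nontrivial coordinate k. If its entry is outside the half system,
apply oddness; entries 1 may thereby become j, and are then removed with the k-th entry held fixed.
In the resulting symbols the last nontrivial coordinate is either k, now inside the half system, or
larger than k. -/
theorem mem_of_isGreatest (k : ι) : ∀ c, symbSupp c = B →
    (∀ i, c i ≠ (D.j i : WithZero (G i))) → IsGreatest {i | c i ≠ 0 ∧ c i ≠ 1} k → Ψ c ∈ W := by
  classical
  induction k using WellFoundedGT.induction with
  | ind k ih =>
  intro c hc hcj hk
  obtain ⟨g, hg⟩ := WithZero.ne_zero_iff_exists.mp hk.1.1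
  have hg1 : g ≠ 1 := by
    rintro rfl
    exact hk.1.2 (by rw [← hg, WithZero.coe_one])
  have hgj : g ≠ D.j k := fun e => hcj k (by rw [← hg, e])
  have hin : ∀ c' : Symb G, symbSupp c' = B → (∀ i, c' i ≠ (D.j i : WithZero (G i))) →
      IsGreatest {i | c' i ≠ 0 ∧ c' i ≠ 1} k → (∃ g ∈ D.H k, c' k = (g : WithZero (G k))) →
      Ψ c' ∈ W := by
    intro c' hc' hj' hk' hH
    refine hM c' hc' ⟨hj', fun l hl => ?_, fun hall => ?_⟩
    · rw [hl.unique hk']; exact hH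
    · exact absurd (hall k) (by simpa [not_or] using hk'.1)
  by_cases hgH : g ∈ D.H k
  · exact hin c hc hcj hk ⟨g, hgH, hg.symm⟩
  · have hjH : D.j k * g ∈ D.H k := by
      by_contra hcon
      exact hgH ((D.mem_H k g).mpr hcon)
    rw [← neg_neg (Ψ c), ← h.odd]
    refine Submodule.neg_mem _ (h.mem_of_forall_no_j hlow (k := k)
      (x := ((D.j k * g : G k) : WithZero (G k))) ?_ _ (by rw [symbSupp_twist, hc])
      (by rw [twist_apply, ← hg, WithZero.coe_mul]))
    intro c' hc' hck' hj'
    have hj'' : ∀ i, c' i ≠ (D.j i : WithZero (G i)) := by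
      intro i
      by_cases hi : i = k
      · subst hi
        rw [hck']
        intro e
        exact hg1 (mul_eq_left.mp (WithZero.coe_inj.mp e))
      · exact hj' i hi
    have hmem : k ∈ Finset.univ.filter (fun i => c' i ≠ 0 ∧ c' i ≠ 1) := by
      rw [Finset.mem_filter, hck']
      refine ⟨Finset.mem_univ _, WithZero.coe_ne_zero, fun e => hgj ?_⟩
      have e' : D.j k * g = 1 := WithZero.coe_inj.mp (e.trans WithZero.coe_one.symm)
      rw [← mul_one (D.j k), ← e', ← mul_assoc, D.j_mul, one_mul]
    set k' := (Finset.univ.filter (fun i => c' i ≠ 0 ∧ c' i ≠ 1)).max' ⟨k, hmem⟩ with hk'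
    have hgr : IsGreatest {i | c' i ≠ 0 ∧ c' i ≠ 1} k' := by
      have := Finset.isGreatest_max' _ ⟨k, hmem⟩
      simpa using this
    rcases (Finset.le_max' _ k hmem).eq_or_lt with e | hlt
    · rw [← hk'] at e
      rw [← e] at hgr
      exact hin c' hc' hj'' hgr ⟨_, hjH, hck'⟩
    · exact ih k' hlt c' hc' hj'' hgr

/-- An entry other than 1 and j is held fixed while all entries j are removed, so every resulting
symbol still has a nontrivial coordinate. -/
theorem mem_of_not_isSign (c : Symb G) (hc : symbSupp c = B) (hs : ¬ D.IsSign B c) : Ψ c ∈ W := by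
  classical
  simp only [DistData.IsSign, not_forall, not_or] at hs
  obtain ⟨k, hkB, hk1, hkj⟩ := hs
  have hk0 : c k ≠ 0 := mem_symbSupp.mp (hc ▸ hkB)
  refine h.mem_of_forall_no_j hlow (k := k) (x := c k) (fun c' hc' hck' hj' => ?_) c hc rfl
  have hj'' : ∀ i, c' i ≠ (D.j i : WithZero (G i)) := by
    intro i
    by_cases hi : i = k
    · subst hi; rwa [hck']
    · exact hj' i hi
  have hmem : k ∈ Finset.univ.filter (fun i => c' i ≠ 0 ∧ c' i ≠ 1) := by
    rw [Finset.mem_filter, hck']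
    exact ⟨Finset.mem_univ _, hk0, hk1⟩
  have hgr := Finset.isGreatest_max' _ ⟨k, hmem⟩
  exact h.mem_of_isGreatest hlow hM _ c' hc' hj'' (by simpa using hgr)

-- In the norm relation at i ∈ B, only the terms with entry 1 and j are still sign symbols; all
-- others already lie in W. Replacing j by 1 therefore changes the sign modulo W.
open scoped Classical in
theorem sub_mem_of_isSign (c : Symb G) (hc : symbSupp c = B) (hs : D.IsSign B c) :
    Ψ c - (-1 : ℤ) ^ (B.filter (fun i => c i ≠ 1)).card • Ψ (oneSymb G B) ∈ W := by
  classical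
  suffices H : ∀ n, ∀ c : Symb G, symbSupp c = B → D.IsSign B c →
      (B.filter (fun i => c i ≠ 1)).card = n → Ψ c - (-1 : ℤ) ^ n • Ψ (oneSymb G B) ∈ W from
    H _ c hc hs rfl
  intro n
  induction n with
  | zero =>
    intro c hc hs hn
    have : c = oneSymb G B := by
      ext1 i
      by_cases hi : i ∈ B
      · rw [oneSymb, if_pos hi]
        by_contra hne
        exact Finset.filter_eq_empty_iff.mp (Finset.card_eq_zero.mp hn) hi hne
      · rw [oneSymb, if_neg hi]
        rw [← hc, mem_symbSupp, not_not] at hi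
        exact hi
    rw [this]
    simp
  | succ n ih =>
    intro c hc hs hn
    obtain ⟨i, hi⟩ := Finset.card_pos.mp (by omega : 0 < (B.filter (fun i => c i ≠ 1)).card)
    obtain ⟨hiB, hi1⟩ := Finset.mem_filter.mp hi
    have hij : c i = (D.j i : WithZero (G i)) := (hs i hiB).resolve_left hi1
    have hiS : i ∈ symbSupp c := hc.symm ▸ hiB
    have hsum := h.sum_update_mem hlow hc hiB
    rw [← Finset.add_sum_erase _ _ (Finset.mem_univ (D.j i)),
      ← Finset.add_sum_erase _ _ (Finset.mem_erase.mpr ⟨(D.j_ne_one i).symm,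
        Finset.mem_univ (1 : G i)⟩), ← hij, Function.update_eq_self, ← add_assoc] at hsum
    have h2 := (Submodule.add_mem_iff_left _ (Submodule.sum_mem _ fun g hg => ?_)).mp hsum
    · have h3 := ih (Function.update c i ((1 : G i) : WithZero (G i)))
        ((symbSupp_update_coe hiS 1).trans hc) (fun l hl => ?_) ?_
      · have h4 := Submodule.sub_mem _ h2 h3
        have e : Ψ c - (-1 : ℤ) ^ (n + 1) • Ψ (oneSymb G B) =
            Ψ c + Ψ (Function.update c i ((1 : G i) : WithZero (G i))) -
              (Ψ (Function.update c i ((1 : G i) : WithZero (G i))) -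
                (-1 : ℤ) ^ n • Ψ (oneSymb G B)) := by
          rw [pow_succ]; module
        rwa [e]
      · by_cases hli : l = i
        · subst hli; left; simp
        · rw [Function.update_of_ne hli]; exact hs l hl
      · have hset : B.filter (fun l => Function.update c i ((1 : G i) : WithZero (G i)) l ≠ 1) =
            (B.filter (fun i => c i ≠ 1)).erase i := by
          ext l
          by_cases hl : l = i
          · subst hl; simp
          · simp [hl]
        rw [hset, Finset.card_erase_of_mem hi, hn]
        rfl
    · refine h.mem_of_not_isSign hlow hM _ ((symbSupp_update_coe hiS g).trans hc) fun hs' => ?_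
      rw [Finset.mem_erase, Finset.mem_erase] at hg
      rcases hs' i hiB with e | e <;> rw [Function.update_self] at e
      · exact hg.1 (WithZero.coe_inj.mp (e.trans WithZero.coe_one.symm))
      · exact hg.2.1 (WithZero.coe_inj.mp e)

omit hlow hM in
theorem linearCombination_act_j (x : Symb G →₀ ℤ) :
    Finsupp.linearCombination ℤ Ψ (act D.j x) = -Finsupp.linearCombination ℤ Ψ x := by
  rw [← LinearMap.comp_apply, ← LinearMap.neg_apply]
  refine finsupp_linearMap_ext (fun c => ?_) x
  simp [act_single, h.odd]

omit hlow hM in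
theorem linearCombination_KS {s : ι → CoordState} {x : Symb G →₀ ℤ} (hx : x ∈ D.KS s) :
    Finsupp.linearCombination ℤ Ψ x = 0 := by
  suffices H : D.KS s ≤ LinearMap.ker (Finsupp.linearCombination ℤ Ψ) from H hx
  refine Submodule.span_le.mpr ?_
  rintro _ ⟨l, c, hl, hc, hcl, rfl⟩
  rw [SetLike.mem_coe, LinearMap.mem_ker, DistData.relMap, DistData.delta, LinearMap.sub_apply,
    LinearMap.sub_apply, coordNorm_single, act_single, act_single]
  simp only [map_sub, map_sum, Finsupp.linearCombination_single, one_smul]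
  rw [h.rel l c hcl, sub_self]

/-- Both an odd multiple of the value at 1_B and twice that value lie in W. The odd multiple comes
from the eigenvector of odd parity: its eigenvalue is +1 modulo relations while Ψ is odd, so Ψ kills
it up to 2-torsion, which is excluded. -/
theorem oneSymb_mem_of_even (hB : Even B.card) : Ψ (oneSymb G B) ∈ W := by
  classical
  obtain ⟨x, hx, hJ, hpar⟩ := D.exists_eigen_of_odd_parity B
  rw [hB.neg_one_pow, one_smul] at hJ
  have hx0 : Finsupp.linearCombination ℤ Ψ x = 0 := by
    have h1 := h.linearCombination_KS hJ
    rw [map_sub, h.linearCombination_act_j, sub_eq_zero] at h1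
    refine h.two _ ?_
    nth_rewrite 1 [← h1]
    exact neg_add_cancel _
  -- The formal sums whose value is n·Ψ(1_B) modulo W for some n congruent to their parity; every
  -- symbol supported in B is one of them.
  let Q : Submodule ℤ (Symb G →₀ ℤ) :=
    { carrier := {y | ∃ n : ℤ, (n : ZMod 2) = D.parity B y ∧
        Finsupp.linearCombination ℤ Ψ y - n • Ψ (oneSymb G B) ∈ W}
      zero_mem' := ⟨0, by simp, by simp⟩
      add_mem' := by
        rintro a b ⟨n, hn, hn'⟩ ⟨l, hl, hl'⟩
        refine ⟨n + l, by simp [hn, hl], ?_⟩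
        convert Submodule.add_mem _ hn' hl' using 1
        rw [map_add]; module
      smul_mem' := by
        rintro z a ⟨n, hn, hn'⟩
        refine ⟨z * n, by simp [hn], ?_⟩
        convert Submodule.smul_mem _ z hn' using 1
        rw [map_smul]; module }
  have hQ : PS G (stateOf B) ≤ Q := by
    refine PS_induction fun c hc => ?_
    have hsub : symbSupp c ⊆ B := by
      intro i hi
      by_contra hiB
      exact mem_symbSupp.mp hi ((hc i).2 (by simp [stateOf, hiB]))
    by_cases hs : D.IsSign B c
    · have hcB : symbSupp c = B := by
        refine Finset.Subset.antisymm hsub fun i hi => mem_symbSupp.mpr fun h0 => ?_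
        exact DistData.not_isSign_of_eq_zero hi h0 hs
      refine ⟨_, ?_, by simpa using h.sub_mem_of_isSign hlow hM c hcB hs⟩
      rw [DistData.parity_single, if_pos hs]
      push_cast
      rw [show (-1 : ZMod 2) = 1 by decide, one_pow]
    · refine ⟨0, ?_, ?_⟩
      · rw [DistData.parity_single, if_neg hs]; simp
      · rw [Finsupp.linearCombination_single, one_smul, zero_smul, sub_zero]
        by_cases hcB : symbSupp c = B
        · exact h.mem_of_not_isSign hlow hM c hcB hs
        · exact hlow c (hsub.ssubset_of_ne hcB)
  obtain ⟨n, hn, hn'⟩ := hQ hx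
  rw [hx0, zero_sub, neg_mem_iff] at hn'
  rw [hpar] at hn
  have hodd : Odd n := by
    rw [← ZMod.intCast_eq_one_iff_odd]; exact hn
  -- The symbol with j on all of B has value Ψ(1_B) modulo W because |B| is even, and value -Ψ(1_B)
  -- by oddness.
  have h2 : (2 : ℤ) • Ψ (oneSymb G B) ∈ W := by
    have h1 := h.sub_mem_of_isSign hlow hM (twist D.j (oneSymb G B))
      (by rw [symbSupp_twist, symbSupp_oneSymb])
      (DistData.isSign_twist_j.mpr fun i hi => Or.inl (by simp [oneSymb, hi]))
    have hfil : B.filter (fun i => twist D.j (oneSymb G B) i ≠ 1) = B := by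
      refine Finset.filter_true_of_mem fun i hi => ?_
      rw [twist_apply, oneSymb, if_pos hi, mul_one]
      exact fun e => D.j_ne_one i (WithZero.coe_inj.mp (e.trans WithZero.coe_one.symm))
    rw [hfil, hB.neg_one_pow, one_smul, h.odd] at h1
    rw [← neg_mem_iff]
    convert h1 using 1
    module
  obtain ⟨l, rfl⟩ := hodd
  have h3 := Submodule.sub_mem _ hn' (Submodule.smul_mem _ l h2)
  convert h3 using 1
  module

/-- The values of an odd distribution on symbols with support `B` are generated by those on the
basis symbols and on the symbols of smaller support. -/
theorem mem_of_symbSupp_eq (c : Symb G) (hc : symbSupp c = B) : Ψ c ∈ W := by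
  classical
  have hone : Ψ (oneSymb G B) ∈ W := by
    rcases Nat.even_or_odd B.card with he | ho
    · exact h.oneSymb_mem_of_even hlow hM he
    · refine hM _ (symbSupp_oneSymb B) ⟨fun i => ?_, fun k hk => ?_, fun _ => ?_⟩
      · by_cases hi : i ∈ B
        · simp only [oneSymb, hi, if_true]
          exact fun e => D.j_ne_one i (WithZero.coe_inj.mp (e.symm.trans WithZero.coe_one.symm))
        · simp only [oneSymb, hi, if_false]
          exact WithZero.zero_ne_coe
      · exfalso
        have := hk.1
        simp [oneSymb] at this
      · rwa [symbSupp_oneSymb]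
  by_cases hs : D.IsSign B c
  · have := Submodule.add_mem _ (h.sub_mem_of_isSign hlow hM c hc hs)
      (Submodule.smul_mem _ ((-1 : ℤ) ^ (B.filter (fun i => c i ≠ 1)).card) hone)
    rwa [sub_add_cancel] at this
  · exact h.mem_of_not_isSign hlow hM c hc hs

end IsOddDistribution

end Generation

open HurwitzZeta Filter Topology

/-! ### Nonvanishing of character sums of the sawtooth function -/

/-- Factor the difference as x⁻ˢ(1 - (x/y)ˢ): the first factor is at most 1/(dx) because x ≥ d, the
second at most 2/x because s ≤ 2 and y ≤ x + 1. The bound is uniform in s, as dominated convergence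
at s → 1 requires. -/
theorem abs_inv_rpow_sub_inv_rpow_le {x y d s : ℝ} (hd : 0 < d) (hd1 : d ≤ 1) (hx : d ≤ x)
    (hxy : x ≤ y) (hyx : y ≤ x + 1) (hs1 : 1 ≤ s) (hs2 : s ≤ 2) :
    |1 / x ^ s - 1 / y ^ s| ≤ 2 / d * (1 / x ^ (2 : ℝ)) := by
  have hx0 : 0 < x := hd.trans_le hx
  have hy0 : 0 < y := hx0.trans_le hxy
  have hxs : 0 < x ^ s := Real.rpow_pos_of_pos hx0 s
  have hys : 0 < y ^ s := Real.rpow_pos_of_pos hy0 s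
  have hle : x ^ s ≤ y ^ s := Real.rpow_le_rpow hx0.le hxy (by linarith)
  rw [abs_of_nonneg (sub_nonneg.mpr (one_div_le_one_div_of_le hxs hle))]
  have hratio : 1 - (x / y) ^ s ≤ 2 / x := by
    have hr0 : 0 < x / y := div_pos hx0 hy0
    have hr1 : x / y ≤ 1 := (div_le_one hy0).mpr hxy
    have h1 : (x / y) ^ (2 : ℝ) ≤ (x / y) ^ s := Real.rpow_le_rpow_of_exponent_ge hr0 hr1 hs2
    have h2 : (x / y) ^ (2 : ℝ) = (x / y) ^ 2 := by norm_cast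
    have h3 : 1 - x / y ≤ 1 / x := by
      rw [sub_le_iff_le_add, div_add_div _ _ hx0.ne' hy0.ne', le_div_iff₀ (mul_pos hx0 hy0)]
      nlinarith
    have h4 : 1 - (x / y) ^ 2 ≤ 2 * (1 - x / y) := by nlinarith [sq_nonneg (1 - x / y)]
    rw [h2] at h1
    calc 1 - (x / y) ^ s ≤ 2 * (1 - x / y) := by linarith
      _ ≤ 2 * (1 / x) := by linarith
      _ = 2 / x := by ring
  have hxd : 1 / x ^ s ≤ 1 / d * (1 / x) := by
    have : d * x ≤ x ^ s := by
      have e : x ^ s = x ^ (s - 1) * x := by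
        rw [← Real.rpow_add_one hx0.ne']; ring_nf
      rw [e]
      refine mul_le_mul_of_nonneg_right ?_ hx0.le
      calc d = d ^ (1 : ℝ) := (Real.rpow_one d).symm
        _ ≤ d ^ (s - 1) := Real.rpow_le_rpow_of_exponent_ge hd hd1 (by linarith)
        _ ≤ x ^ (s - 1) := Real.rpow_le_rpow hd.le hx (by linarith)
    rw [one_div_mul_one_div]
    exact one_div_le_one_div_of_le (mul_pos hd hx0) this
  have e : 1 / x ^ s - 1 / y ^ s = 1 / x ^ s * (1 - (x / y) ^ s) := by
    rw [Real.div_rpow hx0.le hy0.le]; field_simp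
  have hnn : 0 ≤ 1 - (x / y) ^ s := by
    rw [Real.div_rpow hx0.le hy0.le, sub_nonneg]
    exact (div_le_one hys).mpr hle
  rw [e]
  calc 1 / x ^ s * (1 - (x / y) ^ s) ≤ (1 / d * (1 / x)) * (2 / x) :=
        mul_le_mul hxd hratio hnn (by positivity)
    _ = 2 / d * (1 / x ^ (2 : ℝ)) := by
        rw [show x ^ (2 : ℝ) = x ^ 2 by norm_cast]; field_simp

theorem abs_inv_rpow_sub_inv_rpow_le' {x y d z s : ℝ} (hd : 0 < d) (hd1 : d ≤ 1) (hz : d ≤ z)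
    (hx : z ≤ x) (hy : z ≤ y) (hyx : y ≤ x + 1) (hxy : x ≤ y + 1) (hs1 : 1 ≤ s) (hs2 : s ≤ 2) :
    |1 / x ^ s - 1 / y ^ s| ≤ 2 / d * (1 / z ^ (2 : ℝ)) := by
  have hz0 : 0 < z := hd.trans_le hz
  have key : ∀ w, z ≤ w → 2 / d * (1 / w ^ (2 : ℝ)) ≤ 2 / d * (1 / z ^ (2 : ℝ)) := by
    intro w hw
    refine mul_le_mul_of_nonneg_left (one_div_le_one_div_of_le (Real.rpow_pos_of_pos hz0 _)
      (Real.rpow_le_rpow hz0.le hw (by norm_num))) (by positivity)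
  rcases le_total x y with h | h
  · exact (abs_inv_rpow_sub_inv_rpow_le hd hd1 (hz.trans hx) h hyx hs1 hs2).trans (key x hx)
  · rw [abs_sub_comm]
    exact (abs_inv_rpow_sub_inv_rpow_le hd hd1 (hz.trans hy) h hxy hs1 hs2).trans (key y hy)

/-- The series is available for s > 1. Pairing n + a with n + 1 - a makes its terms O(n⁻²) uniformly
in s, so both sides can be compared in the limit s → 1⁺. -/
theorem hurwitzZetaOdd_one_eq_tsum {a : ℝ} (ha0 : 0 < a) (ha1 : a < 1) :
    hurwitzZetaOdd (a : UnitAddCircle) 1 =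
      ∑' n : ℕ, (1 / (n + a : ℂ) - 1 / (n + 1 - a : ℂ)) / 2 := by
  set d := min a (1 - a) with hd
  have hd0 : 0 < d := lt_min ha0 (by linarith)
  have hda : d ≤ a := min_le_left _ _
  have hda' : d ≤ 1 - a := min_le_right _ _
  have hd1 : d ≤ 1 := hda.trans ha1.le
  have hlim1 : Tendsto (fun s : ℝ => hurwitzZetaOdd (a : UnitAddCircle) (s : ℂ)) (𝓝[>] 1)
      (𝓝 (hurwitzZetaOdd (a : UnitAddCircle) 1)) := by
    have hc : Continuous (fun s : ℝ => hurwitzZetaOdd (a : UnitAddCircle) (s : ℂ)) :=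
      (differentiable_hurwitzZetaOdd _).continuous.comp Complex.continuous_ofReal
    have := hc.tendsto 1
    rw [Complex.ofReal_one] at this
    exact this.mono_left nhdsWithin_le_nhds
  have hlim2 : Tendsto (fun s : ℝ => ∑' n : ℕ, (1 / (n + a : ℂ) ^ (s : ℂ) -
      1 / (n + 1 - a : ℂ) ^ (s : ℂ)) / 2) (𝓝[>] 1)
      (𝓝 (∑' n : ℕ, (1 / (n + a : ℂ) - 1 / (n + 1 - a : ℂ)) / 2)) := by
    have hxpos : ∀ n : ℕ, 0 < (n : ℝ) + a := fun n => by positivity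
    have hypos : ∀ n : ℕ, 0 < (n : ℝ) + 1 - a := fun n => by
      have : (0 : ℝ) ≤ n := Nat.cast_nonneg n
      linarith
    refine tendsto_tsum_of_dominated_convergence
      (bound := fun n : ℕ => 2 / d * (1 / |(n : ℝ) + d| ^ (2 : ℝ)))
      (((Real.summable_one_div_nat_add_rpow d 2).mpr (by norm_num)).mul_left _) (fun n => ?_) ?_
    · have hcont : ∀ z : ℝ, 0 < z → Tendsto (fun s : ℝ => (1 : ℂ) / (z : ℂ) ^ (s : ℂ)) (𝓝[>] 1)
          (𝓝 (1 / (z : ℂ))) := by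
        intro z hz
        have hz' : (z : ℂ) ≠ 0 := Complex.ofReal_ne_zero.mpr hz.ne'
        have hc : ContinuousAt (fun s : ℝ => (1 : ℂ) / (z : ℂ) ^ (s : ℂ)) 1 := by
          refine ContinuousAt.div continuousAt_const ?_ ?_
          · exact (Complex.continuous_ofReal.continuousAt.const_cpow (Or.inl hz'))
          · rw [Complex.cpow_ne_zero_iff]; exact Or.inl hz'
        have := hc.tendsto
        rw [Complex.ofReal_one, Complex.cpow_one] at this
        exact this.mono_left nhdsWithin_le_nhds
      have h1 := hcont _ (hxpos n)
      have h2 := hcont _ (hypos n)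
      push_cast at h1 h2
      exact (h1.sub h2).div_const 2
    · have hev : ∀ᶠ s : ℝ in 𝓝[>] 1, s ∈ Set.Ioo (1 : ℝ) 2 :=
        Ioo_mem_nhdsGT (by norm_num)
      filter_upwards [hev] with s hs n
      have hn : (0 : ℝ) ≤ n := Nat.cast_nonneg n
      have e : (1 / (n + a : ℂ) ^ (s : ℂ) - 1 / (n + 1 - a : ℂ) ^ (s : ℂ)) / 2 =
          (((1 / ((n : ℝ) + a) ^ s - 1 / ((n : ℝ) + 1 - a) ^ s) / 2 : ℝ) : ℂ) := by
        push_cast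
        rw [Complex.ofReal_cpow (hxpos n).le, Complex.ofReal_cpow (hypos n).le]
        push_cast
        rfl
      rw [e, Complex.norm_real, Real.norm_eq_abs, abs_div, abs_of_pos (by norm_num : (0 : ℝ) < 2)]
      have hb := abs_inv_rpow_sub_inv_rpow_le' (x := n + a) (y := n + 1 - a) (z := n + d) hd0 hd1
        (by linarith) (by linarith) (by linarith) (by linarith) (by linarith) hs.1.le hs.2.le
      rw [abs_of_pos (by linarith : 0 < (n : ℝ) + d)]
      have habs := abs_nonneg (1 / ((n : ℝ) + a) ^ s - 1 / ((n : ℝ) + 1 - a) ^ s)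
      linarith
  refine tendsto_nhds_unique hlim1 (hlim2.congr' ?_)
  filter_upwards [self_mem_nhdsWithin] with s hs
  exact (hasSum_nat_hurwitzZetaOdd_of_mem_Icc ⟨ha0.le, ha1.le⟩
    (by simpa using hs)).tsum_eq

/-- This is the partial fraction expansion of the cotangent; regrouping its terms changes the N-th
partial sum by 1/a - 1/(a + N). -/
theorem hurwitzZetaOdd_one {a : ℝ} (ha0 : 0 < a) (ha1 : a < 1) :
    hurwitzZetaOdd (a : UnitAddCircle) 1 = Real.pi / 2 * Complex.cot (Real.pi * a) := by
  have hz : (a : ℂ) ∈ Complex.integerComplement := by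
    rintro ⟨n, hn⟩
    have hn' : (n : ℝ) = a := by exact_mod_cast hn
    have h1 : (0 : ℝ) < n := hn' ▸ ha0
    have h2 : (n : ℝ) < 1 := hn' ▸ ha1
    have h3 : 0 < n := by exact_mod_cast h1
    have h4 : n < 1 := by exact_mod_cast h2
    omega
  have hs : HasSum (fun n : ℕ => (1 / (n + a : ℂ) - 1 / (n + 1 - a : ℂ)))
      (Real.pi * Complex.cot (Real.pi * a)) := by
    have hsummable : Summable (fun n : ℕ => (1 / (n + a : ℂ) - 1 / (n + 1 - a : ℂ))) := by
      have hd0 : 0 < min a (1 - a) := lt_min ha0 (by linarith)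
      refine Summable.of_norm_bounded (((Real.summable_one_div_nat_add_rpow (min a (1 - a)) 2).mpr
        (by norm_num)).mul_left (2 / min a (1 - a))) fun n => ?_
      have hn : (0 : ℝ) ≤ n := Nat.cast_nonneg n
      have hb := abs_inv_rpow_sub_inv_rpow_le' (x := n + a) (y := n + 1 - a)
        (z := n + min a (1 - a)) (s := 1) hd0 ((min_le_left _ _).trans ha1.le)
        (by linarith) (by linarith [min_le_left a (1 - a)]) (by linarith [min_le_right a (1 - a)])
        (by linarith) (by linarith) le_rfl (by norm_num)
      rw [Real.rpow_one, Real.rpow_one] at hb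
      have e : (1 / (n + a : ℂ) - 1 / (n + 1 - a : ℂ)) =
          ((1 / ((n : ℝ) + a) - 1 / ((n : ℝ) + 1 - a) : ℝ) : ℂ) := by push_cast; rfl
      rw [e, Complex.norm_real, Real.norm_eq_abs, abs_of_pos (by linarith : 0 < (n : ℝ) + _)]
      exact hb
    have hT := (Summable.hasSum_iff_tendsto_nat (summable_cotTerm hz)).mp
      (summable_cotTerm hz).hasSum
    have hcot : ∑' n : ℕ, cotTerm (a : ℂ) n = Real.pi * Complex.cot (Real.pi * a) - 1 / a :=
      (cot_series_rep' hz).symm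
    rw [hcot] at hT
    rw [Summable.hasSum_iff_tendsto_nat hsummable]
    have hpart : ∀ N : ℕ, ∑ n ∈ Finset.range N, (1 / (n + a : ℂ) - 1 / (n + 1 - a : ℂ)) =
        ∑ n ∈ Finset.range N, cotTerm (a : ℂ) n + 1 / a - 1 / (a + N : ℂ) := by
      intro N
      induction N with
      | zero => simp
      | succ N ih =>
        rw [Finset.sum_range_succ, Finset.sum_range_succ, ih, cotTerm]
        have : (1 : ℂ) / (a - (N + 1)) = -(1 / (N + 1 - a)) := by
          rw [← neg_sub, one_div, one_div, inv_neg]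
        rw [this]
        push_cast
        rw [add_comm (N : ℂ) (a : ℂ)]
        ring
    have hzero : Tendsto (fun N : ℕ => (1 : ℂ) / (a + N : ℂ)) atTop (𝓝 0) := by
      have : Tendsto (fun N : ℕ => (1 : ℝ) / (a + N)) atTop (𝓝 0) :=
        Tendsto.div_atTop tendsto_const_nhds
          (tendsto_atTop_add_const_left _ _ tendsto_natCast_atTop_atTop)
      have h2 := (Complex.continuous_ofReal.tendsto 0).comp this
      rw [Complex.ofReal_zero] at h2
      refine h2.congr fun N => ?_
      simp
    have hfin := (hT.add_const (1 / (a : ℂ))).sub hzero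
    rw [sub_add_cancel, sub_zero] at hfin
    exact hfin.congr fun N => (hpart N).symm
  rw [hurwitzZetaOdd_one_eq_tsum ha0 ha1, (hs.div_const 2).tsum_eq]
  ring

/-- L(1,χ) is nonzero and is a nonzero multiple of the χ-weighted sum of Hurwitz zeta values at 1.
For odd χ the even parts cancel, and the odd parts are cotangents. -/
theorem sum_mul_cot_ne_zero {m : ℕ} [NeZero m] {χ : DirichletCharacter ℂ m} (hχ : χ.Odd) :
    ∑ j : ZMod m, χ j * Complex.cot (Real.pi * (j.val / m : ℝ)) ≠ 0 := by
  have hχ1 : χ ≠ 1 := by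
    rintro rfl
    have := hχ
    rw [DirichletCharacter.Odd] at this
    rw [MulChar.one_apply isUnit_one.neg] at this
    norm_num at this
  have hm1 : m ≠ 1 := fun h => hχ1 (DirichletCharacter.level_one' χ h)
  have hL := DirichletCharacter.LFunction_apply_one_ne_zero hχ1
  rw [DirichletCharacter.LFunction, ZMod.LFunction] at hL
  have hsum := (mul_ne_zero_iff.mp hL).2
  have heven : ∑ j : ZMod m, χ j * hurwitzZetaEven (ZMod.toAddCircle j) 1 = 0 := by
    refine Function.Odd.sum_eq_zero fun j => ?_
    rw [hχ.eval_neg, map_neg, hurwitzZetaEven_neg, neg_mul]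
  have hodd : ∑ j : ZMod m, χ j * hurwitzZeta (ZMod.toAddCircle j) 1 =
      Real.pi / 2 * ∑ j : ZMod m, χ j * Complex.cot (Real.pi * (j.val / m : ℝ)) := by
    simp only [hurwitzZeta, mul_add, Finset.sum_add_distrib]
    rw [heven, zero_add, Finset.mul_sum]
    refine Finset.sum_congr rfl fun j _ => ?_
    by_cases hj : j = 0
    · rw [hj, χ.map_zero' hm1]; simp
    · have hv : 0 < j.val := Nat.pos_of_ne_zero fun h => hj ((ZMod.val_eq_zero j).mp h)
      have hm0 : (0 : ℝ) < m := Nat.cast_pos.mpr (NeZero.pos m)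
      rw [ZMod.toAddCircle_apply, hurwitzZetaOdd_one (div_pos (Nat.cast_pos.mpr hv) hm0)
        ((div_lt_one hm0).mpr (Nat.cast_lt.mpr (ZMod.val_lt j)))]
      ring
  rw [hodd] at hsum
  exact (mul_ne_zero_iff.mp hsum).2

/-- The odd sawtooth function on `ℤ/m`. -/
def saw {m : ℕ} (x : ZMod m) : ℚ := ((x.val : ℚ) - ((-x).val : ℚ)) / (2 * m)

theorem saw_neg {m : ℕ} (x : ZMod m) : saw (-x) = -saw x := by
  rw [saw, saw, neg_neg]; ring

theorem saw_zero {m : ℕ} : saw (0 : ZMod m) = 0 := by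
  simp [saw]

theorem sum_zmod_val {m : ℕ} [NeZero m] {M : Type*} [AddCommMonoid M] (f : ℕ → M) :
    ∑ a : ZMod m, f a.val = ∑ k ∈ Finset.range m, f k := by
  obtain ⟨n, rfl⟩ := Nat.exists_eq_succ_of_ne_zero (NeZero.ne m)
  exact Fin.sum_univ_eq_sum_range f (n + 1)

theorem sum_val_mul_stdAddChar {m : ℕ} [NeZero m] {j : ZMod m} (hj : j ≠ 0) :
    ∑ a : ZMod m, (a.val : ℂ) * ZMod.stdAddChar (a * j) = m / (ZMod.stdAddChar j - 1) := by
  set z : ℂ := ZMod.stdAddChar j with hz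
  have hz1 : z - 1 ≠ 0 := by
    rw [sub_ne_zero]
    intro h
    exact hj (ZMod.injective_stdAddChar (h.trans (AddChar.map_zero_eq_one _).symm))
  have hzm : z ^ m = 1 := by
    rw [hz, ← AddChar.map_nsmul_eq_pow, nsmul_eq_mul, ZMod.natCast_self, zero_mul,
      AddChar.map_zero_eq_one]
  have hterm : ∀ a : ZMod m, (a.val : ℂ) * ZMod.stdAddChar (a * j) = (a.val : ℂ) * z ^ a.val := by
    intro a
    rw [hz, ← AddChar.map_nsmul_eq_pow, nsmul_eq_mul, ZMod.natCast_zmod_val]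
  have hgeom : ∀ n : ℕ, (z - 1) * ∑ k ∈ Finset.range n, (k : ℂ) * z ^ k =
      n * z ^ n - z * ∑ k ∈ Finset.range n, z ^ k := by
    intro n
    induction n with
    | zero => simp
    | succ n ih =>
      rw [Finset.sum_range_succ, Finset.sum_range_succ, mul_add, ih]
      push_cast
      ring
  have h0 : ∑ k ∈ Finset.range m, z ^ k = 0 := by
    have := mul_geom_sum z m
    rw [hzm, sub_self] at this
    exact (mul_eq_zero.mp this).resolve_left hz1
  rw [Finset.sum_congr rfl fun a _ => hterm a,
    sum_zmod_val (fun k => (k : ℂ) * z ^ k), eq_div_iff hz1, mul_comm, hgeom, h0, hzm]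
  simp

/-- The finite Fourier transform of the sawtooth is a cotangent; it links sawtooth sums to L-values.
-/
theorem sum_saw_mul_stdAddChar {m : ℕ} [NeZero m] {j : ZMod m} (hj : j ≠ 0) :
    ∑ a : ZMod m, (saw a : ℂ) * ZMod.stdAddChar (a * j) =
      Complex.cot (Real.pi * (j.val / m : ℝ)) / (2 * Complex.I) := by
  have hm : (m : ℂ) ≠ 0 := Nat.cast_ne_zero.mpr (NeZero.ne m)
  have h1 := sum_val_mul_stdAddChar hj
  have h2 := sum_val_mul_stdAddChar (neg_ne_zero.mpr hj)
  rw [← Equiv.sum_comp (Equiv.neg (ZMod m))] at h2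
  simp only [Equiv.neg_apply, neg_mul_neg] at h2
  have hexp : Complex.exp (2 * Real.pi * Complex.I * ((j.val / m : ℝ) : ℂ)) =
      ZMod.stdAddChar j := by
    rw [ZMod.stdAddChar_apply, ZMod.toCircle_apply]
    push_cast
    congr 1
    ring
  have hz1 : (ZMod.stdAddChar j : ℂ) - 1 ≠ 0 := by
    rw [sub_ne_zero]
    intro h
    exact hj (ZMod.injective_stdAddChar (h.trans (AddChar.map_zero_eq_one _).symm))
  have hmul : (ZMod.stdAddChar j : ℂ) * ZMod.stdAddChar (-j) = 1 := by
    rw [← AddChar.map_add_eq_mul, add_neg_cancel, AddChar.map_zero_eq_one]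
  have hz0 : (ZMod.stdAddChar j : ℂ) ≠ 0 := left_ne_zero_of_mul_eq_one hmul
  rw [eq_inv_of_mul_eq_one_right hmul] at h2
  have hsum : ∑ a : ZMod m, (saw a : ℂ) * ZMod.stdAddChar (a * j) =
      (∑ a : ZMod m, (a.val : ℂ) * ZMod.stdAddChar (a * j) -
        ∑ a : ZMod m, ((-a).val : ℂ) * ZMod.stdAddChar (a * j)) / (2 * m) := by
    rw [← Finset.sum_sub_distrib, Finset.sum_div]
    refine Finset.sum_congr rfl fun a _ => ?_
    rw [saw]; push_cast; ring
  have hz2 : (ZMod.stdAddChar j : ℂ)⁻¹ - 1 ≠ 0 := by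
    intro h
    apply hz1
    rw [sub_eq_zero] at h ⊢
    rw [← inv_inv (ZMod.stdAddChar j : ℂ), h, inv_one]
  rw [hsum, h1, h2, Complex.cot_pi_eq_exp_ratio, hexp]
  set z : ℂ := ZMod.stdAddChar j
  have hI := Complex.I_ne_zero
  have hz3 : 1 - z ≠ 0 := by rw [← neg_sub]; exact neg_ne_zero.mpr hz1
  have e : z⁻¹ - 1 = (1 - z) / z := by field_simp
  rw [e, ← neg_sub z 1]
  field_simp
  ring_nf
  simp
  ring

/-- Expanding the cotangents by the Fourier transform and exchanging sums writes the nonzero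
cotangent sum for χ⁻¹ as a combination of the sums here, so not all of them vanish. -/
theorem exists_sum_mul_saw_ne_zero {m : ℕ} [NeZero m] {χ : DirichletCharacter ℂ m}
    (hχ : χ.Odd) :
    ∃ a : ZMod m, ∑ u : (ZMod m)ˣ, χ u * (saw (a * (u : ZMod m)) : ℂ) ≠ 0 := by
  by_contra! hcon
  have hχ' : (χ⁻¹).Odd := by
    rw [DirichletCharacter.Odd, MulChar.inv_apply_eq_inv', hχ]
    norm_num
  refine sum_mul_cot_ne_zero hχ' ?_
  have hunits : ∀ F : ZMod m → ℂ, ∑ j : ZMod m, χ⁻¹ j * F j =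
      ∑ u : (ZMod m)ˣ, χ⁻¹ u * F u := by
    intro F
    symm
    refine Finset.sum_of_injOn (fun u : (ZMod m)ˣ => (u : ZMod m)) (Units.val_injective.injOn)
      (fun _ _ => Finset.mem_coe.mpr (Finset.mem_univ _)) (fun j _ hj => ?_) (fun _ _ => rfl)
    rw [MulChar.map_nonunit, zero_mul]
    rintro ⟨u, rfl⟩
    exact hj ⟨u, by simp, rfl⟩
  rw [hunits]
  have hone : ∀ u : (ZMod m)ˣ, χ⁻¹ (u : ZMod m) *
      Complex.cot (Real.pi * (((u : ZMod m).val : ℝ) / m : ℝ)) = χ⁻¹ (u : ZMod m) *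
      ((2 * Complex.I) * ∑ a : ZMod m, (saw a : ℂ) * ZMod.stdAddChar (a * (u : ZMod m))) := by
    intro u
    -- A zero unit forces the trivial ring, where 1 = -1 contradicts oddness of the character.
    by_cases hu : (u : ZMod m) = 0
    · have h0 : χ⁻¹ (1 : ZMod m) = χ⁻¹ (-1 : ZMod m) := by
        have : (1 : ZMod m) = 0 := by
          rw [← u.mul_inv, hu, zero_mul]
        rw [this, neg_zero]
      rw [hχ', map_one] at h0
      norm_num at h0
    · rw [sum_saw_mul_stdAddChar hu]
      field_simp [Complex.I_ne_zero]
  rw [Finset.sum_congr rfl fun u _ => hone u]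
  have hre : ∀ u : (ZMod m)ˣ, ∑ a : ZMod m, (saw a : ℂ) * ZMod.stdAddChar (a * (u : ZMod m)) =
      ∑ a : ZMod m, (saw (a * ((u⁻¹ : (ZMod m)ˣ) : ZMod m)) : ℂ) * ZMod.stdAddChar a := by
    intro u
    rw [← Equiv.sum_comp (Units.mulRight u⁻¹)]
    refine Finset.sum_congr rfl fun a _ => ?_
    simp [mul_assoc]
  calc _ = (2 * Complex.I) * ∑ a : ZMod m, ZMod.stdAddChar a *
        ∑ u : (ZMod m)ˣ, χ (u⁻¹ : (ZMod m)ˣ) * (saw (a * ((u⁻¹ : (ZMod m)ˣ) : ZMod m)) : ℂ) := by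
        simp_rw [hre, Finset.mul_sum]
        rw [Finset.sum_comm]
        refine Finset.sum_congr rfl fun a _ => Finset.sum_congr rfl fun u _ => ?_
        rw [MulChar.inv_apply, Ring.inverse_unit]
        ring
    _ = 0 := by
        rw [Finset.sum_eq_zero, mul_zero]
        intro a _
        have := Equiv.sum_comp (Equiv.inv (ZMod m)ˣ)
          (fun u : (ZMod m)ˣ => χ u * (saw (a * (u : ZMod m)) : ℂ))
        simp only [Equiv.inv_apply] at this
        rw [this, hcon, mul_zero]

/-- All character sums of f vanish, so f = 0 by inversion. For even χ this is oddness of f; for odd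
χ, averaging the hypothesis at av against χ⁻¹(v) gives the product of the character sum of f with a
sawtooth sum, and a is chosen to make the latter nonzero. -/
theorem eq_zero_of_forall_sum_mul_saw {m : ℕ} [NeZero m] {f : (ZMod m)ˣ → ℚ}
    (hodd : ∀ u, f (-u) = -f u) (h : ∀ a : ZMod m, ∑ u : (ZMod m)ˣ, f u * saw (a * (u : ZMod m)) = 0) :
    f = 0 := by
  have key : ∀ χ : DirichletCharacter ℂ m, ∑ u : (ZMod m)ˣ, (f u : ℂ) * χ u = 0 := by
    intro χ
    rcases χ.even_or_odd with hχ | hχ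
    · refine Function.Odd.sum_eq_zero fun u => ?_
      rw [hodd, Units.val_neg, hχ.eval_neg]
      push_cast
      ring
    · have hχ' : (χ⁻¹).Odd := by
        rw [DirichletCharacter.Odd, MulChar.inv_apply_eq_inv', hχ]
        norm_num
      obtain ⟨a, ha⟩ := exists_sum_mul_saw_ne_zero hχ'
      have h0 : ∑ v : (ZMod m)ˣ, χ⁻¹ v *
          ∑ u : (ZMod m)ˣ, (f u : ℂ) * (saw (a * (v : ZMod m) * (u : ZMod m)) : ℂ) = 0 := by
        refine Finset.sum_eq_zero fun v _ => ?_
        have := congrArg (fun x : ℚ => (x : ℂ)) (h (a * (v : ZMod m)))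
        push_cast at this
        rw [this, mul_zero]
      have h1 : ∑ v : (ZMod m)ˣ, χ⁻¹ v *
          ∑ u : (ZMod m)ˣ, (f u : ℂ) * (saw (a * (v : ZMod m) * (u : ZMod m)) : ℂ) =
          (∑ u : (ZMod m)ˣ, (f u : ℂ) * χ u) *
            ∑ w : (ZMod m)ˣ, χ⁻¹ w * (saw (a * (w : ZMod m)) : ℂ) := by
        simp_rw [Finset.sum_mul, Finset.mul_sum]
        rw [Finset.sum_comm]
        refine Finset.sum_congr rfl fun u _ => ?_
        rw [← Equiv.sum_comp (Equiv.mulRight u⁻¹)]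
        refine Finset.sum_congr rfl fun w _ => ?_
        have e1 : χ⁻¹ ((w * u⁻¹ : (ZMod m)ˣ) : ZMod m) = χ⁻¹ (w : ZMod m) * χ u := by
          rw [Units.val_mul, map_mul]
          congr 1
          rw [MulChar.inv_apply, Ring.inverse_unit, inv_inv]
        have e2 : a * ((w * u⁻¹ : (ZMod m)ˣ) : ZMod m) * (u : ZMod m) = a * (w : ZMod m) := by
          rw [mul_assoc, ← Units.val_mul, inv_mul_cancel_right]
        rw [Equiv.coe_mulRight, e1, e2]
        ring
      rw [h1] at h0
      exact (mul_eq_zero.mp h0).resolve_right ha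
  funext v
  have h2 : ∑ χ : DirichletCharacter ℂ m, χ (v : ZMod m)⁻¹ * ∑ u : (ZMod m)ˣ, (f u : ℂ) * χ u =
      m.totient * f v := by
    simp_rw [Finset.mul_sum]
    rw [Finset.sum_comm]
    rw [Finset.sum_eq_single v]
    · have := DirichletCharacter.sum_char_inv_mul_char_eq ℂ v.isUnit v
      rw [if_pos rfl] at this
      rw [← this, Finset.sum_mul]
      exact Finset.sum_congr rfl fun χ _ => by ring
    · intro u _ huv
      have := DirichletCharacter.sum_char_inv_mul_char_eq ℂ v.isUnit u
      rw [if_neg fun h => huv (Units.ext h.symm)] at this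
      calc _ = (f u : ℂ) * ∑ χ : DirichletCharacter ℂ m, χ (v : ZMod m)⁻¹ * χ u := by
            rw [Finset.mul_sum]
            exact Finset.sum_congr rfl fun χ _ => by ring
        _ = 0 := by rw [this, mul_zero]
    · simp
  simp_rw [key, mul_zero, Finset.sum_const_zero] at h2
  have hφ : (m.totient : ℂ) ≠ 0 :=
    Nat.cast_ne_zero.mpr (Nat.totient_pos.mpr (NeZero.pos m)).ne'
  have := (mul_eq_zero.mp h2.symm).resolve_left hφ
  exact_mod_cast this

/-- The odd part of the coefficients of `θ_m(a)`, as a function on `(ℤ/m)ˣ`. -/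
def psi {m : ℕ} (a : ZMod m) : (ZMod m)ˣ → ℚ := fun u => saw (-(a * (u : ZMod m)))

theorem psi_apply {m : ℕ} (a : ZMod m) (u : (ZMod m)ˣ) : psi a u = -saw (a * (u : ZMod m)) :=
  saw_neg _

theorem psi_neg {m : ℕ} (a : ZMod m) : psi (-a) = -psi a := by
  funext u
  rw [Pi.neg_apply, psi_apply, psi_apply, neg_mul, saw_neg]

theorem psi_neg_right {m : ℕ} (a : ZMod m) (u : (ZMod m)ˣ) : psi a (-u) = -psi a u := by
  rw [psi_apply, psi_apply, Units.val_neg, mul_neg, saw_neg]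

theorem psi_zero {m : ℕ} : psi (0 : ZMod m) = 0 := by
  funext u
  rw [psi_apply, zero_mul, saw_zero, neg_zero, Pi.zero_apply]

/-! ### Rank of the span of the ψ(a) and the constants -/

section HalfSystem

variable {m : ℕ} [NeZero m]

variable (m) in
/-- A system of representatives of `(ℤ/m)ˣ` modulo `±1`. -/
def halfUnits : Finset (ZMod m)ˣ :=
  Finset.univ.filter fun u => (u : ZMod m).val < (-(u : ZMod m)).val

theorem mem_halfUnits {u : (ZMod m)ˣ} :
    u ∈ halfUnits m ↔ (u : ZMod m).val < (-(u : ZMod m)).val := by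
  simp [halfUnits]

theorem unit_ne_neg (hm : 2 < m) (u : (ZMod m)ˣ) : (u : ZMod m) ≠ -(u : ZMod m) := by
  intro h
  have h2 : (2 : ZMod m) * u = 0 := by
    rw [two_mul]; nth_rewrite 2 [h]; exact add_neg_cancel _
  have h3 : ((2 : ℕ) : ZMod m) = 0 := by
    have := congrArg (· * ((u⁻¹ : (ZMod m)ˣ) : ZMod m)) h2
    simpa [mul_assoc] using this
  rw [ZMod.natCast_eq_zero_iff] at h3
  exact absurd (Nat.le_of_dvd two_pos h3) (not_le.mpr hm)

theorem neg_mem_halfUnits (hm : 2 < m) (u : (ZMod m)ˣ) : -u ∈ halfUnits m ↔ u ∉ halfUnits m := by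
  rw [mem_halfUnits, mem_halfUnits, Units.val_neg, neg_neg, not_lt]
  refine ⟨le_of_lt, fun h => lt_of_le_of_ne h fun h' => ?_⟩
  exact unit_ne_neg hm u (ZMod.val_injective m h').symm

theorem sum_units_eq (hm : 2 < m) {M : Type*} [AddCommMonoid M] (F : (ZMod m)ˣ → M) :
    ∑ u, F u = ∑ u ∈ halfUnits m, (F u + F (-u)) := by
  rw [Finset.sum_add_distrib, ← Finset.sum_add_sum_compl (halfUnits m)]
  congr 1
  refine Finset.sum_nbij' (fun u => -u) (fun u => -u) ?_ ?_ ?_ ?_ ?_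
  · intro u hu
    exact (neg_mem_halfUnits hm u).mpr (Finset.mem_compl.mp hu)
  · intro u hu
    rw [Finset.mem_compl]
    exact fun h => (neg_mem_halfUnits hm u).mp h hu
  all_goals simp

theorem two_mul_card_halfUnits (hm : 2 < m) : 2 * (halfUnits m).card = m.totient := by
  have := sum_units_eq hm (fun _ : (ZMod m)ˣ => 1)
  simp only [Finset.sum_const, smul_eq_mul, mul_one, Finset.card_univ,
    ZMod.card_units_eq_totient] at this
  omega

/-- The span of the `ψ(a)` and of the constants has dimension at least `φ(m) / 2 + 1`. -/
theorem totient_add_two_le_two_mul_finrank (hm : 2 < m) (U : Submodule ℚ ((ZMod m)ˣ → ℚ))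
    (hU : ∀ a, psi a ∈ U) (hU1 : (fun _ => 1 : (ZMod m)ˣ → ℚ) ∈ U) :
    m.totient + 2 ≤ 2 * Module.finrank ℚ U := by
  classical
  -- Functionals on U: pairing with an odd function given by its values on a half system, plus a
  -- multiple of the total sum. Injectivity of L bounds the dimension of U below by φ(m)/2 + 1.
  let L : ((halfUnits m → ℚ) × ℚ) →ₗ[ℚ] Module.Dual ℚ U :=
    LinearMap.mk₂ ℚ (fun fc v => (∑ u : halfUnits m, fc.1 u * (v.1 u - v.1 (-u.1))) +
        fc.2 * ∑ u, v.1 u)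
      (by intro x y v; simp only [Prod.fst_add, Prod.snd_add, Pi.add_apply, add_mul,
            Finset.sum_add_distrib]; ring)
      (by intro r x v; simp only [Prod.smul_fst, Prod.smul_snd, Pi.smul_apply, smul_eq_mul,
            mul_assoc, ← Finset.mul_sum]; ring)
      (by intro x v w
          have e : ∀ u : halfUnits m, x.1 u * ((v + w).1 u - (v + w).1 (-u.1)) =
              x.1 u * (v.1 u - v.1 (-u.1)) + x.1 u * (w.1 u - w.1 (-u.1)) := by
            intro u
            simp only [Submodule.coe_add, Pi.add_apply]; ring
          rw [Finset.sum_congr rfl fun u _ => e u, Finset.sum_add_distrib]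
          simp only [Submodule.coe_add, Pi.add_apply, Finset.sum_add_distrib]
          ring)
      (by intro r x v
          have e : ∀ u : halfUnits m, x.1 u * ((r • v).1 u - (r • v).1 (-u.1)) =
              r * (x.1 u * (v.1 u - v.1 (-u.1))) := by
            intro u
            simp only [Submodule.coe_smul, Pi.smul_apply, smul_eq_mul]; ring
          rw [Finset.sum_congr rfl fun u _ => e u, ← Finset.mul_sum]
          simp only [Submodule.coe_smul, Pi.smul_apply, smul_eq_mul, ← Finset.mul_sum]
          ring)
  have hL : Function.Injective L := by
    rw [injective_iff_map_eq_zero]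
    rintro ⟨f, c⟩ h0
    have h0' : ∀ v : U, (∑ u : halfUnits m, f u * (v.1 u - v.1 (-u.1))) + c * ∑ u, v.1 u = 0 :=
      fun v => DFunLike.congr_fun h0 v
    have hc : c = 0 := by
      have := h0' ⟨_, hU1⟩
      simpa [NeZero.ne m] using this
    let g : (ZMod m)ˣ → ℚ := fun u =>
      if h : u ∈ halfUnits m then f ⟨u, h⟩ else -(if h : -u ∈ halfUnits m then f ⟨-u, h⟩ else 0)
    have hg : ∀ u : halfUnits m, g u = f u ∧ g (-u) = -f u := by
      intro u
      have h1 : (-u : (ZMod m)ˣ) ∉ halfUnits m := fun h =>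
        (neg_mem_halfUnits hm _).mp h u.2
      simp [g, h1]
    have hodd : ∀ u, g (-u) = -g u := by
      intro u
      by_cases h : u ∈ halfUnits m
      · rw [(hg ⟨u, h⟩).1, (hg ⟨u, h⟩).2]
      · have h' := (neg_mem_halfUnits hm u).mpr h
        have h1 := (hg ⟨-u, h'⟩).1
        have h2 := (hg ⟨-u, h'⟩).2
        simp only [neg_neg] at h2
        rw [h1, h2, neg_neg]
    have hg0 : g = 0 := by
      refine eq_zero_of_forall_sum_mul_saw hodd fun a => ?_
      have h1 := h0' ⟨_, hU a⟩
      rw [hc, zero_mul, add_zero] at h1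
      rw [sum_units_eq hm, ← Finset.sum_coe_sort, ← neg_eq_zero, ← Finset.sum_neg_distrib, ← h1]
      refine Finset.sum_congr rfl fun u _ => ?_
      change _ = f u * (psi a u - psi a (-u.1))
      rw [(hg u).1, (hg u).2, psi_neg_right, psi_apply, Units.val_neg, mul_neg, saw_neg]
      ring
    refine Prod.ext ?_ hc
    funext u
    change f u = 0
    rw [← (hg u).1, hg0, Pi.zero_apply]
  have h1 := LinearMap.finrank_le_finrank_of_injective hL
  rw [Subspace.dual_finrank_eq, Module.finrank_prod, Module.finrank_self,
    Module.finrank_fintype_fun_eq_card, Fintype.card_coe] at h1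
  have := two_mul_card_halfUnits hm
  omega

end HalfSystem

/-! ### The distribution relation of the sawtooth -/

section Fibers

variable {m : ℕ} [NeZero m]

theorem natCast_mul_eq_iff {n p : ℕ} (hp : p ≠ 0) (hm : m = p * n) (x y : ZMod m) :
    (p : ZMod m) * x = p * y ↔ x.val ≡ y.val [MOD n] := by
  have h : (p : ZMod m) * x = p * y ↔ p * x.val ≡ p * y.val [MOD m] := by
    rw [← ZMod.natCast_eq_natCast_iff, Nat.cast_mul, Nat.cast_mul, ZMod.natCast_zmod_val,
      ZMod.natCast_zmod_val]
  have e : p * x.val ≡ p * y.val [MOD m] ↔ p * x.val ≡ p * y.val [MOD p * n] := by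
    simp only [Nat.ModEq, hm]
  rw [h, e]
  exact ⟨fun h => Nat.ModEq.mul_left_cancel' hp h, fun h => Nat.ModEq.mul_left' p h⟩

open scoped Classical in
theorem sum_fiber_val {p : ℕ} (hp : p ∣ m) (y : ZMod m) :
    ∑ x : ZMod m with (p : ZMod m) * x = p * y, (x.val : ℚ) =
      ((p : ZMod m) * y).val + m * (p - 1) / 2 := by
  obtain ⟨n, hn⟩ := hp
  have hm0 := NeZero.ne m
  have hp0 : p ≠ 0 := by rintro rfl; simp at hn; exact hm0 hn
  have hn0 : n ≠ 0 := by rintro rfl; simp at hn; exact hm0 hn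
  have hnpos := Nat.pos_of_ne_zero hn0
  set y0 := y.val % n with hy0
  have hy0n : y0 < n := Nat.mod_lt _ hnpos
  have hlt : ∀ k ∈ Finset.range p, y0 + k * n < m := by
    intro k hk
    rw [Finset.mem_range] at hk
    calc y0 + k * n < n + k * n := by omega
      _ = (k + 1) * n := by ring
      _ ≤ p * n := Nat.mul_le_mul_right _ hk
      _ = m := hn.symm
  have hval : ∀ k ∈ Finset.range p, ((y0 + k * n : ℕ) : ZMod m).val = y0 + k * n := fun k hk =>
    ZMod.val_cast_of_lt (hlt k hk)
  -- The fibre is the arithmetic progression y0 + kn with 0 ≤ k < p.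
  have h1 : ∑ x : ZMod m with (p : ZMod m) * x = p * y, (x.val : ℚ) =
      ∑ k ∈ Finset.range p, ((y0 + k * n : ℕ) : ℚ) := by
    refine Finset.sum_nbij' (fun x => x.val / n) (fun k => ((y0 + k * n : ℕ) : ZMod m)) ?_ ?_ ?_ ?_ ?_
    · intro x hx
      rw [Finset.mem_range, Nat.div_lt_iff_lt_mul hnpos, ← hn]
      exact ZMod.val_lt x
    · intro k hk
      rw [Finset.mem_filter, natCast_mul_eq_iff hp0 hn, hval k hk]
      refine ⟨Finset.mem_univ _, ?_⟩
      rw [Nat.ModEq, Nat.add_mul_mod_self_right, hy0, Nat.mod_mod]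
    · intro x hx
      rw [Finset.mem_filter, natCast_mul_eq_iff hp0 hn] at hx
      rw [hy0, ← hx.2, mul_comm, Nat.mod_add_div, ZMod.natCast_zmod_val]
    · intro k hk
      rw [hval k hk, Nat.add_mul_div_right _ _ hnpos, Nat.div_eq_of_lt hy0n, zero_add]
    · intro x hx
      rw [Finset.mem_filter, natCast_mul_eq_iff hp0 hn] at hx
      rw [hy0, ← hx.2, mul_comm (x.val / n), Nat.mod_add_div]
  have h2 : ((p : ZMod m) * y).val = p * y0 := by
    have e : (p : ZMod m) * y = ((p * y.val : ℕ) : ZMod m) := by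
      rw [Nat.cast_mul, ZMod.natCast_zmod_val]
    have e' : p * y.val % m = p * y.val % (p * n) := by simp only [hn]
    rw [e, ZMod.val_natCast, e', Nat.mul_mod_mul_left]
  have h3 : ∀ k : ℕ, ∑ i ∈ Finset.range k, ((y0 + i * n : ℕ) : ℚ) =
      k * y0 + n * (k * (k - 1) / 2) := by
    intro k
    induction k with
    | zero => simp
    | succ k ih => rw [Finset.sum_range_succ, ih]; push_cast; ring
  rw [h1, h2, h3]
  have : (m : ℚ) = p * n := by exact_mod_cast hn
  rw [this]
  push_cast
  ring

open scoped Classical in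
/-- The distribution relation for the sawtooth function. -/
theorem sum_fiber_saw {p : ℕ} (hp : p ∣ m) (y : ZMod m) :
    ∑ x : ZMod m with (p : ZMod m) * x = p * y, saw x = saw ((p : ZMod m) * y) := by
  have h1 := sum_fiber_val hp y
  have h2 := sum_fiber_val hp (-y)
  have h3 : ∑ x : ZMod m with (p : ZMod m) * x = p * y, ((-x).val : ℚ) =
      ∑ x : ZMod m with (p : ZMod m) * x = p * (-y), (x.val : ℚ) := by
    refine Finset.sum_nbij' (fun x => -x) (fun x => -x) ?_ ?_ ?_ ?_ ?_ <;>
      simp +contextual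
  simp only [saw]
  rw [← Finset.sum_div, Finset.sum_sub_distrib, h1, h3, h2, mul_neg]
  congr 1
  ring

open scoped Classical in
/-- The distribution relation for `ψ`. -/
theorem sum_fiber_psi {p : ℕ} (hp : p ∣ m) (y : ZMod m) :
    ∑ x : ZMod m with (p : ZMod m) * x = p * y, psi x = psi ((p : ZMod m) * y) := by
  funext u
  rw [Finset.sum_apply, psi_apply, mul_assoc, ← sum_fiber_saw hp, ← Finset.sum_neg_distrib]
  refine Finset.sum_nbij' (fun x => x * u) (fun x => x * (u⁻¹ : (ZMod m)ˣ)) ?_ ?_ ?_ ?_ ?_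
  · intro x hx
    simp only [Finset.mem_filter, Finset.mem_univ, true_and] at hx ⊢
    rw [← mul_assoc, hx, mul_assoc]
  · intro x hx
    simp only [Finset.mem_filter, Finset.mem_univ, true_and] at hx ⊢
    rw [← mul_assoc, hx, mul_assoc, mul_assoc, Units.mul_inv, mul_one]
  · intro x _
    rw [mul_assoc, Units.mul_inv, mul_one]
  · intro x _
    rw [mul_assoc, Units.inv_mul, mul_one]
  · intro x _
    exact psi_apply x u

/-- The sawtooth function is compatible with the inclusions `ℤ/n → ℤ/kn`. -/
theorem saw_mul {k n : ℕ} (hm : m = k * n) (x : ℤ) :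
    saw (((k : ℤ) * x : ℤ) : ZMod m) = saw (x : ZMod n) := by
  have hm0 := NeZero.ne m
  have hk0 : k ≠ 0 := by rintro rfl; simp at hm; exact hm0 hm
  have hn0 : n ≠ 0 := by rintro rfl; simp at hm; exact hm0 hm
  have : NeZero n := ⟨hn0⟩
  have key : ∀ x : ℤ, ((((k : ℤ) * x : ℤ) : ZMod m).val : ℚ) = k * ((x : ZMod n).val : ℚ) := by
    intro x
    have h1 : ((((k : ℤ) * x : ℤ) : ZMod m).val : ℤ) = k * ((x : ZMod n).val : ℤ) := by
      rw [ZMod.val_intCast, ZMod.val_intCast, hm, Nat.cast_mul,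
        Int.mul_emod_mul_of_pos _ _ (by exact_mod_cast Nat.pos_of_ne_zero hk0)]
    exact_mod_cast h1
  have hx : -(((k : ℤ) * x : ℤ) : ZMod m) = (((k : ℤ) * (-x) : ℤ) : ZMod m) := by push_cast; ring
  have hx' : -(x : ZMod n) = ((-x : ℤ) : ZMod n) := by push_cast; ring
  rw [saw, saw, hx, hx', key, key]
  have : (m : ℚ) = k * n := by exact_mod_cast hm
  rw [this]
  field_simp

end Fibers

/-! ### Odd distributions at prime power level -/

section LevelPrimePower

/-- An odd `q`-periodic function on `ℤ`, `q` a power of `p`, satisfying the distribution relation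
for `p`, is generated by its values at `1, …, φ(q) / 2`. -/
theorem mem_of_distribution_prime_power {V : Type*} [AddCommGroup V] {p e q : ℕ}
    (hp : p.Prime) (hq : q = p ^ e) (hq2 : 2 < q) (f : ℤ → V) (hper : ∀ x, f (x + q) = f x)
    (hodd : ∀ x, f (-x) = -f x) (h0 : f 0 = 0)
    (hdist : ∀ x, ∑ k ∈ Finset.range p, f (x - k * (q / p : ℕ)) = f (p * x))
    (W : Submodule ℤ V) (hW : ∀ b : ℕ, 1 ≤ b → b ≤ q.totient / 2 → f b ∈ W) (x : ℤ) : f x ∈ W := by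
  have hper' : ∀ (x k : ℤ), f (x + k * q) = f x := by
    intro x k
    induction k using Int.induction_on with
    | zero => simp
    | succ k ih => rw [← ih, ← hper (x + k * q)]; congr 1; ring
    | pred k ih => rw [← ih, ← hper]; congr 1; ring
  have he : e ≠ 0 := by rintro rfl; simp at hq; omega
  obtain ⟨n, hn⟩ : ∃ n, q = p * n := ⟨p ^ (e - 1), by rw [hq, ← pow_succ', Nat.sub_add_cancel (by omega)]⟩
  have hqn : q / p = n := by rw [hn, Nat.mul_div_cancel_left _ hp.pos]
  have htot : q.totient = q - n := by
    rw [hq, Nat.totient_prime_pow hp (by omega), Nat.mul_sub, mul_one, ← pow_succ,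
      Nat.sub_add_cancel (by omega), ← hq]
    congr 1
    have : p * n = p * p ^ (e - 1) := by
      rw [← hn, hq, ← pow_succ', Nat.sub_add_cancel (by omega)]
    exact (Nat.eq_of_mul_eq_mul_left hp.pos this).symm
  obtain ⟨φ, hφ⟩ : ∃ φ, q.totient = 2 * φ := (Nat.totient_even hq2).exists_two_nsmul _ |>.imp
    fun _ h => by simpa using h
  have hnq : n ≤ q := hn ▸ Nat.le_mul_of_pos_left n hp.pos
  have hqφ : (q : ℤ) = 2 * φ + n := by omega
  have hsmall : ∀ y : ℤ, |y| ≤ φ → f y ∈ W := by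
    have hpos : ∀ y : ℤ, 0 ≤ y → y ≤ φ → f y ∈ W := by
      intro y hy hyφ
      lift y to ℕ using hy
      rcases Nat.eq_zero_or_pos y with rfl | hy
      · rw [Nat.cast_zero, h0]; exact W.zero_mem
      · exact hW y hy (by omega)
    intro y hy
    rw [abs_le] at hy
    rcases le_total 0 y with h | h
    · exact hpos y h hy.2
    · have := hpos (-y) (by omega) (by omega)
      rw [hodd] at this
      exact neg_mem_iff.mp this
  -- For φ < y ≤ q/2 (φ is half of φ(q), so q = 2φ + n), the fibre terms y - kn with 1 ≤ k ≤ p - 1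
  -- all lie in [-φ, φ]. The distribution relation thus exchanges f(y) for f(py).
  have hstep : ∀ y : ℤ, 0 ≤ y → 2 * y ≤ q → f (p * y) ∈ W → f y ∈ W := by
    intro y hy hyq hpy
    by_cases hyφ : y ≤ φ
    · exact hsmall y (by rw [abs_le]; omega)
    · rw [← hdist, hqn, ← Nat.sub_add_cancel hp.pos, Finset.sum_range_succ'] at hpy
      rw [Nat.cast_zero, zero_mul, sub_zero] at hpy
      refine (Submodule.add_mem_iff_right W (Submodule.sum_mem _ fun k hk => hsmall _ ?_)).mp hpy
      rw [Finset.mem_range] at hk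
      have h1 : ((k + 1 : ℕ) : ℤ) * n ≤ (p - 1 : ℕ) * n := by
        gcongr; omega
      have h2 : ((p - 1 : ℕ) : ℤ) * n = q - n := by
        rw [Nat.cast_sub hp.one_le, hn]; push_cast; ring
      have h3 : (n : ℤ) ≤ ((k + 1 : ℕ) : ℤ) * n := by
        push_cast; nlinarith [Int.natCast_nonneg n, Int.natCast_nonneg k]
      rw [abs_le]
      constructor <;> omega
  -- Since py is divisible by one more power of p, induct from multiples of q, where f is 0, down to
  -- all integers. Periodicity and oddness bring each argument into [0, q/2] without losing
  -- divisibility.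
  have hval : ∀ k ≤ e, ∀ x : ℤ, f (p ^ (e - k) * x) ∈ W := by
    intro k
    induction k with
    | zero =>
      intro _ x
      have : (p : ℤ) ^ (e - 0) * x = 0 + x * q := by rw [hq, Nat.sub_zero]; push_cast; ring
      rw [this, hper', h0]
      exact W.zero_mem
    | succ k ih =>
      intro hk x
      have ih' := ih (by omega)
      set d := (p : ℤ) ^ (e - (k + 1)) with hd
      have hpd : (p : ℤ) ^ (e - k) = p * d := by
        rw [hd, ← pow_succ']; congr 1; omega
      obtain ⟨c, hc⟩ : d ∣ (q : ℤ) := by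
        rw [hq, hd]; push_cast; exact pow_dvd_pow _ (by omega)
      have hmain : ∀ y : ℤ, 0 ≤ y → 2 * y ≤ q → d ∣ y → f y ∈ W := by
        rintro y hy hyq ⟨z, rfl⟩
        refine hstep _ hy hyq ?_
        rw [← mul_assoc, ← hpd]
        exact ih' z
      have hq0 : (0 : ℤ) < q := by exact_mod_cast (by omega : 0 < q)
      have hr : d ∣ (d * x) % q := by
        rw [Int.emod_def, hc]
        exact dvd_sub (dvd_mul_right _ _) (Dvd.intro (c * (d * x / (d * c))) (by ring))
      have hfr : f (d * x) = f ((d * x) % q) := by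
        rw [← hper' ((d * x) % q) (d * x / q)]
        congr 1
        rw [mul_comm (d * x / q), Int.emod_add_mul_ediv]
      rw [hfr]
      have hr0 := Int.emod_nonneg (d * x) hq0.ne'
      have hr1 := Int.emod_lt_of_pos (d * x) hq0
      generalize (d * x) % q = r at *
      rcases le_total (2 * r) q with h | h
      · exact hmain r hr0 h hr
      · have h2 := hmain (q - r) (by omega) (by omega) (dvd_sub (Dvd.intro c hc.symm) hr)
        rw [← neg_mem_iff, ← hodd, ← hper, neg_add_eq_sub]
        exact h2
  simpa using hval e le_rfl x

end LevelPrimePower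

theorem isUnit_iff_not_minFac_dvd {q : ℕ} (hq : IsPrimePow q) (z : ℕ) :
    IsUnit (z : ZMod q) ↔ ¬ q.minFac ∣ z := by
  have h := hq.minFac_pow_factorization_eq
  have he : 0 < q.factorization q.minFac := by
    rcases Nat.eq_zero_or_pos (q.factorization q.minFac) with h0 | h0
    · rw [h0, pow_zero] at h
      exact absurd h.symm hq.ne_one
    · exact h0
  have hp : q.minFac.Prime := Nat.minFac_prime hq.ne_one
  rw [ZMod.isUnit_iff_coprime, ← hp.coprime_iff_not_dvd, Nat.coprime_comm]
  have e : q.Coprime z ↔ (q.minFac ^ q.factorization q.minFac).Coprime z := by rw [h]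
  rw [e]
  exact Nat.coprime_pow_left_iff he _ _

theorem div_minFac_mul_eq_zero_iff {q : ℕ} (hq : IsPrimePow q) (z : ZMod q) :
    ((q / q.minFac : ℕ) : ZMod q) * z = 0 ↔ ¬ IsUnit z := by
  have : NeZero q := ⟨hq.ne_zero⟩
  have hp : q.minFac.Prime := Nat.minFac_prime hq.ne_one
  have hpq : q / q.minFac * q.minFac = q := Nat.div_mul_cancel (Nat.minFac_dvd q)
  have hpos : 0 < q / q.minFac := Nat.div_pos (Nat.minFac_le hq.pos) hp.pos
  rw [← ZMod.natCast_zmod_val z, isUnit_iff_not_minFac_dvd hq, not_not, ← Nat.cast_mul,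
    ZMod.natCast_eq_zero_iff]
  have e : q ∣ q / q.minFac * z.val ↔ q / q.minFac * q.minFac ∣ q / q.minFac * z.val := by
    rw [hpq]
  rw [e]
  exact Nat.mul_dvd_mul_iff_left hpos

/-! ### Chinese remainder coordinates and norm relations -/

section CRT

variable {m t : ℕ} {q : Fin t → ℕ} (hq : IsPrimePowerFactorization m q)

/-- The Chinese remainder isomorphism. -/
def crt : ZMod m ≃+* (∀ i, ZMod (q i)) :=
  (ZMod.ringEquivCongr hq.prod_eq.symm).trans
    (ZMod.prodEquivPi q fun i j hij => hq.coprime i j hij)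

theorem crt_natCast (n : ℕ) (i : Fin t) : crt hq (n : ZMod m) i = n := by
  rw [map_natCast, Pi.natCast_apply]

theorem crt_natCast_mul (n : ℕ) (x : ZMod m) (i : Fin t) :
    crt hq ((n : ZMod m) * x) i = n * crt hq x i := by
  rw [map_mul, Pi.mul_apply, crt_natCast]

include hq in
theorem isUnit_natCast_of_ne {k l : Fin t} (h : l ≠ k) : IsUnit (q k : ZMod (q l)) := by
  rw [ZMod.isUnit_iff_coprime]
  exact hq.coprime k l h.symm

include hq in
theorem q_dvd (k : Fin t) : q k ∣ m := hq.prod_eq ▸ Finset.dvd_prod_of_mem q (Finset.mem_univ k)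

theorem q_mul_eq_iff (k : Fin t) (x y : ZMod m) :
    (q k : ZMod m) * x = q k * y ↔ ∀ l, l ≠ k → crt hq x l = crt hq y l := by
  rw [← (crt hq).injective.eq_iff, funext_iff]
  refine forall_congr' fun l => ?_
  rw [crt_natCast_mul, crt_natCast_mul]
  by_cases h : l = k
  · subst h; simp
  · simp only [h, ne_eq, not_false_eq_true, forall_const]
    exact (isUnit_natCast_of_ne hq h).mul_right_inj

include hq in
theorem isUnit_div_minFac {k l : Fin t} (h : l ≠ k) :
    IsUnit ((q k / (q k).minFac : ℕ) : ZMod (q l)) := by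
  have := isUnit_natCast_of_ne hq h
  rw [← Nat.div_mul_cancel (Nat.minFac_dvd (q k)), Nat.cast_mul] at this
  exact isUnit_of_mul_isUnit_left this

include hq in
theorem isUnit_minFac {k l : Fin t} (h : l ≠ k) : IsUnit ((q k).minFac : ZMod (q l)) := by
  have := isUnit_natCast_of_ne hq h
  rw [← Nat.div_mul_cancel (Nat.minFac_dvd (q k)), Nat.cast_mul] at this
  exact isUnit_of_mul_isUnit_right this

/-- The fibre of multiplication by q_k leaves the k-th coordinate free; the fibre here allows
exactly its non-units. The difference of the two distribution relations is therefore a sum over the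
units at k. -/
theorem q_div_mul_eq_iff (k : Fin t) (x y : ZMod m) (hy : crt hq y k = 0) :
    ((q k / (q k).minFac : ℕ) : ZMod m) * x = (q k / (q k).minFac : ℕ) * y ↔
      (∀ l, l ≠ k → crt hq x l = crt hq y l) ∧ ¬ IsUnit (crt hq x k) := by
  have h1 : ∀ l, l ≠ k → (((q k / (q k).minFac : ℕ) : ZMod (q l)) * crt hq x l =
      (q k / (q k).minFac : ℕ) * crt hq y l ↔ crt hq x l = crt hq y l) := fun l h =>
    (isUnit_div_minFac hq h).mul_right_inj
  rw [← (crt hq).injective.eq_iff, funext_iff]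
  simp only [crt_natCast_mul]
  constructor
  · intro h
    refine ⟨fun l hl => (h1 l hl).mp (h l), ?_⟩
    rw [← div_minFac_mul_eq_zero_iff (hq.isPrimePow k), h k, hy, mul_zero]
  · rintro ⟨h, h'⟩ l
    by_cases hl : l = k
    · subst hl
      rw [hy, mul_zero, (div_minFac_mul_eq_zero_iff (hq.isPrimePow l) _).mpr h']
    · exact (h1 l hl).mpr (h l hl)

variable [NeZero m] [∀ i, NeZero (q i)]

/-- The norm relation at one prime. -/
theorem sum_units_psi (k : Fin t) (y : ZMod m) (hy : crt hq y k = 0) :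
    ∑ g : (ZMod (q k))ˣ, psi ((crt hq).symm (Function.update (crt hq y) k (g : ZMod (q k)))) =
      psi ((q k : ZMod m) * y) - psi (((q k / (q k).minFac : ℕ) : ZMod m) * y) := by
  classical
  have hd : q k / (q k).minFac ∣ m := (Nat.div_dvd_of_dvd (Nat.minFac_dvd _)).trans (q_dvd hq k)
  rw [← sum_fiber_psi (q_dvd hq k), ← sum_fiber_psi hd, eq_sub_iff_add_eq,
    ← Finset.sum_filter_add_sum_filter_not
      (Finset.univ.filter fun x : ZMod m => (q k : ZMod m) * x = q k * y)
      (fun x => IsUnit (crt hq x k)), Finset.filter_filter, Finset.filter_filter]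
  congr 1
  · refine Finset.sum_bij (fun g _ => (crt hq).symm (Function.update (crt hq y) k (g : ZMod (q k))))
      ?_ ?_ ?_ (fun _ _ => rfl)
    · intro g _
      simp only [Finset.mem_filter, Finset.mem_univ, true_and, q_mul_eq_iff hq,
        RingEquiv.apply_symm_apply, Function.update_self, Units.isUnit, and_true]
      intro l hl
      rw [Function.update_of_ne hl]
    · intro g _ g' _ h
      have := congrFun ((crt hq).symm.injective h) k
      simpa [Units.ext_iff] using this
    · intro x hx
      simp only [Finset.mem_filter, Finset.mem_univ, true_and, q_mul_eq_iff hq] at hx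
      refine ⟨hx.2.unit, Finset.mem_univ _, ?_⟩
      rw [RingEquiv.symm_apply_eq]
      funext l
      by_cases hl : l = k
      · subst hl; simp
      · rw [Function.update_of_ne hl, hx.1 l hl]
  · refine Finset.sum_congr (Finset.filter_congr fun x _ => ?_) fun _ _ => rfl
    rw [q_div_mul_eq_iff hq k x y hy, q_mul_eq_iff hq]

end CRT

/-- The residue class of an element of `(ℤ/n)ˣ ∪ {0}`. -/
def resid {n : ℕ} (x : WithZero (ZMod n)ˣ) : ZMod n :=
  WithZero.recZeroCoe (motive := fun _ => ZMod n) 0 (fun g => (g : ZMod n)) x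

@[simp] theorem resid_zero {n : ℕ} : resid (0 : WithZero (ZMod n)ˣ) = 0 := rfl

@[simp] theorem resid_coe {n : ℕ} (g : (ZMod n)ˣ) : resid (g : WithZero (ZMod n)ˣ) = g := rfl

theorem resid_coe_mul {n : ℕ} (g : (ZMod n)ˣ) (x : WithZero (ZMod n)ˣ) :
    resid ((g : WithZero (ZMod n)ˣ) * x) = (g : ZMod n) * resid x := by
  induction x using WithZero.recZeroCoe with
  | zero => simp
  | coe x => rw [← WithZero.coe_mul, resid_coe, resid_coe, Units.val_mul]

theorem resid_eq_zero_iff {n : ℕ} (hn : 1 < n) {x : WithZero (ZMod n)ˣ} : resid x = 0 ↔ x = 0 := by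
  have : Fact (1 < n) := ⟨hn⟩
  induction x using WithZero.recZeroCoe with
  | zero => simp
  | coe x => simp

theorem resid_injective {n : ℕ} (hn : 1 < n) : Function.Injective (resid (n := n)) := by
  have : Fact (1 < n) := ⟨hn⟩
  intro x y h
  induction x using WithZero.recZeroCoe with
  | zero => exact ((resid_eq_zero_iff hn).mp (h.symm.trans resid_zero)).symm
  | coe x =>
    induction y using WithZero.recZeroCoe with
    | zero => exact (resid_eq_zero_iff hn).mp h
    | coe y => rw [resid_coe, resid_coe] at h; rw [Units.ext h]

theorem resid_isUnit_or {n : ℕ} (x : WithZero (ZMod n)ˣ) : x = 0 ∨ IsUnit (resid x) := by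
  induction x using WithZero.recZeroCoe with
  | zero => exact Or.inl rfl
  | coe x => exact Or.inr x.isUnit

/-! ### Residue classes attached to symbols -/

section SymbEval

variable {m t : ℕ} {q : Fin t → ℕ} (hq : IsPrimePowerFactorization m q)
  [NeZero m] [∀ i, NeZero (q i)]

/-- The product of the `q_i` at which a symbol vanishes. -/
def symbRad (c : Symb fun i => (ZMod (q i))ˣ) : ℕ := ∏ i ∈ (symbSupp c)ᶜ, q i

include hq in
theorem isUnit_symbRad (c : Symb fun i => (ZMod (q i))ˣ) {i : Fin t} (hi : c i ≠ 0) :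
    IsUnit (symbRad c : ZMod (q i)) := by
  rw [ZMod.isUnit_iff_coprime, symbRad]
  refine Nat.Coprime.prod_left fun l hl => hq.coprime l i ?_
  rintro rfl
  exact (Finset.mem_compl.mp hl) (mem_symbSupp.mpr hi)

/-- The residue class modulo `m` attached to a symbol. -/
def symbEval (c : Symb fun i => (ZMod (q i))ˣ) : ZMod m :=
  -- The factor `symbRad c` is the gcd of the resulting residue with m, so the symbol records the
  -- residue divided by this gcd, which is the normalisation used by the conditions defining `M`.
  (crt hq).symm fun i => (symbRad c : ZMod (q i)) * resid (c i)

theorem crt_symbEval (c : Symb fun i => (ZMod (q i))ˣ) (i : Fin t) :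
    crt hq (symbEval hq c) i = symbRad c * resid (c i) := by
  rw [symbEval, RingEquiv.apply_symm_apply]

theorem crt_symbEval_twist (σ : ∀ i, (ZMod (q i))ˣ) (c : Symb fun i => (ZMod (q i))ˣ)
    (i : Fin t) :
    crt hq (symbEval hq (twist σ c)) i = σ i * crt hq (symbEval hq c) i := by
  rw [crt_symbEval, crt_symbEval, symbRad, symbSupp_twist, twist_apply, resid_coe_mul, symbRad]
  ring

variable (q) in
/-- The twist at `k` in the norm relations: the inverse of the prime dividing `q_k`. -/
def invPrime (k i : Fin t) : (ZMod (q i))ˣ :=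
  if h : ((q k).minFac).Coprime (q i) then (ZMod.unitOfCoprime _ h)⁻¹ else 1

include hq in
theorem minFac_mul_invPrime {k i : Fin t} (h : i ≠ k) :
    ((q k).minFac : ZMod (q i)) * (invPrime q k i : ZMod (q i)) = 1 := by
  have h1 : ((q k).minFac).Coprime (q i) := by
    rw [← ZMod.isUnit_iff_coprime]; exact isUnit_minFac hq h
  rw [invPrime, dif_pos h1]
  have := (ZMod.unitOfCoprime _ h1).mul_inv
  rwa [ZMod.coe_unitOfCoprime] at this

theorem unit_zmod_lt_half_iff {n : ℕ} [NeZero n] (hn : 2 < n) (g : (ZMod n)ˣ) :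
    2 * (g : ZMod n).val < n ↔ ¬ 2 * ((-1 * g : (ZMod n)ˣ) : ZMod n).val < n := by
  have h0 : (g : ZMod n) ≠ 0 := by
    intro h
    apply unit_ne_neg hn g
    rw [h, neg_zero]
  have hne : (g : ZMod n).val ≠ (-(g : ZMod n)).val := fun h =>
    unit_ne_neg hn g (ZMod.val_injective n h)
  have h1 := ZMod.neg_val (g : ZMod n)
  rw [if_neg h0] at h1
  have h2 := ZMod.val_lt (g : ZMod n)
  rw [neg_one_mul, Units.val_neg]
  omega

/-- The data of the cyclotomic distribution. -/
def cycDist (hq2 : ∀ i, 2 < q i) : DistData fun i => (ZMod (q i))ˣ where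
  j _ := -1
  A _ _ := 1
  B := invPrime q
  H i := {g | 2 * (g : ZMod (q i)).val < q i}
  j_mul _ := by simp
  mem_H i g := unit_zmod_lt_half_iff (hq2 i) g

/-- The relation at k is the difference of the distribution relations for multiplication by q_k and
by q_k/p_k. The first returns the class of c itself, the second its twist by p_k⁻¹. -/
theorem isOddDistribution (hq2 : ∀ i, 2 < q i) :
    IsOddDistribution (cycDist hq2) fun c => (psi (symbEval hq c) : (ZMod m)ˣ → ℚ) where
  odd c := by
    rw [← psi_neg]
    congr 1
    apply (crt hq).injective
    funext i
    rw [crt_symbEval_twist, map_neg, Pi.neg_apply]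
    simp [cycDist]
  rel k c hc := by
    classical
    -- The class of c with the factor q_k removed from its radical, because filling the k-th
    -- coordinate with a unit removes k from the vanishing set.
    set y : ZMod m := (crt hq).symm fun i =>
      ((∏ l ∈ (symbSupp c)ᶜ.erase k, q l : ℕ) : ZMod (q i)) * resid (c i) with hy
    have hk : k ∈ (symbSupp c)ᶜ := by simp [mem_symbSupp, hc]
    have hyi : ∀ i, crt hq y i =
        ((∏ l ∈ (symbSupp c)ᶜ.erase k, q l : ℕ) : ZMod (q i)) * resid (c i) := by
      intro i; rw [hy, RingEquiv.apply_symm_apply]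
    have hyk : crt hq y k = 0 := by rw [hyi, hc, resid_zero, mul_zero]
    have hrad : symbRad c = q k * ∏ l ∈ (symbSupp c)ᶜ.erase k, q l :=
      (Finset.mul_prod_erase _ _ hk).symm
    have hupd : ∀ g : (ZMod (q k))ˣ, (symbSupp (Function.update c k (g : WithZero (ZMod (q k))ˣ)))ᶜ =
        (symbSupp c)ᶜ.erase k := by
      intro g
      ext i
      by_cases hi : i = k
      · subst hi; simp [mem_symbSupp]
      · simp [mem_symbSupp, hi]
    have hunit : IsUnit ((∏ l ∈ (symbSupp c)ᶜ.erase k, q l : ℕ) : ZMod (q k)) := by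
      rw [ZMod.isUnit_iff_coprime]
      exact Nat.Coprime.prod_left fun l hl => hq.coprime l k (Finset.ne_of_mem_erase hl)
    have h1 := sum_units_psi hq k y hyk
    have e1 : (q k : ZMod m) * y = symbEval hq (twist ((cycDist hq2).A k) c) := by
      apply (crt hq).injective
      funext i
      rw [crt_natCast_mul, crt_symbEval_twist, crt_symbEval, hyi, hrad]
      simp only [cycDist, Units.val_one, one_mul]
      push_cast
      ring
    have e2 : ((q k / (q k).minFac : ℕ) : ZMod m) * y =
        symbEval hq (twist ((cycDist hq2).B k) c) := by
      apply (crt hq).injective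
      funext i
      rw [crt_natCast_mul, crt_symbEval_twist, crt_symbEval, hyi, hrad]
      by_cases hi : i = k
      · subst hi; rw [hc]; simp
      · have h2 := minFac_mul_invPrime hq hi
        have h3 : ((q k : ℕ) : ZMod (q i)) = (q k / (q k).minFac : ℕ) * (q k).minFac := by
          rw [← Nat.cast_mul, Nat.div_mul_cancel (Nat.minFac_dvd _)]
        change _ = (invPrime q k i : ZMod (q i)) * _
        rw [Nat.cast_mul, h3]
        linear_combination (-((q k / (q k).minFac : ℕ) : ZMod (q i)) *
          (∏ l ∈ (symbSupp c)ᶜ.erase k, q l : ℕ) * resid (c i)) * h2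
    -- The evaluation of a filled symbol multiplies its k-th entry by the reduced radical, a unit at
    -- k; reindexing absorbs this unit.
    rw [← e1, ← e2, ← h1, ← Equiv.sum_comp (Equiv.mulLeft hunit.unit⁻¹)]
    refine Finset.sum_congr rfl fun g _ => ?_
    congr 1
    apply (crt hq).injective
    rw [RingEquiv.apply_symm_apply]
    funext i
    rw [crt_symbEval, symbRad, hupd]
    by_cases hi : i = k
    · subst hi
      rw [Function.update_self, Function.update_self, resid_coe, Equiv.coe_mulLeft, Units.val_mul,
        ← mul_assoc, IsUnit.mul_val_inv, one_mul]
    · simp [hi, hyi]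
  two v hv := by
    funext u
    have := congrFun hv u
    simp only [Pi.add_apply, Pi.zero_apply] at this ⊢
    linarith

end SymbEval

open scoped Classical in
theorem sum_fiber_eq_sum_range {m p : ℕ} [NeZero m] (hp : p ∣ m) {V : Type*} [AddCommMonoid V]
    (F : ZMod m → V) (y : ZMod m) :
    ∑ x : ZMod m with (p : ZMod m) * x = p * y, F x =
      ∑ k ∈ Finset.range p, F (y - k * (m / p : ℕ)) := by
  obtain ⟨n, hn⟩ := hp
  have hm0 := NeZero.ne m
  have hp0 : p ≠ 0 := by rintro rfl; simp at hn; exact hm0 hn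
  have hn0 : n ≠ 0 := by rintro rfl; simp at hn; exact hm0 hn
  have hmp : m / p = n := by rw [hn, Nat.mul_div_cancel_left _ (Nat.pos_of_ne_zero hp0)]
  have hzero : ((p : ZMod m) * n) = 0 := by rw [← Nat.cast_mul, ← hn, ZMod.natCast_self]
  rw [hmp]
  symm
  refine Finset.sum_bij (fun k _ => y - k * (n : ZMod m)) ?_ ?_ ?_ (fun _ _ => rfl)
  · intro k _
    simp only [Finset.mem_filter, Finset.mem_univ, true_and]
    linear_combination (-(k : ZMod m)) * hzero
  · intro k hk l hl h
    rw [Finset.mem_range] at hk hl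
    have h' : ((k * n : ℕ) : ZMod m) = ((l * n : ℕ) : ZMod m) := by
      push_cast; exact sub_right_injective h
    have hlt : ∀ k, k < p → k * n < m := fun k hk => by
      rw [hn]; exact Nat.mul_lt_mul_of_pos_right hk (Nat.pos_of_ne_zero hn0)
    rw [ZMod.natCast_eq_natCast_iff, Nat.ModEq, Nat.mod_eq_of_lt (hlt k hk),
      Nat.mod_eq_of_lt (hlt l hl)] at h'
    exact Nat.eq_of_mul_eq_mul_right (Nat.pos_of_ne_zero hn0) h'
  · intro x hx
    simp only [Finset.mem_filter, Finset.mem_univ, true_and] at hx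
    have h1 : (p : ZMod m) * (y - x) = p * 0 := by rw [mul_sub, hx]; ring
    rw [natCast_mul_eq_iff hp0 hn, ZMod.val_zero, Nat.modEq_zero_iff_dvd] at h1
    obtain ⟨k, hk⟩ := h1
    refine ⟨k, ?_, ?_⟩
    · rw [Finset.mem_range]
      by_contra! hkp
      have := ZMod.val_lt (y - x)
      have h2 : n * p ≤ n * k := Nat.mul_le_mul_left n hkp
      rw [hk, hn, mul_comm p] at this
      omega
    · rw [← Nat.cast_mul, mul_comm k, ← hk, ZMod.natCast_zmod_val]
      ring

/-! ### The index set M_m in terms of symbols, and generation of all ψ(z) -/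

section Index

variable {m t : ℕ} {q : Fin t → ℕ} (hq : IsPrimePowerFactorization m q)
  [NeZero m] [∀ i, NeZero (q i)]

theorem crt_eq_natCast_val (z : ZMod m) (i : Fin t) : crt hq z i = (z.val : ZMod (q i)) := by
  rw [← crt_natCast hq, ZMod.natCast_zmod_val]

theorem mem_J'_val_iff (z : ZMod m) (i : Fin t) : i ∈ J' q z.val ↔ crt hq z i ≠ 0 := by
  rw [J', Finset.mem_filter, crt_eq_natCast_val, ne_eq, ZMod.natCast_eq_zero_iff]
  simp

/-- Every residue class whose coordinates are zero or units comes from a symbol. -/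
theorem exists_symbEval_eq (hq1 : ∀ i, 1 < q i) {z : ZMod m}
    (hz : ∀ i, crt hq z i = 0 ∨ IsUnit (crt hq z i)) : ∃ c, symbEval hq c = z := by
  classical
  set R : ℕ := ∏ i ∈ (J' q z.val)ᶜ, q i with hR
  have hne : ∀ i, IsUnit (crt hq z i) → crt hq z i ≠ 0 := by
    intro i h
    have : Fact (1 < q i) := ⟨hq1 i⟩
    exact h.ne_zero
  have hRu : ∀ i, IsUnit (crt hq z i) → IsUnit (R : ZMod (q i)) := by
    intro i h
    rw [ZMod.isUnit_iff_coprime, hR]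
    refine Nat.Coprime.prod_left fun l hl => hq.coprime l i ?_
    rintro rfl
    exact (Finset.mem_compl.mp hl) ((mem_J'_val_iff hq z l).mpr (hne l h))
  let c : Symb fun i => (ZMod (q i))ˣ := fun i =>
    if h : IsUnit (crt hq z i) then (((hRu i h).unit⁻¹ * h.unit : (ZMod (q i))ˣ) : WithZero _) else 0
  have hc : ∀ i, c i ≠ 0 ↔ IsUnit (crt hq z i) := by
    intro i
    by_cases h : IsUnit (crt hq z i) <;> simp [c, h]
  have hsupp : symbSupp c = J' q z.val := by
    ext i
    rw [mem_symbSupp, hc, mem_J'_val_iff hq]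
    exact ⟨hne i, fun h => (hz i).resolve_left h⟩
  refine ⟨c, (crt hq).injective (funext fun i => ?_)⟩
  rw [crt_symbEval, symbRad, hsupp, ← hR]
  by_cases h : IsUnit (crt hq z i)
  · simp only [c, dif_pos h]
    rw [resid_coe, Units.val_mul, ← mul_assoc, IsUnit.mul_val_inv, one_mul, IsUnit.unit_spec]
  · simp only [c, dif_neg h]
    rw [resid_zero, mul_zero, (hz i).resolve_right h]

theorem symbEval_coord (c : Symb fun i => (ZMod (q i))ˣ) (i : Fin t) :
    crt hq (symbEval hq c) i = 0 ∨ IsUnit (crt hq (symbEval hq c) i) := by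
  rw [crt_symbEval]
  rcases resid_isUnit_or (c i) with h | h
  · left; rw [h, resid_zero, mul_zero]
  · by_cases hc : c i = 0
    · left; rw [hc, resid_zero, mul_zero]
    · exact Or.inr ((isUnit_symbRad hq c hc).mul h)

theorem crt_symbEval_eq_zero (hq1 : ∀ i, 1 < q i) (c : Symb fun i => (ZMod (q i))ˣ) (i : Fin t) :
    crt hq (symbEval hq c) i = 0 ↔ c i = 0 := by
  rw [crt_symbEval]
  refine ⟨fun h => ?_, fun h => by rw [h, resid_zero, mul_zero]⟩
  by_contra hc
  rw [(isUnit_symbRad hq c hc).mul_right_eq_zero, resid_eq_zero_iff (hq1 i)] at h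
  exact hc h

theorem J'_symbEval (hq1 : ∀ i, 1 < q i) (c : Symb fun i => (ZMod (q i))ˣ) :
    J' q (symbEval hq c).val = symbSupp c := by
  ext i
  rw [mem_J'_val_iff hq, mem_symbSupp, ne_eq, crt_symbEval_eq_zero hq hq1]

include hq in
theorem symbRad_mul (c : Symb fun i => (ZMod (q i))ˣ) :
    symbRad c * ∏ i ∈ symbSupp c, q i = m := by
  rw [symbRad, Finset.prod_compl_mul_prod, hq.prod_eq]

theorem symbRad_dvd_val (hq1 : ∀ i, 1 < q i) (c : Symb fun i => (ZMod (q i))ˣ) :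
    symbRad c ∣ (symbEval hq c).val := by
  refine Finset.prod_dvd_of_isRelPrime
    (fun i _ j _ hij => Nat.coprime_iff_isRelPrime.mp (hq.coprime i j hij)) (fun i hi => ?_)
  rw [← ZMod.natCast_eq_zero_iff, ← crt_eq_natCast_val hq, crt_symbEval_eq_zero hq hq1]
  simpa [mem_symbSupp] using hi

theorem coprime_val_prod (c : Symb fun i => (ZMod (q i))ˣ) (hq1 : ∀ i, 1 < q i) :
    ((symbEval hq c).val).Coprime (∏ i ∈ symbSupp c, q i) := by
  refine Nat.Coprime.prod_right fun i hi => ?_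
  rw [← ZMod.isUnit_iff_coprime, ← crt_eq_natCast_val hq]
  refine (symbEval_coord hq c i).resolve_left ?_
  rw [crt_symbEval_eq_zero hq hq1]
  exact mem_symbSupp.mp hi

theorem gcd_symbEval (hq1 : ∀ i, 1 < q i) (c : Symb fun i => (ZMod (q i))ˣ) :
    ((symbEval hq c).val).gcd m = symbRad c := by
  have e : ((symbEval hq c).val).gcd m =
      ((symbEval hq c).val).gcd (symbRad c * ∏ i ∈ symbSupp c, q i) := by
    simp only [symbRad_mul hq c]
  rw [e, Nat.Coprime.gcd_mul_right_cancel_right _ (coprime_val_prod hq c hq1).symm]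
  exact Nat.gcd_eq_right (symbRad_dvd_val hq hq1 c)

theorem symbEval_mem_X (hq1 : ∀ i, 1 < q i) {c : Symb fun i => (ZMod (q i))ˣ}
    (hc : (symbSupp c).Nonempty) : (symbEval hq c).val ∈ X m := by
  obtain ⟨i, hi⟩ := hc
  refine ⟨Nat.pos_of_ne_zero fun h => ?_, ZMod.val_lt _, ?_⟩
  · rw [ZMod.val_eq_zero] at h
    apply mem_symbSupp.mp hi
    rw [← crt_symbEval_eq_zero hq hq1, h, map_zero, Pi.zero_apply]
  · rw [gcd_symbEval hq hq1]
    have hpos : 0 < symbRad c := Nat.pos_of_ne_zero fun h => NeZero.ne m (by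
      rw [← symbRad_mul hq c, h, zero_mul])
    have : m / symbRad c = ∏ i ∈ symbSupp c, q i :=
      Nat.div_eq_of_eq_mul_right hpos (symbRad_mul hq c).symm
    rw [this]
    exact coprime_val_prod hq c hq1

theorem intCast_modEq_iff {n : ℕ} (a b : ℤ) : a ≡ b [ZMOD n] ↔ (a : ZMod n) = b :=
  (ZMod.intCast_eq_intCast_iff a b n).symm

theorem natCast_resid {c : Symb fun i => (ZMod (q i))ˣ} {i : Fin t} (hi : c i ≠ 0) {a : ℕ}
    (ha : (symbEval hq c).val = symbRad c * a) : (a : ZMod (q i)) = resid (c i) := by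
  have h1 := crt_symbEval hq c i
  rw [crt_eq_natCast_val, ha, Nat.cast_mul] at h1
  exact (isUnit_symbRad hq c hi).mul_left_cancel h1

theorem val_modEq_symbRad_iff (hq1 : ∀ i, 1 < q i) (c : Symb fun i => (ZMod (q i))ˣ) (i : Fin t) :
    (symbEval hq c).val ≡ symbRad c [MOD q i] ↔ c i = 0 ∨ c i = 1 := by
  rw [← ZMod.natCast_eq_natCast_iff, ← crt_eq_natCast_val hq, crt_symbEval]
  by_cases hi : c i = 0
  · have : (symbRad c : ZMod (q i)) = 0 := by
      rw [ZMod.natCast_eq_zero_iff, symbRad]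
      exact Finset.dvd_prod_of_mem q (by simp [mem_symbSupp, hi])
    simp [hi, this]
  · simp only [hi, false_or]
    nth_rewrite 2 [← mul_one (symbRad c : ZMod (q i))]
    rw [(isUnit_symbRad hq c hi).mul_right_inj, ← Units.val_one, ← resid_coe, WithZero.coe_one]
    exact (resid_injective (hq1 i)).eq_iff

/-- The gcd with m is `symbRad c`, a unit wherever c is nonzero. Cancelling it turns each congruence
into a condition on c i, the divisibility a ∣ m into all entries being 0 or 1, and the fractional
part condition into membership in the half system of residues below q_k/2. -/
theorem symbEval_mem_M_iff (hq2 : ∀ i, 2 < q i) {c : Symb fun i => (ZMod (q i))ˣ}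
    (hc : (symbSupp c).Nonempty) :
    (symbEval hq c).val ∈ M m q ↔ InM (cycDist hq2) c := by
  have hq1 : ∀ i, 1 < q i := fun i => (by norm_num : 1 < 2).trans (hq2 i)
  have hX := symbEval_mem_X hq hq1 hc
  have hg := gcd_symbEval hq hq1 c
  have hmod := val_modEq_symbRad_iff hq hq1 c
  have hpos : 0 < symbRad c := Nat.pos_of_ne_zero fun h => NeZero.ne m (by
    rw [← symbRad_mul hq c, h, zero_mul])
  have hset : {i | ¬ (symbEval hq c).val ≡ ((symbEval hq c).val).gcd m [MOD q i]} =
      {i | c i ≠ 0 ∧ c i ≠ 1} := by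
    ext i
    rw [Set.mem_ofPred_eq, Set.mem_ofPred_eq, hg, hmod, not_or]
  have hdvd : (symbEval hq c).val ∣ m ↔ ∀ i, c i = 0 ∨ c i = 1 := by
    constructor
    · intro h i
      rw [← hmod, ← hg, Nat.gcd_eq_left h]
    · intro h
      have h1 : symbEval hq c = (symbRad c : ZMod m) := by
        apply (crt hq).injective
        funext i
        rw [crt_natCast, crt_eq_natCast_val, ZMod.natCast_eq_natCast_iff]
        exact (hmod i).mpr (h i)
      have h2 : symbRad c < m := by
        rw [← hg]
        exact (Nat.gcd_le_left _ hX.1).trans_lt hX.2.1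
      rw [h1, ZMod.val_cast_of_lt h2]
      exact ⟨_, (symbRad_mul hq c).symm⟩
  rw [M, Set.mem_ofPred_eq, InM, and_iff_right hX]
  refine and_congr ?_ (and_congr ?_ ?_)
  · refine forall_congr' fun i => ?_
    rw [hg]
    have h1 : ¬ q i ∣ (symbEval hq c).val ↔ c i ≠ 0 := by
      rw [← ZMod.natCast_eq_zero_iff, ← crt_eq_natCast_val hq, crt_symbEval_eq_zero hq hq1]
    rw [h1]
    by_cases hi : c i = 0
    · simp [hi]
    · simp only [ne_eq, hi, not_false_eq_true, forall_const]
      rw [intCast_modEq_iff]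
      push_cast
      rw [← crt_eq_natCast_val hq, crt_symbEval, ← mul_neg_one,
        (isUnit_symbRad hq c hi).mul_right_inj]
      have : (-1 : ZMod (q i)) = resid ((-1 : (ZMod (q i))ˣ) : WithZero (ZMod (q i))ˣ) := by
        rw [resid_coe, Units.val_neg, Units.val_one]
      rw [this, (resid_injective (hq1 i)).eq_iff]
      rfl
  · rw [hset]
    have h2 : ∀ k, IsGreatest {i | c i ≠ 0 ∧ c i ≠ 1} k →
        ((Int.fract (((symbEval hq c).val : ℚ) / ((((symbEval hq c).val).gcd m : ℚ) * (q k : ℚ))) <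
          1 / 2) ↔ ∃ g ∈ (cycDist hq2).H k, c k = (g : WithZero (ZMod (q k))ˣ)) := by
      intro k hk
      have hck := hk.1.1
      obtain ⟨g, hgk⟩ := WithZero.ne_zero_iff_exists.mp hck
      obtain ⟨a, ha⟩ := symbRad_dvd_val hq hq1 c
      have h3 := natCast_resid hq hck ha
      have hqk : (0 : ℚ) < q k := by exact_mod_cast NeZero.pos (q k)
      have h4 : ((symbEval hq c).val : ℚ) / ((((symbEval hq c).val).gcd m : ℚ) * (q k : ℚ)) =
          (a : ℚ) / (q k : ℚ) := by
        have : (symbRad c : ℚ) ≠ 0 := by exact_mod_cast hpos.ne'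
        rw [hg, ha]
        push_cast
        field_simp
      rw [h4]
      have h5 : Int.fract ((a : ℚ) / (q k : ℚ)) = ((g : ZMod (q k)).val : ℚ) / q k := by
        rw [← resid_coe, hgk, ← h3, ZMod.val_natCast]
        exact Int.fract_div_natCast_eq_div_natCast_mod
      rw [h5, div_lt_iff₀ hqk]
      have h6 : (((g : ZMod (q k)).val : ℚ) < 1 / 2 * q k) ↔ 2 * (g : ZMod (q k)).val < q k := by
        rw [← Nat.cast_lt (α := ℚ)]
        push_cast
        constructor <;> intro h <;> linarith
      rw [h6]
      constructor
      · exact fun h => ⟨g, h, hgk.symm⟩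
      · rintro ⟨g', h, h'⟩
        rw [← hgk, WithZero.coe_inj] at h'
        rw [h']; exact h
    constructor
    · intro h k hk
      refine (h2 k hk).mp (h ?_ k hk)
      rw [hdvd]
      intro h'
      exact (h' k).elim hk.1.1 hk.1.2
    · intro h _ k hk
      exact (h2 k hk).mpr (h k hk)
  · rw [hdvd, J'_symbEval hq hq1]

include hq in
theorem minFac_dvd_div_gcd {a : ℕ} {i : Fin t} (h : ¬ q i ∣ a) : (q i).minFac ∣ m / a.gcd m := by
  have hp : ((q i).minFac).Prime := Nat.minFac_prime (hq.isPrimePow i).ne_one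
  by_contra hp'
  have h1 : (m / a.gcd m).Coprime (q i) := by
    rw [← ZMod.isUnit_iff_coprime]
    exact (isUnit_iff_not_minFac_dvd (hq.isPrimePow i) _).mpr hp'
  have h2 : q i ∣ a.gcd m * (m / a.gcd m) := by
    rw [Nat.mul_div_cancel' (Nat.gcd_dvd_right a m)]; exact q_dvd hq i
  exact h ((h1.symm.dvd_of_dvd_mul_right h2).trans (Nat.gcd_dvd_left a m))

/-- A coordinate that is neither 0 nor a unit would make p_i divide both a and m/(a,m), against the
coprimality in `X`. -/
theorem exists_symbEval_of_mem_X (hq1 : ∀ i, 1 < q i) {a : ℕ} (ha : a ∈ X m) :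
    ∃ c, (symbEval hq c).val = a := by
  obtain ⟨c, hc⟩ := exists_symbEval_eq hq hq1 (z := (a : ZMod m)) fun i => by
    rw [crt_natCast, isUnit_iff_not_minFac_dvd (hq.isPrimePow i), ZMod.natCast_eq_zero_iff]
    by_contra! h
    have hp : ((q i).minFac).Prime := Nat.minFac_prime (hq.isPrimePow i).ne_one
    have := Nat.dvd_gcd h.2 (minFac_dvd_div_gcd hq h.1)
    rw [ha.2.2] at this
    exact hp.one_lt.ne' (Nat.dvd_one.mp this)
  exact ⟨c, by rw [hc, ZMod.val_cast_of_lt ha.2.1]⟩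

/-- The elements `ψ(z)` with `z` coming from a symbol generate all `ψ(z)`. -/
theorem psi_mem_of_coord (W : Submodule ℤ ((ZMod m)ˣ → ℚ))
    (hW : ∀ z, (∀ i, crt hq z i = 0 ∨ IsUnit (crt hq z i)) → psi z ∈ W) (z : ZMod m) :
    psi z ∈ W := by
  classical
  induction hn : (z.val).gcd m using Nat.strong_induction_on generalizing z with
  | _ n ih =>
  by_cases hz : ∀ i, crt hq z i = 0 ∨ IsUnit (crt hq z i)
  · exact hW z hz
  push Not at hz
  obtain ⟨i, h0, h1⟩ := hz
  rw [crt_eq_natCast_val, isUnit_iff_not_minFac_dvd (hq.isPrimePow i), not_not] at h1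
  rw [crt_eq_natCast_val, ne_eq, ZMod.natCast_eq_zero_iff] at h0
  have hp : ((q i).minFac).Prime := Nat.minFac_prime (hq.isPrimePow i).ne_one
  have hd := minFac_dvd_div_gcd hq h0
  obtain ⟨y, hy⟩ := h1
  have hzy : z = ((q i).minFac : ZMod m) * y := by
    rw [← Nat.cast_mul, ← hy, ZMod.natCast_zmod_val]
  have hpm : (q i).minFac ∣ m := (Nat.minFac_dvd _).trans (q_dvd hq i)
  -- If z is divisible by p_i but not by q_i, the distribution relation replaces ψ(z) by a sum over
  -- x with p_i x = z.
  rw [hzy, ← sum_fiber_psi hpm]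
  refine Submodule.sum_mem _ fun x hx => ih _ ?_ x rfl
  rw [Finset.mem_filter, ← hzy] at hx
  have hg : ((q i).minFac * x.val).gcd m = n := by
    have h2 : (q i).minFac * x.val ≡ z.val [MOD m] := by
      rw [← ZMod.natCast_eq_natCast_iff, Nat.cast_mul, ZMod.natCast_zmod_val,
        ZMod.natCast_zmod_val, hx.2]
    rw [h2.gcd_eq, hn]
  have hle : x.val.gcd m ∣ n := by
    rw [← hg]
    exact Nat.gcd_dvd_gcd_of_dvd_left _ (dvd_mul_left _ _)
  have hnpos : 0 < n := hn ▸ Nat.gcd_pos_of_pos_right _ (NeZero.pos m)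
  -- Were the gcd of x with m still n, then p_i n would divide both p_i x and m, as p_i ∣ m/n, hence
  -- would divide n.
  refine lt_of_le_of_ne (Nat.le_of_dvd hnpos hle) fun h => ?_
  have h3 : (q i).minFac * n ∣ n := by
    nth_rewrite 2 [← hg]
    refine Nat.dvd_gcd (Nat.mul_dvd_mul_left _ (h ▸ Nat.gcd_dvd_left _ _)) ?_
    rw [hn] at hd
    have := Nat.mul_dvd_mul_right hd n
    rwa [Nat.div_mul_cancel (hn ▸ Nat.gcd_dvd_right _ _)] at this
  have h4 := Nat.le_of_dvd hnpos h3
  have h5 := hp.two_le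
  nlinarith

include hq in
/-- The `ψ((m / q_j) x)` are generated by those with `1 ≤ x ≤ φ(q_j) / 2`. -/
theorem psi_mem_of_prime_power (j : Fin t) (hq2 : 2 < q j) (W : Submodule ℤ ((ZMod m)ˣ → ℚ))
    (hW : ∀ b : ℕ, 1 ≤ b → b ≤ (q j).totient / 2 → psi ((m / q j * b : ℕ) : ZMod m) ∈ W)
    (x : ℕ) : psi ((m / q j * x : ℕ) : ZMod m) ∈ W := by
  have hp : ((q j).minFac).Prime := Nat.minFac_prime (hq.isPrimePow j).ne_one
  have hqm := Nat.div_mul_cancel (q_dvd hq j)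
  have hpm : (q j).minFac ∣ m := (Nat.minFac_dvd _).trans (q_dvd hq j)
  have hdiv : m / (q j).minFac = m / q j * (q j / (q j).minFac) := by
    apply Nat.div_eq_of_eq_mul_left hp.pos
    rw [mul_assoc, Nat.div_mul_cancel (Nat.minFac_dvd _), hqm]
  have := mem_of_distribution_prime_power hp (hq.isPrimePow j).minFac_pow_factorization_eq.symm hq2
    (fun x => psi (((m / q j : ℕ) : ZMod m) * ((x : ℤ) : ZMod m)))
    (fun x => by
      congr 1
      have : ((m / q j : ℕ) : ZMod m) * (q j : ℕ) = 0 := by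
        rw [← Nat.cast_mul, hqm, ZMod.natCast_self]
      push_cast at this ⊢
      linear_combination this)
    (fun x => by rw [← psi_neg]; congr 1; push_cast; ring)
    (by simp [psi_zero])
    (fun x => by
      have h1 := sum_fiber_psi hpm (((m / q j : ℕ) : ZMod m) * ((x : ℤ) : ZMod m))
      rw [sum_fiber_eq_sum_range hpm, hdiv] at h1
      have e : (((q j).minFac : ℤ) * x : ℤ) = ((q j).minFac : ZMod m) * (x : ZMod m) := by
        push_cast; ring
      rw [e, mul_left_comm, ← h1]
      refine Finset.sum_congr rfl fun k _ => ?_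
      congr 1
      simp only [Int.cast_sub, Int.cast_mul, Int.cast_natCast, Nat.cast_mul]
      ring)
    W (fun b h1 h2 => by simpa using hW b h1 h2) x
  simpa using this

/-- The induction principle generating all `ψ(z)` from those indexed by `M'_m`. -/
theorem psi_mem (hq2 : ∀ i, 2 < q i) (W : Submodule ℤ ((ZMod m)ˣ → ℚ))
    (h1 : ∀ i (b : ℕ), 1 ≤ b → b ≤ (q i).totient / 2 → psi ((m / q i * b : ℕ) : ZMod m) ∈ W)
    (h2 : ∀ a ∈ M m q, 1 < (J' q a).card → (∀ z, (∀ i, crt hq z i = 0 ∨ IsUnit (crt hq z i)) →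
      J' q z.val ⊂ J' q a → psi z ∈ W) → psi (a : ZMod m) ∈ W) (z : ZMod m) : psi z ∈ W := by
  have hq1 : ∀ i, 1 < q i := fun i => (by norm_num : 1 < 2).trans (hq2 i)
  have key : ∀ (B : Finset (Fin t)) (c : Symb fun i => (ZMod (q i))ˣ), symbSupp c = B →
      psi (symbEval hq c) ∈ W := by
    intro B
    induction B using Finset.strongInduction with
    | H B ih =>
    intro c hc
    -- Empty support gives ψ(0) = 0, a single coordinate is the prime power case, and larger
    -- supports fall under the abstract generation theorem.
    rcases Nat.lt_trichotomy B.card 1 with hB | hB | hB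
    · rw [Nat.lt_one_iff, Finset.card_eq_zero] at hB
      have : symbEval hq c = 0 := by
        apply (crt hq).injective
        funext i
        rw [map_zero, Pi.zero_apply, crt_symbEval_eq_zero hq hq1]
        by_contra hi
        rw [← ne_eq, ← mem_symbSupp, hc, hB] at hi
        simp at hi
      rw [this, psi_zero]
      exact W.zero_mem
    · obtain ⟨j, hj⟩ := Finset.card_eq_one.mp hB
      obtain ⟨x, hx⟩ := symbRad_dvd_val hq hq1 c
      have h3 := symbRad_mul hq c
      rw [hc, hj, Finset.prod_singleton] at h3
      have h4 : m / q j = symbRad c := by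
        rw [← h3, Nat.mul_div_cancel _ (NeZero.pos (q j))]
      rw [← ZMod.natCast_zmod_val (symbEval hq c), hx, ← h4]
      exact psi_mem_of_prime_power hq j (hq2 j) W (h1 j) x
    · refine (isOddDistribution hq hq2).mem_of_symbSupp_eq (B := B)
        (fun c' hc' => ih _ hc' c' rfl) (fun c' hc' hM => ?_) c hc
      have hne : (symbSupp c').Nonempty := by
        rw [hc', ← Finset.card_pos]; omega
      have h5 := h2 _ ((symbEval_mem_M_iff hq hq2 hne).mpr hM)
        (by rw [J'_symbEval hq hq1, hc']; exact hB) (fun z hz hzB => by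
          obtain ⟨c'', rfl⟩ := exists_symbEval_eq hq hq1 hz
          rw [J'_symbEval hq hq1, J'_symbEval hq hq1, hc'] at hzB
          exact ih _ hzB c'' rfl)
      rwa [ZMod.natCast_zmod_val] at h5
  refine psi_mem_of_coord hq W (fun z hz => ?_) z
  obtain ⟨c, rfl⟩ := exists_symbEval_eq hq hq1 hz
  exact key _ c rfl

end Index

instance {α : Type*} [Fintype α] : Fintype (WithZero α) :=
  inferInstanceAs (Fintype (Option α))

theorem card_withZero {α : Type*} [Fintype α] : Fintype.card (WithZero α) = Fintype.card α + 1 :=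
  Fintype.card_option

/-! ### Counting the symbols of the index set -/

section Count

variable {ι : Type*} [Fintype ι] [LinearOrder ι] {G : ι → Type*} [∀ i, CommGroup (G i)]
  [∀ i, Fintype (G i)]

open scoped Classical in
/-- The set of coordinates different from `0` and `1`. -/
def nontrivCoords (c : Symb G) : Finset ι := Finset.univ.filter fun i => c i ≠ 0 ∧ c i ≠ 1

theorem mem_nontrivCoords {c : Symb G} {i : ι} : i ∈ nontrivCoords c ↔ c i ≠ 0 ∧ c i ≠ 1 := by
  simp [nontrivCoords]

/-- Multiplying the last nontrivial coordinate by `j`. -/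
def flipTop (D : DistData G) (c : Symb G) : Symb G :=
  if h : (nontrivCoords c).Nonempty then
    Function.update c ((nontrivCoords c).max' h)
      ((D.j ((nontrivCoords c).max' h) : WithZero (G ((nontrivCoords c).max' h))) *
        c ((nontrivCoords c).max' h))
  else c

variable {D : DistData G} {c : Symb G}

theorem coe_j_mul_ne_one {i : ι} {x : WithZero (G i)} (hx : x ≠ D.j i) :
    (D.j i : WithZero (G i)) * x ≠ 1 := by
  intro h
  apply hx
  have hj : (D.j i : WithZero (G i)) * D.j i = 1 := by
    rw [← WithZero.coe_mul, D.j_mul, WithZero.coe_one]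
  calc x = (D.j i * D.j i : WithZero (G i)) * x := by rw [hj, one_mul]
    _ = D.j i := by rw [mul_assoc, h, mul_one]

theorem coe_j_mul_ne_j {i : ι} {x : WithZero (G i)} (hx : x ≠ 1) :
    (D.j i : WithZero (G i)) * x ≠ D.j i := by
  intro h
  exact hx (mul_left_cancel₀ WithZero.coe_ne_zero (h.trans (mul_one _).symm))

theorem nontrivCoords_flipTop (hc : ∀ i, c i ≠ D.j i) :
    nontrivCoords (flipTop D c) = nontrivCoords c := by
  rw [flipTop]
  split_ifs with h
  · have hk := Finset.max'_mem _ h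
    set k := (nontrivCoords c).max' h
    have hk' := mem_nontrivCoords.mp hk
    ext i
    by_cases hi : i = k
    · subst hi
      simp only [hk, iff_true]
      rw [mem_nontrivCoords, Function.update_self]
      exact ⟨mul_ne_zero WithZero.coe_ne_zero hk'.1, coe_j_mul_ne_one (hc _)⟩
    · rw [mem_nontrivCoords, mem_nontrivCoords, Function.update_of_ne hi]
  · rfl

theorem flipTop_flipTop (hc : ∀ i, c i ≠ D.j i) : flipTop D (flipTop D c) = c := by
  by_cases h : (nontrivCoords c).Nonempty
  · have h' : (nontrivCoords (flipTop D c)).Nonempty := by rwa [nontrivCoords_flipTop hc]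
    have hmax : (nontrivCoords (flipTop D c)).max' h' = (nontrivCoords c).max' h := by
      congr 1; exact nontrivCoords_flipTop hc
    rw [flipTop, dif_pos h', hmax]
    conv_lhs => rw [flipTop, dif_pos h]
    rw [Function.update_self, Function.update_idem, ← mul_assoc, ← WithZero.coe_mul, D.j_mul,
      WithZero.coe_one, one_mul, Function.update_eq_self]
  · rw [flipTop, dif_neg]
    · rw [flipTop, dif_neg h]
    · rwa [nontrivCoords_flipTop hc]

theorem symbSupp_flipTop : symbSupp (flipTop D c) = symbSupp c := by
  rw [flipTop]
  split_ifs with h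
  · ext i
    rw [mem_symbSupp, mem_symbSupp]
    by_cases hi : i = (nontrivCoords c).max' h
    · rw [hi, Function.update_self]
      simp
    · rw [Function.update_of_ne hi]
  · rfl

theorem flipTop_ne_j (hc : ∀ i, c i ≠ D.j i) (i : ι) : flipTop D c i ≠ D.j i := by
  rw [flipTop]
  split_ifs with h
  · have hk := mem_nontrivCoords.mp (Finset.max'_mem _ h)
    by_cases hi : i = (nontrivCoords c).max' h
    · rw [hi, Function.update_self]
      exact coe_j_mul_ne_j hk.2
    · rw [Function.update_of_ne hi]; exact hc i
  · exact hc i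

theorem isGreatest_nontrivCoords (h : (nontrivCoords c).Nonempty) :
    IsGreatest {i | c i ≠ 0 ∧ c i ≠ 1} ((nontrivCoords c).max' h) :=
  ⟨mem_nontrivCoords.mp (Finset.max'_mem _ h), fun i hi =>
    Finset.le_max' _ i (mem_nontrivCoords.mpr hi)⟩

theorem not_inM_flipTop (hc : InM D c) (h : (nontrivCoords c).Nonempty) :
    ¬ InM D (flipTop D c) := by
  intro hf
  have h' : (nontrivCoords (flipTop D c)).Nonempty := by rwa [nontrivCoords_flipTop hc.1]
  have hmax : (nontrivCoords (flipTop D c)).max' h' = (nontrivCoords c).max' h := by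
    congr 1; exact nontrivCoords_flipTop hc.1
  obtain ⟨g, hg, hgc⟩ := hc.2.1 _ (isGreatest_nontrivCoords h)
  have h2 := hf.2.1 _ (isGreatest_nontrivCoords h')
  rw [hmax] at h2
  obtain ⟨g', hg', hgc'⟩ := h2
  rw [flipTop, dif_pos h, Function.update_self, hgc, ← WithZero.coe_mul, WithZero.coe_inj] at hgc'
  rw [← hgc'] at hg'
  exact (D.mem_H _ _).mp hg hg'

variable (D) in
open scoped Classical in
/-- The symbols of the index set with support `B`. -/
def inMFinset (B : Finset ι) : Finset (Symb G) :=
  Finset.univ.filter fun c => symbSupp c = B ∧ InM D c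

open scoped Classical in
theorem card_symb_ne_j (B : Finset ι) :
    ((Finset.univ.filter fun c : Symb G => symbSupp c = B ∧ ∀ i, c i ≠ D.j i).card : ℤ) =
      ∏ i ∈ B, ((Fintype.card (G i) : ℤ) - 1) := by
  have h1 : (Finset.univ.filter fun c : Symb G => symbSupp c = B ∧ ∀ i, c i ≠ D.j i) =
      Fintype.piFinset fun i => if i ∈ B then (Finset.univ.erase (0 : WithZero (G i))).erase ↑(D.j i)
        else {0} := by
    ext c
    simp only [Finset.mem_filter, Finset.mem_univ, true_and, Fintype.mem_piFinset]
    constructor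
    · rintro ⟨rfl, h⟩ i
      by_cases hi : c i = 0
      · simp [mem_symbSupp, hi]
      · simp [mem_symbSupp, hi, h i]
    · intro h
      have h2 : symbSupp c = B := by
        ext i
        have := h i
        by_cases hi : i ∈ B
        · simp only [hi, if_true, Finset.mem_erase] at this
          simp only [mem_symbSupp, hi, iff_true]
          exact this.2.1
        · simpa [mem_symbSupp, hi] using this
      refine ⟨h2, fun i => ?_⟩
      have := h i
      by_cases hi : i ∈ B
      · simp only [hi, if_true, Finset.mem_erase] at this
        exact this.1
      · simp only [hi, if_false, Finset.mem_singleton] at this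
        rw [this]
        exact WithZero.coe_ne_zero.symm
  rw [h1, Fintype.card_piFinset, ← Finset.prod_filter_mul_prod_filter_not Finset.univ (· ∈ B)]
  rw [Finset.prod_congr rfl (g := fun i => Fintype.card (G i) - 1)
    (s₂ := Finset.univ.filter (· ∈ B)), Finset.prod_congr rfl (g := fun _ => 1)
    (s₂ := Finset.univ.filter (¬ · ∈ B)), Finset.prod_const_one, mul_one, Finset.filter_mem_eq_inter,
    Finset.univ_inter, Nat.cast_prod]
  · refine Finset.prod_congr rfl fun i _ => ?_
    rw [Nat.cast_sub Fintype.card_pos, Nat.cast_one]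
  · intro i hi
    rw [if_neg (Finset.mem_filter.mp hi).2, Finset.card_singleton]
  · intro i hi
    rw [if_pos (Finset.mem_filter.mp hi).2, Finset.card_erase_of_mem, Finset.card_erase_of_mem,
      Finset.card_univ, card_withZero]
    · omega
    · simp
    · simp

/-- The index symbols with a nontrivial coordinate, their flips, and 1_B are pairwise different
symbols of support B without entry j, and there are ∏(|G_i| - 1) of these. The symbol 1_B itself is
in the index set only for |B| odd, which produces the sign. -/
theorem two_mul_card_inMFinset_le (B : Finset ι) :
    2 * ((inMFinset D B).card : ℤ) ≤
      ∏ i ∈ B, ((Fintype.card (G i) : ℤ) - 1) - ∏ _i ∈ B, (-1 : ℤ) := by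
  classical
  rw [← card_symb_ne_j (D := D)]
  set T := Finset.univ.filter fun c : Symb G => symbSupp c = B ∧ ∀ i, c i ≠ D.j i with hT
  set P := (inMFinset D B).filter fun c => (nontrivCoords c).Nonempty with hP
  have hPmem : ∀ c, c ∈ P ↔ (symbSupp c = B ∧ InM D c) ∧ (nontrivCoords c).Nonempty := by
    intro c; simp [hP, inMFinset]
  have hinj : Set.InjOn (flipTop D) P := by
    intro c hc c' hc' h
    rw [← flipTop_flipTop ((hPmem c).mp hc).1.2.1, h, flipTop_flipTop ((hPmem c').mp hc').1.2.1]
  have hdisj : Disjoint P (P.image (flipTop D)) := by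
    rw [Finset.disjoint_left]
    intro c hc hcim
    obtain ⟨c', hc', rfl⟩ := Finset.mem_image.mp hcim
    have := (hPmem c').mp hc'
    exact not_inM_flipTop this.1.2 this.2 ((hPmem _).mp hc).1.2
  have hone_triv : ¬ (nontrivCoords (oneSymb G B)).Nonempty := by
    rintro ⟨i, hi⟩
    rw [mem_nontrivCoords, oneSymb] at hi
    split_ifs at hi <;> simp at hi
  have hone : oneSymb G B ∈ T := by
    rw [hT, Finset.mem_filter]
    refine ⟨Finset.mem_univ _, symbSupp_oneSymb B, fun i => ?_⟩
    rw [oneSymb]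
    split_ifs
    · rw [← WithZero.coe_one, ne_eq, WithZero.coe_inj]
      exact (D.j_ne_one i).symm
    · exact WithZero.coe_ne_zero.symm
  have hsub : insert (oneSymb G B) (P ∪ P.image (flipTop D)) ⊆ T := by
    intro c hc
    rw [Finset.mem_insert, Finset.mem_union, Finset.mem_image] at hc
    rcases hc with rfl | hc | ⟨c', hc', rfl⟩
    · exact hone
    · have := (hPmem c).mp hc
      simp only [hT, Finset.mem_filter, Finset.mem_univ, true_and]
      exact ⟨this.1.1, this.1.2.1⟩
    · have := (hPmem c').mp hc'
      simp only [hT, Finset.mem_filter, Finset.mem_univ, true_and]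
      exact ⟨symbSupp_flipTop.trans this.1.1, flipTop_ne_j this.1.2.1⟩
  have hnot : oneSymb G B ∉ P ∪ P.image (flipTop D) := by
    rw [Finset.mem_union, Finset.mem_image]
    rintro (h | ⟨c', hc', h⟩)
    · exact hone_triv ((hPmem _).mp h).2
    · have := (hPmem c').mp hc'
      apply hone_triv
      rw [← h, nontrivCoords_flipTop this.1.2.1]
      exact this.2
  have h1 := Finset.card_le_card hsub
  rw [Finset.card_insert_of_notMem hnot, Finset.card_union_of_disjoint hdisj,
    Finset.card_image_of_injOn hinj] at h1
  have h2 : ∀ c ∈ inMFinset D B, c ∉ P → c = oneSymb G B ∧ Odd B.card := by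
    intro c hc hcP
    have hc' : symbSupp c = B ∧ InM D c := by simpa [inMFinset] using hc
    have h3 : ∀ i, c i = 0 ∨ c i = 1 := by
      intro i
      by_contra! hi
      exact hcP ((hPmem c).mpr ⟨hc', i, mem_nontrivCoords.mpr hi⟩)
    refine ⟨?_, by rw [← hc'.1]; exact hc'.2.2.2 h3⟩
    funext i
    rw [oneSymb, ← hc'.1]
    by_cases hi : c i = 0
    · simp [mem_symbSupp, hi]
    · simp [mem_symbSupp, (h3 i).resolve_left hi]
  rw [Finset.prod_const]
  rcases Nat.even_or_odd B.card with he | ho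
  · have h3 : inMFinset D B ⊆ P := by
      intro c hc
      by_contra hcP
      exact Nat.not_even_iff_odd.mpr (h2 c hc hcP).2 he
    have h4 := Finset.card_le_card h3
    rw [he.neg_one_pow]
    omega
  · have h3 : inMFinset D B ⊆ insert (oneSymb G B) P := by
      intro c hc
      by_cases hcP : c ∈ P
      · exact Finset.mem_insert_of_mem hcP
      · exact Finset.mem_insert.mpr (Or.inl (h2 c hc hcP).1)
    have h4 := (Finset.card_le_card h3).trans (Finset.card_insert_le _ _)
    rw [ho.neg_one_pow]
    omega

end Count

/-! ### The cardinality of M'_m -/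

section CountM

variable {m t : ℕ} {q : Fin t → ℕ} (hq : IsPrimePowerFactorization m q)
  [NeZero m] [∀ i, NeZero (q i)]

include hq in
theorem totient_eq_prod : m.totient = ∏ i, (q i).totient := by
  rw [← ZMod.card_units_eq_totient,
    Fintype.card_congr ((Units.mapEquiv (crt hq).toMulEquiv).trans MulEquiv.piUnits).toEquiv,
    Fintype.card_pi]
  simp_rw [ZMod.card_units_eq_totient]

include hq in
theorem q_mul_div (i : Fin t) : m / q i * q i = m := Nat.div_mul_cancel (q_dvd hq i)

include hq in
theorem q_dvd_div {i j : Fin t} (h : i ≠ j) : q i ∣ m / q j := by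
  have h1 : q i ∣ m / q j * q j := by rw [q_mul_div hq]; exact q_dvd hq i
  exact (hq.coprime i j h).dvd_of_dvd_mul_right h1

include hq in
theorem coprime_q_div (j : Fin t) : (q j).Coprime (m / q j) := by
  have : m / q j = ∏ i ∈ Finset.univ.erase j, q i := by
    apply Nat.div_eq_of_eq_mul_right (NeZero.pos (q j))
    rw [Finset.mul_prod_erase _ _ (Finset.mem_univ j), hq.prod_eq]
  rw [this]
  exact Nat.Coprime.prod_right fun i hi => hq.coprime j i (Finset.ne_of_mem_erase hi).symm

include hq in
theorem J'_div_mul {j : Fin t} {b : ℕ} (hb : ¬ q j ∣ b) : J' q (m / q j * b) = {j} := by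
  ext i
  rw [J', Finset.mem_filter, Finset.mem_singleton]
  by_cases h : i = j
  · subst h
    simp only [Finset.mem_univ, true_and, iff_true]
    exact fun h' => hb ((coprime_q_div hq i).dvd_of_dvd_mul_left h')
  · simp only [Finset.mem_univ, true_and, h, iff_false, not_not]
    exact (q_dvd_div hq h).mul_right b

include hq in
theorem div_dvd_iff {a : ℕ} (j : Fin t) : m / q j ∣ a ↔ J' q a ⊆ {j} := by
  have hprod : m / q j = ∏ i ∈ Finset.univ.erase j, q i := by
    apply Nat.div_eq_of_eq_mul_right (NeZero.pos (q j))
    rw [Finset.mul_prod_erase _ _ (Finset.mem_univ j), hq.prod_eq]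
  constructor
  · intro h i hi
    rw [Finset.mem_singleton]
    by_contra hij
    exact (Finset.mem_filter.mp hi).2 ((q_dvd_div hq hij).trans h)
  · intro h
    rw [hprod]
    refine Finset.prod_dvd_of_isRelPrime
      (fun i _ j _ hij => Nat.coprime_iff_isRelPrime.mp (hq.coprime i j hij)) (fun i hi => ?_)
    by_contra hi'
    have := h (Finset.mem_filter.mpr ⟨Finset.mem_univ i, hi'⟩)
    exact Finset.ne_of_mem_erase hi (Finset.mem_singleton.mp this)

theorem not_dvd_of_le_totient {n b : ℕ} (hn : 1 < n) (h1 : 1 ≤ b) (h2 : b ≤ n.totient / 2) :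
    ¬ n ∣ b := by
  intro h
  have h3 := Nat.le_of_dvd h1 h
  have h4 := Nat.totient_lt n hn
  omega

include hq in
theorem mem_M'_iff {a : ℕ} :
    a ∈ M' m q ↔ (a ∈ M m q ∧ 1 < (J' q a).card) ∨
      ∃ i, ∃ b, 1 ≤ b ∧ b ≤ (q i).totient / 2 ∧ a = m / q i * b := by
  rw [M', Set.mem_union, Set.mem_iUnion]
  refine or_congr (and_congr_right fun ha => ?_) Iff.rfl
  have hne := J'_nonempty hq ha.1.1 ha.1.2.1
  constructor
  · intro h
    by_contra h1
    have h2 : (J' q a).card = 1 := by have := hne.card_pos; omega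
    obtain ⟨j, hj⟩ := Finset.card_eq_one.mp h2
    exact h j ((div_dvd_iff hq j).mpr hj.le)
  · intro h i hi
    have := Finset.card_le_card ((div_dvd_iff hq i).mp hi)
    rw [Finset.card_singleton] at this
    omega

include hq in
theorem div_mul_lt {j : Fin t} {b : ℕ} (hb : b < q j) : m / q j * b < m := by
  have h0 : 0 < m / q j := Nat.div_pos (Nat.le_of_dvd (NeZero.pos m) (q_dvd hq j)) (NeZero.pos _)
  calc m / q j * b < m / q j * q j := Nat.mul_lt_mul_of_pos_left hb h0
    _ = m := q_mul_div hq j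

include hq in
theorem M'_subset (hq2 : ∀ i, 2 < q i) {a : ℕ} (ha : a ∈ M' m q) : 0 < a ∧ a < m := by
  rcases (mem_M'_iff hq).mp ha with h | ⟨i, b, h1, h2, rfl⟩
  · exact ⟨h.1.1.1, h.1.1.2.1⟩
  · have h0 : 0 < m / q i := Nat.div_pos (Nat.le_of_dvd (NeZero.pos m) (q_dvd hq i)) (NeZero.pos _)
    have h4 := Nat.totient_lt (q i) (by have := hq2 i; omega)
    exact ⟨Nat.mul_pos h0 h1, div_mul_lt hq (by omega)⟩

include hq in
theorem M'_finite (hq2 : ∀ i, 2 < q i) : (M' m q).Finite :=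
  (Set.finite_lt_nat m).subset fun _ ha => (M'_subset hq hq2 ha).2

-- Partition by the set J' and sum the bounds: expanding products over subsets gives ∏(1 + (φ(q_i) -
-- 1)) - ∏(1 - 1) = φ(m). Singletons satisfy the same bound although their elements are the mb/q_i
-- instead of members of `M`.
include hq in
theorem two_mul_ncard_M'_le (hm : 1 < m) (hq2 : ∀ i, 2 < q i) :
    2 * (M' m q).ncard ≤ m.totient := by
  classical
  have hq1 : ∀ i, 1 < q i := fun i => (by norm_num : 1 < 2).trans (hq2 i)
  set S := (M'_finite hq hq2).toFinset with hS
  have hmemS : ∀ a, a ∈ S ↔ a ∈ M' m q := fun a => Set.Finite.mem_toFinset _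
  have hcard : (M' m q).ncard = S.card := Set.ncard_eq_toFinset_card _ _
  have hB : ∀ B : Finset (Fin t), 2 * ((S.filter fun a => J' q a = B).card : ℤ) ≤
      ∏ i ∈ B, ((Fintype.card (ZMod (q i))ˣ : ℤ) - 1) - ∏ _i ∈ B, (-1 : ℤ) := by
    intro B
    rcases Nat.lt_trichotomy B.card 1 with hB | hB | hB
    · rw [Nat.lt_one_iff, Finset.card_eq_zero] at hB
      subst hB
      rw [Finset.filter_false_of_mem]
      · simp
      · intro a ha h
        have := M'_subset hq hq2 ((hmemS a).mp ha)
        exact (J'_nonempty hq this.1 this.2).ne_empty h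
    · obtain ⟨j, rfl⟩ := Finset.card_eq_one.mp hB
      have h1 : (S.filter fun a => J' q a = {j}) ⊆
          (Finset.Icc 1 ((q j).totient / 2)).image fun b => m / q j * b := by
        intro a ha
        rw [Finset.mem_filter, hmemS, mem_M'_iff hq] at ha
        obtain ⟨h | ⟨i, b, h1, h2, rfl⟩, h'⟩ := ha
        · rw [h', Finset.card_singleton] at h
          omega
        · rw [J'_div_mul hq (not_dvd_of_le_totient (hq1 i) h1 h2), Finset.singleton_inj] at h'
          subst h'
          exact Finset.mem_image_of_mem _ (Finset.mem_Icc.mpr ⟨h1, h2⟩)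
      have h2 := (Finset.card_le_card h1).trans Finset.card_image_le
      rw [Nat.card_Icc] at h2
      rw [Finset.prod_singleton, Finset.prod_singleton, ZMod.card_units_eq_totient]
      omega
    · refine le_trans ?_ (two_mul_card_inMFinset_le (D := cycDist hq2) B)
      have h1 : ∀ a ∈ S.filter fun a => J' q a = B, ∃ c : Symb fun i => (ZMod (q i))ˣ,
          c ∈ inMFinset (cycDist hq2) B ∧ (symbEval hq c).val = a := by
        intro a ha
        rw [Finset.mem_filter, hmemS, mem_M'_iff hq] at ha
        obtain ⟨h | ⟨i, b, h1, h2, rfl⟩, h'⟩ := ha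
        · obtain ⟨c, rfl⟩ := exists_symbEval_of_mem_X hq hq1 h.1.1
          rw [J'_symbEval hq hq1] at h'
          refine ⟨c, ?_, rfl⟩
          rw [inMFinset, Finset.mem_filter]
          refine ⟨Finset.mem_univ _, h', (symbEval_mem_M_iff hq hq2 ?_).mp h.1⟩
          rw [h', ← Finset.card_pos]; omega
        · rw [J'_div_mul hq (not_dvd_of_le_totient (hq1 i) h1 h2)] at h'
          rw [← h', Finset.card_singleton] at hB
          omega
      choose f hf hf' using h1
      have h2 : (S.filter fun a => J' q a = B).card ≤ (inMFinset (cycDist hq2) B).card := by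
        rw [← Finset.card_attach]
        refine Finset.card_le_card_of_injOn
          (fun a : {a // a ∈ S.filter fun a => J' q a = B} => f a.1 a.2) (fun a _ => hf a.1 a.2) ?_
        intro a _ a' _ h
        apply Subtype.ext
        rw [← hf' a.1 a.2, ← hf' a'.1 a'.2]
        exact congrArg (fun c => (symbEval hq c).val) h
      have : ((S.filter fun a => J' q a = B).card : ℤ) ≤ (inMFinset (cycDist hq2) B).card := by
        exact_mod_cast h2
      linarith
  have hsum : (S.card : ℤ) = ∑ B : Finset (Fin t), ((S.filter fun a => J' q a = B).card : ℤ) := by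
    rw [← Nat.cast_sum]
    congr 1
    exact Finset.card_eq_sum_card_fiberwise fun _ _ => Finset.mem_coe.mpr (Finset.mem_univ _)
  -- The product ∏(1 - 1) vanishes only if there is at least one prime power.
  have ht : Nonempty (Fin t) := by
    by_contra h
    rw [not_nonempty_iff] at h
    have := hq.prod_eq
    rw [Finset.univ_eq_empty, Finset.prod_empty] at this
    omega
  have h1 : ∑ B : Finset (Fin t), (∏ i ∈ B, ((Fintype.card (ZMod (q i))ˣ : ℤ) - 1) -
      ∏ _i ∈ B, (-1 : ℤ)) = m.totient := by
    rw [Finset.sum_sub_distrib, ← Finset.powerset_univ, ← Finset.prod_one_add,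
      ← Finset.prod_one_add, totient_eq_prod hq]
    simp_rw [ZMod.card_units_eq_totient]
    simp [Fin.pos_iff_nonempty.mpr ht |>.ne']
  have h2 := Finset.sum_le_sum fun B (_ : B ∈ Finset.univ) => hB B
  rw [h1, ← Finset.mul_sum, ← hsum] at h2
  rw [hcard]
  exact_mod_cast h2

end CountM

/-! ### Group ring elements as functions on (ℤ/m)ˣ -/

section Coefficients

variable (m : ℕ) [NeZero m]

/-- The automorphism attached to a unit modulo `m`. -/
def gal (u : (ZMod m)ˣ) : GG m := (IsCyclotomicExtension.Rat.galEquivZMod m (cycField m)).symm u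

/-- The coefficients of an element of `ℚ[G_m]`: the value at `u` is the coefficient of `σ_u⁻¹`. -/
def coeffFn : QG m →ₗ[ℚ] ((ZMod m)ˣ → ℚ) where
  toFun x u := x.coeff (gal m u)⁻¹
  map_add' _ _ := rfl
  map_smul' _ _ := rfl

variable {m}

theorem coeffFn_apply (x : QG m) (u : (ZMod m)ˣ) : coeffFn m x u = x.coeff (gal m u)⁻¹ := rfl

theorem gal_surjective : Function.Surjective (gal m) := MulEquiv.surjective _

theorem gal_injective : Function.Injective (gal m) := MulEquiv.injective _

theorem coeffFn_injective : Function.Injective (coeffFn m) := by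
  intro x y h
  refine MonoidAlgebra.ext (Finsupp.ext fun σ => ?_)
  obtain ⟨u, hu⟩ := gal_surjective σ⁻¹
  have := congrFun h u
  rwa [coeffFn_apply, coeffFn_apply, hu, inv_inv] at this

open scoped Classical in
theorem coeffFn_single (v : (ZMod m)ˣ) (a : ℚ) (u : (ZMod m)ˣ) :
    coeffFn m (MonoidAlgebra.single (gal m v)⁻¹ a) u = if v = u then a else 0 := by
  rw [coeffFn_apply, MonoidAlgebra.coeff_single, Finsupp.single_apply]
  simp only [inv_inj, gal_injective.eq_iff]

theorem sigma_eq_gal {s : ℕ} (hs : s.Coprime m) : sigma m s = gal m (ZMod.unitOfCoprime s hs) := by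
  rw [sigma, dif_pos hs, gal]

theorem fract_eq_val_div (a : ℤ) : Int.fract ((a : ℚ) / m) = ((a : ZMod m).val : ℚ) / m := by
  rw [Int.fract_div_intCast_eq_div_intCast_mod, ← ZMod.val_intCast, Int.cast_natCast]

theorem coeffFn_theta (a : ℤ) (u : (ZMod m)ˣ) :
    coeffFn m (theta m a) u = ((-((a : ZMod m) * (u : ZMod m))).val : ℚ) / m := by
  classical
  -- The sum defining θ runs over [1, m], residues over [0, m). For units the ranges differ only
  -- when m = 1, where s = m represents 0.
  set s0 : ℕ := if (u : ZMod m).val = 0 then m else (u : ZMod m).val with hs0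
  have hcast : (s0 : ZMod m) = u := by
    rw [hs0]
    split_ifs with h
    · rw [ZMod.natCast_self, eq_comm, ← ZMod.val_eq_zero, h]
    · exact ZMod.natCast_zmod_val _
  have hcop : s0.Coprime m := by
    rw [← ZMod.isUnit_iff_coprime, hcast]; exact u.isUnit
  have hmem : s0 ∈ (Finset.Icc 1 m).filter (fun s => s.Coprime m) := by
    rw [Finset.mem_filter, Finset.mem_Icc]
    refine ⟨?_, hcop⟩
    rw [hs0]
    split_ifs with h
    · exact ⟨NeZero.pos m, le_rfl⟩
    · exact ⟨Nat.pos_of_ne_zero h, (ZMod.val_lt _).le⟩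
  have huniq : ∀ s ∈ (Finset.Icc 1 m).filter (fun s => s.Coprime m), (s : ZMod m) = u → s = s0 := by
    intro s hs hsu
    rw [Finset.mem_filter, Finset.mem_Icc] at hs
    rcases hs.1.2.lt_or_eq with h | h
    · have h1 : (u : ZMod m).val = s := by rw [← hsu, ZMod.val_cast_of_lt h]
      rw [hs0, h1, if_neg (by omega)]
    · have h1 : (u : ZMod m).val = 0 := by rw [← hsu, h, ZMod.natCast_self, ZMod.val_zero]
      rw [hs0, if_pos h1, h]
  rw [theta, map_sum, Finset.sum_apply, Finset.sum_eq_single_of_mem s0 hmem]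
  · have h1 : -((a : ℚ) * (s0 : ℚ)) / (m : ℚ) = ((-(a * (s0 : ℤ)) : ℤ) : ℚ) / m := by push_cast; ring
    rw [sigma_eq_gal hcop, coeffFn_single, if_pos, h1, fract_eq_val_div]
    · push_cast
      rw [hcast]
    · exact Units.ext ((ZMod.coe_unitOfCoprime _ _).trans hcast)
  · intro s hs hne
    have hs' : s.Coprime m := (Finset.mem_filter.mp hs).2
    rw [sigma_eq_gal hs', coeffFn_single, if_neg]
    rintro h
    exact hne (huniq s hs (by rw [← h, ZMod.coe_unitOfCoprime]))

theorem coeffFn_normElt (u : (ZMod m)ˣ) : coeffFn m (normElt m) u = 1 := by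
  classical
  rw [coeffFn_apply, normElt, MonoidAlgebra.coeff_sum, Finsupp.finsetSum_apply]
  simp [MonoidAlgebra.coeff_single, Finsupp.single_apply]

theorem val_div_eq_saw {x : ZMod m} (hx : x ≠ 0) : (x.val : ℚ) / m = saw x + 1 / 2 := by
  have h1 := ZMod.neg_val x
  rw [if_neg hx] at h1
  have h2 := ZMod.val_lt x
  have hm : (m : ℚ) ≠ 0 := Nat.cast_ne_zero.mpr (NeZero.ne m)
  rw [saw, h1, Nat.cast_sub h2.le]
  field_simp
  ring

/-- For a nonzero residue the fractional part is the sawtooth plus ½. At 0 both fractional part and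
sawtooth vanish, so the class a = 0 has to be kept apart. -/
theorem coeffFn_theta_of_ne_zero {a : ℤ} (ha : (a : ZMod m) ≠ 0) :
    coeffFn m (theta m a) = psi (a : ZMod m) + (1 / 2 : ℚ) • (fun _ => 1) := by
  funext u
  rw [coeffFn_theta, val_div_eq_saw]
  · simp [psi]
  · rw [neg_ne_zero]
    intro h
    exact ha (u.isUnit.mul_left_eq_zero.mp h)

theorem coeffFn_theta_of_eq_zero {a : ℤ} (ha : (a : ZMod m) = 0) : coeffFn m (theta m a) = 0 := by
  funext u
  rw [coeffFn_theta, ha]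
  simp

theorem galRes_gal {d : ℕ} [NeZero d] (h : d ∣ m) (u : (ZMod m)ˣ) :
    galRes h (gal m u) = gal d (ZMod.unitsMap h u) := by
  have key : ∀ σ : GG m, IsCyclotomicExtension.Rat.galEquivZMod d (cycField d) (galRes h σ) =
      ZMod.unitsMap h (IsCyclotomicExtension.Rat.galEquivZMod m (cycField m) σ) := by
    intro σ
    let _ : Algebra (cycField d) (cycField m) := (ratIncl (cycField_le h)).toRingHom.toAlgebra
    have _ : IsScalarTower ℚ (cycField d) (cycField m) :=
      IsScalarTower.of_algebraMap_eq fun x => ((ratIncl (cycField_le h)).commutes x).symm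
    exact IsCyclotomicExtension.Rat.galEquivZMod_restrictNormal_apply m (cycField m) (cycField d) h σ
  have := key (gal m u)
  rw [gal, MulEquiv.apply_symm_apply] at this
  rw [gal, gal, ← this, MulEquiv.symm_apply_apply]

theorem coeffFn_cor {d : ℕ} [NeZero d] (h : d ∣ m) (x : QG d) (u : (ZMod m)ˣ) :
    coeffFn m (cor h x) u = coeffFn d x (ZMod.unitsMap h u) := by
  classical
  rw [coeffFn_apply, coeffFn_apply, ← galRes_gal h, ← map_inv, cor, MonoidAlgebra.coeff_sum,
    Finsupp.finsetSum_apply, Finset.sum_eq_single (galRes h (gal m u)⁻¹)]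
  · rw [MonoidAlgebra.coeff_smul, Finsupp.smul_apply, MonoidAlgebra.coeff_sum,
      Finsupp.finsetSum_apply, Finset.sum_eq_single (gal m u)⁻¹]
    · simp [MonoidAlgebra.coeff_single]
    · intro σ _ hσ
      rw [MonoidAlgebra.coeff_single, Finsupp.single_apply, if_neg hσ]
    · intro hn
      exact (hn (by simp)).elim
  · intro τ _ hτ
    rw [MonoidAlgebra.coeff_smul, Finsupp.smul_apply, MonoidAlgebra.coeff_sum,
      Finsupp.finsetSum_apply, Finset.sum_eq_zero, smul_zero]
    intro σ hσ
    rw [MonoidAlgebra.coeff_single, Finsupp.single_apply, if_neg]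
    rintro rfl
    exact hτ (Finset.mem_filter.mp hσ).2.symm
  · simp

open scoped Classical in
theorem coeffFn_res {d : ℕ} [NeZero d] (h : d ∣ m) (x : QG m) (v : (ZMod d)ˣ) :
    coeffFn d (res h x) v = ∑ w : (ZMod m)ˣ with ZMod.unitsMap h w = v, coeffFn m x w := by
  induction x using MonoidAlgebra.induction_linear with
  | zero => simp
  | add x y hx hy => simp only [map_add, Pi.add_apply, hx, hy, Finset.sum_add_distrib]
  | single σ a =>
    obtain ⟨w, hw⟩ := gal_surjective σ⁻¹
    have hσ : σ = (gal m w)⁻¹ := by rw [hw, inv_inv]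
    have hres : res h (MonoidAlgebra.single (gal m w)⁻¹ a) =
        MonoidAlgebra.single (gal d (ZMod.unitsMap h w))⁻¹ a := by
      rw [res, MonoidAlgebra.mapDomainRingHom_apply, MonoidAlgebra.mapDomain_single, map_inv,
        galRes_gal]
    rw [hσ, hres, coeffFn_single]
    simp_rw [coeffFn_single]
    rw [Finset.sum_ite_eq]
    simp

open scoped Classical in
theorem coeffFn_thetaLift (n : ℕ) [NeZero n] (a : ℤ) (u : (ZMod m)ˣ) :
    coeffFn m (thetaLift m n a) u = ∑ w : (ZMod n)ˣ with
      ZMod.unitsMap (Nat.gcd_dvd_right m n) w = ZMod.unitsMap (Nat.gcd_dvd_left m n) u,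
        coeffFn n (theta n a) w := by
  rw [thetaLift, coeffFn_cor, coeffFn_res]

end Coefficients

/-! ### Fibre sums of ψ between levels -/

section Norm

open scoped Classical in
/-- Summation over the fibres of `(ℤ/n)ˣ → (ℤ/d)ˣ`. -/
def fiberSum {d n : ℕ} [NeZero n] (h : d ∣ n) :
    ((ZMod n)ˣ → ℚ) →ₗ[ℤ] ((ZMod d)ˣ → ℚ) where
  toFun f v := ∑ w : (ZMod n)ˣ with ZMod.unitsMap h w = v, f w
  map_add' f g := by funext v; simp [Finset.sum_add_distrib]
  map_smul' r f := by funext v; simp [Finset.mul_sum]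

open scoped Classical in
theorem fiberSum_apply {d n : ℕ} [NeZero n] (h : d ∣ n) (f : (ZMod n)ˣ → ℚ) (v : (ZMod d)ˣ) :
    fiberSum h f v = ∑ w : (ZMod n)ˣ with ZMod.unitsMap h w = v, f w := rfl

theorem fiberSum_fiberSum {d e n : ℕ} [NeZero n] [NeZero e] (h : d ∣ e) (h' : e ∣ n)
    (f : (ZMod n)ˣ → ℚ) : fiberSum h (fiberSum h' f) = fiberSum (h.trans h') f := by
  classical
  funext v
  simp only [fiberSum_apply]
  rw [← Finset.sum_fiberwise_of_maps_to (s := Finset.univ.filter fun w : (ZMod n)ˣ =>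
    ZMod.unitsMap (h.trans h') w = v) (t := Finset.univ.filter fun w : (ZMod e)ˣ =>
    ZMod.unitsMap h w = v) (g := ZMod.unitsMap h')]
  · refine Finset.sum_congr rfl fun x hx => Finset.sum_congr ?_ fun _ _ => rfl
    ext w
    simp only [Finset.mem_filter, Finset.mem_univ, true_and] at hx ⊢
    refine ⟨fun hw => ⟨?_, hw⟩, fun hw => hw.2⟩
    rw [← hx, ← hw, ← MonoidHom.comp_apply, ZMod.unitsMap_comp]
  · intro w hw
    simp only [Finset.mem_filter, Finset.mem_univ, true_and] at hw ⊢
    rw [← hw, ← MonoidHom.comp_apply, ZMod.unitsMap_comp]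

open scoped Classical in
theorem fiberSum_eq_sum {d n : ℕ} [NeZero n] (h : d ∣ n) (F : ZMod n → ℚ) (v : (ZMod d)ˣ) :
    fiberSum h (fun w => F w) v =
      ∑ x : ZMod n with ZMod.castHom h (ZMod d) x = v ∧ IsUnit x, F x := by
  rw [fiberSum_apply]
  refine Finset.sum_bij (fun w _ => (w : ZMod n)) ?_ ?_ ?_ (fun _ _ => rfl)
  · intro w hw
    simp only [Finset.mem_filter, Finset.mem_univ, true_and] at hw ⊢
    exact ⟨by rw [← hw]; rfl, w.isUnit⟩
  · intro w _ w' _ hww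
    exact Units.ext hww
  · intro x hx
    simp only [Finset.mem_filter, Finset.mem_univ, true_and] at hx
    refine ⟨hx.2.unit, ?_, rfl⟩
    simp only [Finset.mem_filter, Finset.mem_univ, true_and]
    exact Units.ext hx.1

section OnePrime

variable {p e n : ℕ} [NeZero n] [NeZero e] (hp : p.Prime) (hn : n = p * e)

include hn in
theorem castHom_eq_natCast (h : e ∣ n) (x : ZMod n) : ZMod.castHom h (ZMod e) x = (x.val : ZMod e) := by
  rw [← map_natCast (ZMod.castHom h (ZMod e)), ZMod.natCast_zmod_val]

include hp hn in
theorem castHom_eq_iff (h : e ∣ n) (x : ZMod n) (k : ℕ) :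
    ZMod.castHom h (ZMod e) x = k ↔ (p : ZMod n) * x = p * (k : ZMod n) := by
  rw [castHom_eq_natCast hn, ZMod.natCast_eq_natCast_iff, natCast_mul_eq_iff hp.ne_zero hn,
    ZMod.val_natCast]
  have : k % n ≡ k [MOD e] := (Nat.mod_modEq k n).of_dvd h
  exact ⟨fun h => h.trans this.symm, fun h => h.trans this⟩

include hp hn in
open scoped Classical in
/-- The sum of the sawtooth function over a full fibre of `ℤ/pe → ℤ/e`. -/
theorem exists_sum_fiber_saw (a : ℕ) : ∃ (c b : ℕ), ∀ k : ℕ,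
    ∑ x : ZMod n with (p : ZMod n) * x = p * (k : ZMod n), saw ((a : ZMod n) * x) =
      c * saw ((b : ZMod e) * (k : ZMod e)) := by
  have hlevel : ∀ k : ℕ, saw ((p : ZMod n) * (k : ZMod n)) = saw (k : ZMod e) := by
    intro k
    have := saw_mul hn k
    simpa using this
  -- If p ∣ a, then ax is constant on the fibre and one value occurs p times. Otherwise a is
  -- invertible modulo p, multiplication by a carries the fibre bijectively to another one, and the
  -- distribution relation applies.
  by_cases hpa : p ∣ a
  · obtain ⟨b, rfl⟩ := hpa
    refine ⟨p, b, fun k => ?_⟩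
    have h1 : ∀ x ∈ Finset.univ.filter fun x : ZMod n => (p : ZMod n) * x = p * (k : ZMod n),
        saw (((p * b : ℕ) : ZMod n) * x) = saw ((b : ZMod e) * (k : ZMod e)) := by
      intro x hx
      have hx' := (Finset.mem_filter.mp hx).2
      have : ((p * b : ℕ) : ZMod n) * x = (p : ZMod n) * ((b * k : ℕ) : ZMod n) := by
        push_cast
        linear_combination (b : ZMod n) * hx'
      rw [this, hlevel]
      push_cast
      rfl
    rw [Finset.sum_congr rfl h1, sum_fiber_eq_sum_range ⟨e, hn⟩]
    simp
  · have hcop : a.Coprime p := (hp.coprime_iff_not_dvd.mpr hpa).symm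
    obtain ⟨b, -, hb⟩ := Nat.exists_mul_mod_eq_one_of_coprime hcop hp.one_lt
    have hb' : ((a * b : ℕ) : ZMod n) = p * ((a * b / p : ℕ) : ZMod n) + 1 := by
      have := Nat.div_add_mod (a * b) p
      rw [hb] at this
      calc ((a * b : ℕ) : ZMod n) = ((p * (a * b / p) + 1 : ℕ) : ZMod n) := by rw [this]
        _ = _ := by rw [Nat.cast_add, Nat.cast_mul, Nat.cast_one]
    rw [Nat.cast_mul] at hb'
    refine ⟨1, a, fun k => ?_⟩
    have h1 : ∑ x : ZMod n with (p : ZMod n) * x = p * (k : ZMod n), saw ((a : ZMod n) * x) =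
        ∑ x : ZMod n with (p : ZMod n) * x = p * ((a * k : ℕ) : ZMod n), saw x := by
      refine Finset.sum_nbij' (fun x => (a : ZMod n) * x)
        (fun z => (k : ZMod n) + b * (z - a * k)) ?_ ?_ ?_ ?_ (fun _ _ => rfl)
      · intro x hx
        simp only [Finset.mem_filter, Finset.mem_univ, true_and] at hx ⊢
        push_cast
        linear_combination (a : ZMod n) * hx
      · intro z hz
        simp only [Finset.mem_filter, Finset.mem_univ, true_and] at hz ⊢
        push_cast at hz
        linear_combination (b : ZMod n) * hz
      · intro x hx
        simp only [Finset.mem_filter, Finset.mem_univ, true_and] at hx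
        linear_combination (x - k) * hb' + ((a * b / p : ℕ) : ZMod n) * hx
      · intro z hz
        simp only [Finset.mem_filter, Finset.mem_univ, true_and] at hz
        push_cast at hz
        linear_combination (z - a * k) * hb' + ((a * b / p : ℕ) : ZMod n) * hz
    rw [h1, sum_fiber_saw ⟨e, hn⟩, hlevel]
    push_cast
    ring

-- The full fibre sum is an integer multiple of some ψ(b) at level e. If p ∣ e, every lift of a unit
-- is a unit; otherwise exactly one lift is divisible by p, and the term to be removed is a ψ
-- twisted by p⁻¹.
include hp hn in
theorem fiberSum_psi_mem_of_prime (h : e ∣ n) (a : ZMod n) :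
    fiberSum h (psi a) ∈ Submodule.span ℤ (Set.range (psi : ZMod e → (ZMod e)ˣ → ℚ)) := by
  classical
  obtain ⟨c, b, hcb⟩ := exists_sum_fiber_saw hp hn a.val
  rw [ZMod.natCast_zmod_val] at hcb
  have hfull : ∀ v : (ZMod e)ˣ,
      ∑ x : ZMod n with ZMod.castHom h (ZMod e) x = v, saw (-(a * x)) =
        c * psi (b : ZMod e) v := by
    intro v
    have h1 := hcb (v : ZMod e).val
    rw [ZMod.natCast_zmod_val] at h1
    rw [psi_apply, mul_neg, ← h1, ← Finset.sum_neg_distrib]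
    refine Finset.sum_congr (Finset.filter_congr fun x _ => ?_) fun x _ => saw_neg _
    rw [← castHom_eq_iff hp hn h, ZMod.natCast_zmod_val]
  have hpsi : ∀ v : (ZMod e)ˣ, fiberSum h (psi a) v =
      ∑ x : ZMod n with ZMod.castHom h (ZMod e) x = v ∧ IsUnit x, saw (-(a * x)) := fun v =>
    fiberSum_eq_sum h (fun x => saw (-(a * x))) v
  have hcopval : ∀ (v : (ZMod e)ˣ) (x : ZMod n), ZMod.castHom h (ZMod e) x = v →
      (x.val).Coprime e := by
    intro v x hx
    rw [← ZMod.isUnit_iff_coprime, ← castHom_eq_natCast hn h, hx]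
    exact v.isUnit
  have hunit : ∀ (v : (ZMod e)ˣ) (x : ZMod n), ZMod.castHom h (ZMod e) x = v →
      (IsUnit x ↔ ¬ p ∣ x.val) := by
    intro v x hx
    have h1 : IsUnit x ↔ (x.val).Coprime n := by
      rw [← ZMod.isUnit_iff_coprime, ZMod.natCast_zmod_val]
    have h2 : (x.val).Coprime n ↔ (x.val).Coprime (p * e) := by simp only [hn]
    rw [h1, h2, Nat.coprime_mul_iff_right, and_iff_left (hcopval v x hx), Nat.coprime_comm,
      hp.coprime_iff_not_dvd]
  have hspan : ∀ z : ZMod e, psi z ∈ Submodule.span ℤ (Set.range (psi : ZMod e → (ZMod e)ˣ → ℚ)) :=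
    fun z => Submodule.subset_span ⟨z, rfl⟩
  by_cases hpe : p ∣ e
  · have : fiberSum h (psi a) = (c : ℤ) • psi (b : ZMod e) := by
      funext v
      rw [hpsi, Pi.smul_apply, zsmul_eq_mul, Int.cast_natCast, ← hfull]
      refine Finset.sum_congr (Finset.filter_congr fun x _ => ?_) fun _ _ => rfl
      rw [and_iff_left_iff_imp]
      intro hx
      rw [hunit v x hx]
      intro hpx
      have := Nat.dvd_gcd hpx hpe
      rw [hcopval v x hx] at this
      exact hp.one_lt.ne' (Nat.dvd_one.mp this)
    rw [this]
    exact Submodule.smul_mem _ _ (hspan _)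
  · have hpe' : p.Coprime e := hp.coprime_iff_not_dvd.mpr hpe
    set p' : (ZMod e)ˣ := ZMod.unitOfCoprime p hpe' with hp'
    have hp'v : (p' : ZMod e) = p := ZMod.coe_unitOfCoprime _ _
    have : fiberSum h (psi a) = (c : ℤ) • psi (b : ZMod e) -
        psi ((a.val : ZMod e) * ((p'⁻¹ : (ZMod e)ˣ) : ZMod e)) := by
      funext v
      rw [hpsi, Pi.sub_apply, Pi.smul_apply, zsmul_eq_mul, Int.cast_natCast, ← hfull,
        eq_sub_iff_add_eq, ← Finset.sum_filter_add_sum_filter_not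
          (Finset.univ.filter fun x : ZMod n => ZMod.castHom h (ZMod e) x = v) (fun x => IsUnit x),
        Finset.filter_filter, Finset.filter_filter]
      congr 1
      -- With k = p⁻¹v, the class pk is the only lift of v divisible by p, because p and e are
      -- coprime.
      set k := (((p'⁻¹ : (ZMod e)ˣ) : ZMod e) * v).val with hk
      have hkv : (k : ZMod e) = ((p'⁻¹ : (ZMod e)ˣ) : ZMod e) * v := ZMod.natCast_zmod_val _
      have hx0 : ZMod.castHom h (ZMod e) ((p * k : ℕ) : ZMod n) = v := by
        rw [map_natCast, Nat.cast_mul, hkv, ← mul_assoc, ← hp'v, Units.mul_inv, one_mul]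
      have hpval : ∀ l : ℕ, p ∣ ((p * l : ℕ) : ZMod n).val := by
        intro l
        rw [ZMod.val_natCast]
        exact (Nat.dvd_mod_iff ⟨e, hn⟩).mpr (dvd_mul_right _ _)
      rw [Finset.sum_eq_single_of_mem ((p * k : ℕ) : ZMod n)]
      · have h1 := saw_mul hn (-(a.val * k : ℤ))
        have e1 : (((p : ℤ) * (-(a.val * k : ℤ)) : ℤ) : ZMod n) = -(a * ((p * k : ℕ) : ZMod n)) := by
          push_cast
          rw [ZMod.natCast_zmod_val]
          ring
        have e2 : ((-(a.val * k : ℤ) : ℤ) : ZMod e) =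
            -((a.val : ZMod e) * ((p'⁻¹ : (ZMod e)ˣ) : ZMod e) * (v : ZMod e)) := by
          push_cast
          rw [hkv]
          ring
        rw [e1, e2] at h1
        exact h1.symm
      · simp only [Finset.mem_filter, Finset.mem_univ, true_and]
        exact ⟨hx0, by rw [hunit v _ hx0, not_not]; exact hpval k⟩
      · intro x hx hne
        simp only [Finset.mem_filter, Finset.mem_univ, true_and] at hx
        rw [hunit v x hx.1, not_not] at hx
        refine absurd ?_ hne
        apply ZMod.val_injective n
        have h1 : x.val ≡ ((p * k : ℕ) : ZMod n).val [MOD e] := by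
          rw [← ZMod.natCast_eq_natCast_iff, ← castHom_eq_natCast hn h, ← castHom_eq_natCast hn h,
            hx.1, hx0]
        have h2 : x.val ≡ ((p * k : ℕ) : ZMod n).val [MOD p] :=
          (Nat.modEq_zero_iff_dvd.mpr hx.2).trans (Nat.modEq_zero_iff_dvd.mpr (hpval k)).symm
        have h3 := (Nat.modEq_and_modEq_iff_modEq_mul hpe').mp ⟨h2, h1⟩
        rw [← hn] at h3
        exact Nat.ModEq.eq_of_lt_of_lt h3 (ZMod.val_lt _) (ZMod.val_lt _)
    rw [this]
    exact Submodule.sub_mem _ (Submodule.smul_mem _ _ (hspan _)) (hspan _)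

end OnePrime

/-- Fibre sums compose, so the primes of n/d can be removed one at a time. -/
theorem fiberSum_psi_mem {d n : ℕ} [NeZero d] [NeZero n] (h : d ∣ n) (a : ZMod n) :
    fiberSum h (psi a) ∈ Submodule.span ℤ (Set.range (psi : ZMod d → (ZMod d)ˣ → ℚ)) := by
  classical
  suffices H : ∀ (k n : ℕ) [NeZero n] (h : d ∣ n) (a : ZMod n), n = k → fiberSum h (psi a) ∈
      Submodule.span ℤ (Set.range (psi : ZMod d → (ZMod d)ˣ → ℚ)) from H n n h a rfl
  clear h a
  intro k
  induction k using Nat.strong_induction_on with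
  | _ k ih =>
  rintro n _ h a rfl
  by_cases hdn : d = n
  · subst hdn
    have : fiberSum h (psi a) = psi a := by
      funext v
      rw [fiberSum_apply, ZMod.unitsMap_self]
      simp [Finset.filter_eq']
    rw [this]
    exact Submodule.subset_span ⟨a, rfl⟩
  · obtain ⟨c, hc⟩ := h
    have hc1 : c ≠ 1 := by rintro rfl; exact hdn (by rw [hc, mul_one])
    obtain ⟨p, hp, c', rfl⟩ := Nat.exists_prime_and_dvd hc1
    have hn : n = p * (d * c') := by rw [hc]; ring
    have : NeZero (d * c') := ⟨fun h0 => NeZero.ne n (by rw [hn, h0, mul_zero])⟩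
    have h1 : d * c' ∣ n := ⟨p, by rw [hn]; ring⟩
    have h2 := fiberSum_psi_mem_of_prime hp hn h1 a
    have hlt : d * c' < n := by
      rw [hn]
      have := hp.one_lt
      have := NeZero.pos (d * c')
      nlinarith
    rw [← fiberSum_fiberSum (dvd_mul_right d c') h1]
    have h3 : Submodule.span ℤ (Set.range (psi : ZMod (d * c') → (ZMod (d * c'))ˣ → ℚ)) ≤
        (Submodule.span ℤ (Set.range (psi : ZMod d → (ZMod d)ˣ → ℚ))).comap
          (fiberSum (dvd_mul_right d c')) := by
      rw [Submodule.span_le]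
      rintro _ ⟨z, rfl⟩
      exact ih (d * c') hlt (d * c') (dvd_mul_right d c') z rfl
    exact h3 h2

end Norm

/-! ### The coefficient lattice of S'_m -/

section SPrimeSpan

variable {m : ℕ} [NeZero m]

variable (m) in
/-- The coefficient lattice of `S'_m`. -/
def coeffLattice : Submodule ℤ ((ZMod m)ˣ → ℚ) :=
  Submodule.span ℤ (insert ((1 / 2 : ℚ) • fun _ => (1 : ℚ)) (Set.range psi))

theorem psi_mem_coeffLattice (a : ZMod m) : psi a ∈ coeffLattice m :=
  Submodule.subset_span (Set.mem_insert_of_mem _ ⟨a, rfl⟩)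

theorem half_mem_coeffLattice : ((1 / 2 : ℚ) • fun _ => (1 : ℚ)) ∈ coeffLattice m :=
  Submodule.subset_span (Set.mem_insert _ _)

theorem psi_unitsMap {d : ℕ} [NeZero d] (h : d ∣ m) (z : ZMod d) (u : (ZMod m)ˣ) :
    psi z (ZMod.unitsMap h u) = psi ((m / d * z.val : ℕ) : ZMod m) u := by
  have hm : m = m / d * d := (Nat.div_mul_cancel h).symm
  have h1 := saw_mul hm (z.val * (u : ZMod m).val : ℤ)
  have e1 : (((m / d : ℕ) : ℤ) * (z.val * (u : ZMod m).val : ℤ) : ℤ) =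
      ((m / d * z.val : ℕ) : ZMod m) * (u : ZMod m) := by
    simp only [Int.cast_mul, Int.cast_natCast, Nat.cast_mul, ZMod.natCast_zmod_val]
    ring
  have e2 : ((z.val * (u : ZMod m).val : ℤ) : ZMod d) = z * (ZMod.unitsMap h u : (ZMod d)ˣ) := by
    simp only [Int.cast_mul, Int.cast_natCast, ZMod.natCast_zmod_val]
    congr 1
    rw [ZMod.natCast_val, ZMod.unitsMap_val]
  rw [e1, e2] at h1
  rw [psi_apply, psi_apply, h1]

/-- The odd part is a fibre sum of ψ pulled back to level m, hence a combination of ψ's. The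
constant part is ½ times the fibre size, which is the same for all fibres. -/
theorem coeffFn_thetaLift_mem (n : ℕ) [NeZero n] (a : ℤ) :
    coeffFn m (thetaLift m n a) ∈ coeffLattice m := by
  classical
  by_cases ha : (a : ZMod n) = 0
  · have : coeffFn m (thetaLift m n a) = 0 := by
      funext u
      rw [coeffFn_thetaLift, coeffFn_theta_of_eq_zero ha]
      simp
    rw [this]
    exact Submodule.zero_mem _
  · set hd := Nat.gcd_dvd_left m n
    set hd' := Nat.gcd_dvd_right m n
    let pull : ((ZMod (m.gcd n))ˣ → ℚ) →ₗ[ℤ] ((ZMod m)ˣ → ℚ) :=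
      { toFun := fun f u => f (ZMod.unitsMap hd u)
        map_add' := fun _ _ => rfl
        map_smul' := fun _ _ => rfl }
    have h1 : Submodule.span ℤ (Set.range (psi : ZMod (m.gcd n) → _)) ≤
        (coeffLattice m).comap pull := by
      rw [Submodule.span_le]
      rintro _ ⟨z, rfl⟩
      have : pull (psi z) = psi ((m / m.gcd n * z.val : ℕ) : ZMod m) :=
        funext fun u => psi_unitsMap hd z u
      rw [SetLike.mem_coe, Submodule.mem_comap, this]
      exact psi_mem_coeffLattice _
    have h2 : coeffFn m (thetaLift m n a) = pull (fiberSum hd' (psi (a : ZMod n))) +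
        ((Finset.univ.filter fun w : (ZMod n)ˣ => ZMod.unitsMap hd' w = 1).card : ℤ) •
          ((1 / 2 : ℚ) • fun _ => (1 : ℚ)) := by
      funext u
      have hcard : (Finset.univ.filter fun w : (ZMod n)ˣ =>
          ZMod.unitsMap hd' w = ZMod.unitsMap hd u).card =
          (Finset.univ.filter fun w : (ZMod n)ˣ => ZMod.unitsMap hd' w = 1).card := by
        apply MonoidHom.card_fiber_eq_of_mem_range
        · exact ZMod.unitsMap_surjective hd' _
        · exact ⟨1, map_one _⟩
      rw [coeffFn_thetaLift, coeffFn_theta_of_ne_zero ha, ← hcard]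
      change _ = fiberSum hd' (psi (a : ZMod n)) (ZMod.unitsMap hd u) + _
      rw [fiberSum_apply]
      simp [Finset.sum_add_distrib]
    rw [h2]
    exact Submodule.add_mem _ (h1 (fiberSum_psi_mem hd' _))
      (Submodule.smul_mem _ _ half_mem_coeffLattice)

theorem coeffFn_mem_of_mem_SPrime {x : QG m} (hx : x ∈ SPrime m) :
    coeffFn m x ∈ coeffLattice m := by
  induction hx using AddSubgroup.closure_induction with
  | mem x hx =>
    obtain ⟨n, _, a, rfl⟩ := hx
    exact coeffFn_thetaLift_mem n a
  | zero => rw [map_zero]; exact Submodule.zero_mem _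
  | add x y _ _ hx hy => rw [map_add]; exact Submodule.add_mem _ hx hy
  | neg x _ hx => rw [map_neg]; exact Submodule.neg_mem _ hx

theorem theta_mem_SPrime (a : ℤ) : theta m a ∈ SPrime m := by
  classical
  refine AddSubgroup.subset_closure ⟨m, inferInstance, a, coeffFn_injective (funext fun u => ?_)⟩
  rw [coeffFn_thetaLift]
  have hinj : ∀ (d : ℕ) (h : d ∣ m), d = m → Function.Injective (ZMod.unitsMap h) := by
    rintro d h rfl
    rw [ZMod.unitsMap_self]
    exact fun _ _ h => h
  rw [Finset.sum_eq_single u]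
  · intro w hw hwu
    exact absurd (hinj _ _ (Nat.gcd_self m) (Finset.mem_filter.mp hw).2) hwu
  · intro h
    exact (h (by simp)).elim

theorem half_normElt_mem_SPrime : (1 / 2 : ℚ) • normElt m ∈ SPrime m := by
  classical
  -- For n = 2 and a = 1 the only coefficient of θ is ½ and the group at level (m, 2) is trivial, so
  -- corestriction spreads ½ over all of G_m.
  refine AddSubgroup.subset_closure ⟨2, inferInstance, 1, coeffFn_injective (funext fun u => ?_)⟩
  have hsub : Subsingleton (ZMod (m.gcd 2))ˣ := by
    rw [← Fintype.card_le_one_iff_subsingleton, ZMod.card_units_eq_totient]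
    exact Nat.le_of_dvd one_pos (by simpa using Nat.totient_dvd_of_dvd (Nat.gcd_dvd_right m 2))
  rw [coeffFn_thetaLift, map_smul, Pi.smul_apply, coeffFn_normElt,
    Finset.filter_true_of_mem fun w _ => Subsingleton.elim _ _]
  have huniq : (Finset.univ : Finset (ZMod 2)ˣ) = {1} := by decide
  rw [huniq, Finset.sum_singleton, coeffFn_theta]
  have : (-(((1 : ℤ) : ZMod 2) * ((1 : (ZMod 2)ˣ) : ZMod 2))).val = 1 := by decide
  rw [this]
  norm_num

theorem normElt_mem_SPrime : normElt m ∈ SPrime m := by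
  have := (SPrime m).add_mem half_normElt_mem_SPrime (half_normElt_mem_SPrime (m := m))
  rwa [← add_smul, add_halves, one_smul] at this

end SPrimeSpan

/-! ### The elements α: shortness, triangularity, and the basis criterion -/

section Alpha

variable {m : ℕ} [NeZero m]

/-- Three residues in [0, m) with sum divisible by m and the first nonzero have sum m or 2m.
Dividing by m and subtracting 1 leaves 0 or 1. -/
theorem isShort_of_add_eq_zero {a b c : ℤ} (h : ((a + b + c : ℤ) : ZMod m) = 0)
    (ha : (a : ZMod m) ≠ 0) :
    IsShort (theta m a + theta m b + theta m c - normElt m) := by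
  intro σ
  obtain ⟨u, hu⟩ := gal_surjective σ⁻¹
  have hσ : ∀ x : QG m, x.coeff σ = coeffFn m x u := fun x => by rw [coeffFn_apply, hu, inv_inv]
  have hm : (m : ℚ) ≠ 0 := Nat.cast_ne_zero.mpr (NeZero.ne m)
  rw [hσ, map_sub, map_add, map_add, Pi.sub_apply, Pi.add_apply, Pi.add_apply, coeffFn_theta,
    coeffFn_theta, coeffFn_theta, coeffFn_normElt]
  set x := (-((a : ZMod m) * (u : ZMod m))) with hx
  set y := (-((b : ZMod m) * (u : ZMod m))) with hy
  set z := (-((c : ZMod m) * (u : ZMod m))) with hz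
  have hx0 : x.val ≠ 0 := by
    rw [ne_eq, ZMod.val_eq_zero, hx, neg_eq_zero]
    exact fun h' => ha (u.isUnit.mul_left_eq_zero.mp h')
  have hdvd : m ∣ x.val + y.val + z.val := by
    rw [← ZMod.natCast_eq_zero_iff]
    push_cast
    rw [ZMod.natCast_zmod_val, ZMod.natCast_zmod_val, ZMod.natCast_zmod_val]
    push_cast at h
    rw [hx, hy, hz]
    linear_combination (-(u : ZMod m)) * h
  obtain ⟨k, hk⟩ := hdvd
  have h1 := ZMod.val_lt x
  have h2 := ZMod.val_lt y
  have h3 := ZMod.val_lt z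
  have hk0 : k ≠ 0 := by rintro rfl; omega
  have hk3 : k < 3 := by
    by_contra! h'
    have := Nat.mul_le_mul_left m h'
    omega
  have hq : (x.val : ℚ) / m + y.val / m + z.val / m - 1 = k - 1 := by
    have : (x.val : ℚ) + y.val + z.val = m * k := by exact_mod_cast hk
    rw [← add_div, ← add_div, this, mul_div_cancel_left₀ _ hm]
  rw [hq]
  have : k = 1 ∨ k = 2 := by omega
  rcases this with rfl | rfl
  · left; norm_num
  · right; norm_num

variable {t : ℕ} {q : Fin t → ℕ} (hq : IsPrimePowerFactorization m q)
  [∀ i, NeZero (q i)]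

/-- From ux + vy = -1, the number ux is 0 modulo q_j and -1 modulo the other q_i with i ∈ J'_b, and
vy the reverse. Each auxiliary argument is thus 0 or -b in every coordinate and gains a zero inside
J'_b, because |J'_b| > 1. -/
theorem alpha_of_one_lt_card {b : ℕ} (hb : 1 < (J' q b).card) :
    ∃ z w : ℤ, alpha m q b = theta m b + theta m z + theta m w - normElt m ∧
      ((b + z + w : ℤ) : ZMod m) = 0 ∧
      ((∀ i, crt hq z i = 0 ∨ crt hq z i = -(b : ZMod (q i))) ∧ ∃ i ∈ J' q b, crt hq z i = 0) ∧
      ((∀ i, crt hq w i = 0 ∨ crt hq w i = -(b : ZMod (q i))) ∧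
        ∃ i ∈ J' q b, crt hq w i = 0) := by
  have h : (J' q b).Nonempty := by rw [← Finset.card_pos]; omega
  set j := (J' q b).min' h with hj
  have hjmem : j ∈ J' q b := Finset.min'_mem _ h
  have hcompl : (J' q b)ᶜ = J q b := by
    ext i; simp [J, J']
  set v := ∏ i ∈ (J' q b).erase j, q i with hv
  have hprod : q j * r q b * v = m := by
    rw [mul_right_comm, hv, Finset.mul_prod_erase _ _ hjmem, r, ← hcompl, Finset.prod_mul_prod_compl,
      hq.prod_eq]
  have hpos : 0 < q j * r q b := Nat.pos_of_ne_zero fun h0 => NeZero.ne m (by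
    rw [← hprod, h0, zero_mul])
  have hv' : v = m / (q j * r q b) := (Nat.div_eq_of_eq_mul_right hpos hprod.symm).symm
  have hcop : (q j).Coprime v :=
    Nat.Coprime.prod_right fun i hi => hq.coprime j i (Finset.ne_of_mem_erase hi).symm
  obtain ⟨x, y, hxy⟩ : ∃ x y : ℤ, (q j : ℤ) * x + v * y = -1 := by
    obtain ⟨x, y, hxy⟩ := Nat.isCoprime_iff_coprime.mpr hcop
    exact ⟨-x, -y, by linarith⟩
  have hvi : ∀ i ∈ J' q b, i ≠ j → (v : ZMod (q i)) = 0 := by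
    intro i hi hij
    rw [ZMod.natCast_eq_zero_iff]
    exact Finset.dvd_prod_of_mem q (Finset.mem_erase.mpr ⟨hij, hi⟩)
  have hbi : ∀ i, i ∉ J' q b → (b : ZMod (q i)) = 0 := by
    intro i hi
    rw [ZMod.natCast_eq_zero_iff]
    by_contra h'
    exact hi (Finset.mem_filter.mpr ⟨Finset.mem_univ i, h'⟩)
  have hxyi : ∀ i, (q j : ZMod (q i)) * x + v * y = -1 := fun i => by
    have := congrArg (fun n : ℤ => (n : ZMod (q i))) hxy
    push_cast at this
    exact this
  have hqj : (q j : ZMod (q j)) = 0 := ZMod.natCast_self _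
  have hcz : ∀ i, crt hq ((b * q j * x : ℤ) : ZMod m) i = b * q j * x := by
    intro i; rw [map_intCast, Pi.intCast_apply]; push_cast; rfl
  have hcw : ∀ i, crt hq ((b * v * y : ℤ) : ZMod m) i = b * v * y := by
    intro i; rw [map_intCast, Pi.intCast_apply]; push_cast; rfl
  obtain ⟨l, hl, hlj⟩ : ∃ l ∈ J' q b, l ≠ j := Finset.exists_mem_ne hb j
  refine ⟨b * q j * x, b * v * y, alpha_eq_of_bezout hq h hb rfl hv' hxy, ?_, ⟨fun i => ?_, j, hjmem, ?_⟩,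
    fun i => ?_, l, hl, ?_⟩
  · have : (b + b * q j * x + b * v * y : ℤ) = 0 := by linear_combination (b : ℤ) * hxy
    rw [this, Int.cast_zero]
  · rw [hcz]
    by_cases hi : i ∈ J' q b
    · by_cases hij : i = j
      · left; rw [hij, hqj]; ring
      · right
        have := hxyi i
        rw [hvi i hi hij] at this
        linear_combination (b : ZMod (q i)) * this
    · left; rw [hbi i hi]; ring
  · rw [hcz, hqj]; ring
  · rw [hcw]
    by_cases hi : i ∈ J' q b
    · by_cases hij : i = j
      · right
        have := hxyi i
        have hqi : (q j : ZMod (q i)) = 0 := by rw [hij]; exact hqj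
        rw [hqi] at this
        linear_combination (b : ZMod (q i)) * this
      · left; rw [hvi i hi hij]; ring
    · left; rw [hbi i hi]; ring
  · rw [hcw, hvi l hl hlj]; ring

include hq in
theorem alpha_of_J'_eq_singleton {b : ℕ} {j : Fin t} (hb : J' q b = {j}) (hbj : b ≠ m / q j) :
    alpha m q b = theta m (-(b : ℤ)) + theta m ((b : ℤ) - ((m / q j : ℕ) : ℤ)) +
      theta m ((m / q j : ℕ) : ℤ) - normElt m := by
  have h : (J' q b).Nonempty := by rw [hb]; exact Finset.singleton_nonempty j
  have hmin : (J' q b).min' h = j := by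
    have := Finset.min'_mem _ h
    exact Finset.mem_singleton.mp (hb.subset this)
  rw [alpha, dif_pos h]
  simp only [hmin]
  rw [if_neg (by rw [hb, Finset.card_singleton]; omega), if_neg hbj]

include hq in
theorem alpha_div {j : Fin t} (hj : 1 < q j) :
    alpha m q (m / q j) = theta m ((m / q j * ((q j).totient / 2) : ℕ) : ℤ) +
      theta m ((m / q j * ((q j).totient / 2) : ℕ) : ℤ) + theta m ((m / (q j).minFac : ℕ) : ℤ) -
        normElt m := by
  have hb : J' q (m / q j) = {j} := by
    have := J'_div_mul hq (j := j) (b := 1) (by rw [Nat.dvd_one]; omega)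
    rwa [mul_one] at this
  have h : (J' q (m / q j)).Nonempty := by rw [hb]; exact Finset.singleton_nonempty j
  have hmin : (J' q (m / q j)).min' h = j := by
    have := Finset.min'_mem _ h
    exact Finset.mem_singleton.mp (hb.subset this)
  rw [alpha, dif_pos h]
  simp only [hmin]
  rw [if_neg (by rw [hb, Finset.card_singleton]; omega), if_pos trivial, two_smul]

include hq in
/-- All the elements `α_m(b)` are short. -/
theorem isShort_alpha (hq2 : ∀ i, 2 < q i) {b : ℕ} (hb : 0 < b) (hbm : b < m) :
    IsShort (alpha m q b) := by
  have hne := J'_nonempty hq hb hbm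
  have hb0 : (b : ZMod m) ≠ 0 := by
    rw [ne_eq, ZMod.natCast_eq_zero_iff]
    exact fun h => absurd (Nat.le_of_dvd hb h) (not_le.mpr hbm)
  by_cases h1 : 1 < (J' q b).card
  · obtain ⟨z, w, h, h0, -⟩ := alpha_of_one_lt_card hq h1
    rw [h]
    exact isShort_of_add_eq_zero h0 (by simpa using hb0)
  · obtain ⟨j, hj⟩ := Finset.card_eq_one.mp (le_antisymm (not_lt.mp h1) hne.card_pos)
    by_cases hbj : b = m / q j
    · have hp : ((q j).minFac).Prime := Nat.minFac_prime (hq.isPrimePow j).ne_one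
      obtain ⟨f, hf⟩ := (Nat.totient_even (hq2 j)).two_dvd
      have hf' : (q j).totient / 2 = f := by omega
      -- The identity φ(q) + q/p = q makes the arguments mφ(q)/(2q), taken twice, and m/p sum to m.
      have htot : (q j).totient + q j / (q j).minFac = q j := by
        have h2 := (hq.isPrimePow j).minFac_pow_factorization_eq
        set e := (q j).factorization (q j).minFac
        have he : e ≠ 0 := by
          intro he
          rw [he, pow_zero] at h2
          have := hq2 j
          omega
        obtain ⟨e', he'⟩ := Nat.exists_eq_succ_of_ne_zero he
        have h3 : q j / (q j).minFac = (q j).minFac ^ e' := by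
          apply Nat.div_eq_of_eq_mul_left hp.pos
          rw [← pow_succ, ← Nat.succ_eq_add_one, ← he', h2]
        have h4 : (q j).totient = (q j).minFac ^ e' * ((q j).minFac - 1) := by
          conv_lhs => rw [← h2, he']
          rw [Nat.totient_prime_pow_succ hp]
        rw [h3, h4]
        calc _ = (q j).minFac ^ e' * ((q j).minFac - 1 + 1) := by ring
          _ = (q j).minFac ^ (e' + 1) := by rw [Nat.sub_add_cancel hp.one_le, pow_succ]
          _ = q j := by rw [← Nat.succ_eq_add_one, ← he', h2]
      have hdiv : m / (q j).minFac = m / q j * (q j / (q j).minFac) := by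
        apply Nat.div_eq_of_eq_mul_left hp.pos
        rw [mul_assoc, Nat.div_mul_cancel (Nat.minFac_dvd _), q_mul_div hq]
      rw [hbj, alpha_div hq (by have := hq2 j; omega), hf']
      apply isShort_of_add_eq_zero
      · have h5 : m / q j * f + m / q j * f + m / (q j).minFac = m := by
          rw [hdiv, ← mul_add, ← mul_add, ← two_mul, ← hf, htot, q_mul_div hq]
        have h6 : ((m / q j * f : ℕ) : ℤ) + ((m / q j * f : ℕ) : ℤ) +
            ((m / (q j).minFac : ℕ) : ℤ) = (m : ℤ) := by exact_mod_cast h5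
        rw [h6, Int.cast_natCast, ZMod.natCast_self]
      · rw [Int.cast_natCast, ne_eq, ZMod.natCast_eq_zero_iff]
        have h7 := Nat.totient_pos.mpr (NeZero.pos (q j))
        have h8 := Nat.totient_lt (q j) (by have := hq2 j; omega)
        have h9 := div_mul_lt hq (j := j) (b := f) (by omega)
        have h10 : 0 < m / q j := Nat.div_pos (Nat.le_of_dvd (NeZero.pos m) (q_dvd hq j))
          (NeZero.pos _)
        exact fun h => absurd (Nat.le_of_dvd (Nat.mul_pos h10 (by omega)) h) (not_le.mpr h9)
    · rw [alpha_of_J'_eq_singleton hq hj hbj]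
      apply isShort_of_add_eq_zero
      · rw [show (-(b : ℤ) + ((b : ℤ) - ((m / q j : ℕ) : ℤ)) + ((m / q j : ℕ) : ℤ)) = 0 by ring,
          Int.cast_zero]
      · rw [Int.cast_neg, Int.cast_natCast, neg_ne_zero]
        exact hb0

section Lattice

variable {W : Submodule ℤ ((ZMod m)ˣ → ℚ)} (hhalf : ((1 / 2 : ℚ) • fun _ => (1 : ℚ)) ∈ W)

include hhalf

theorem psi_mem_iff_coeffFn_theta_mem (a : ℤ) :
    psi (a : ZMod m) ∈ W ↔ coeffFn m (theta m a) ∈ W := by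
  by_cases ha : (a : ZMod m) = 0
  · rw [coeffFn_theta_of_eq_zero ha, ha, psi_zero]
  · rw [coeffFn_theta_of_ne_zero ha]
    exact (Submodule.add_mem_iff_left W hhalf).symm

theorem coeffFn_normElt_mem : coeffFn m (normElt m) ∈ W := by
  have : coeffFn m (normElt m) = ((1 / 2 : ℚ) • fun _ => (1 : ℚ)) + ((1 / 2 : ℚ) • fun _ => 1) := by
    funext u
    rw [coeffFn_normElt]
    norm_num
  rw [this]
  exact Submodule.add_mem _ hhalf hhalf

-- Modulo ½·1 and the values of ψ on smaller supports, α_m(a) and ψ(a) generate the same, so the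
-- α_m(a) may stand in for ψ(a) in the induction on supports.
include hq in
theorem coeffLattice_le (hq2 : ∀ i, 2 < q i)
    (h1 : ∀ i (b : ℕ), 1 ≤ b → b ≤ (q i).totient / 2 → psi ((m / q i * b : ℕ) : ZMod m) ∈ W)
    (h2 : ∀ a ∈ M m q, 1 < (J' q a).card → coeffFn m (alpha m q a) ∈ W) :
    coeffLattice m ≤ W := by
  have hq1 : ∀ i, 1 < q i := fun i => (by norm_num : 1 < 2).trans (hq2 i)
  refine Submodule.span_le.mpr (Set.insert_subset hhalf ?_)
  rintro _ ⟨z, rfl⟩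
  refine psi_mem hq hq2 W h1 (fun a ha hcard hlow => ?_) z
  obtain ⟨z, w, hα, -, hz, hw⟩ := alpha_of_one_lt_card hq hcard
  have hcoord : ∀ i, (a : ZMod (q i)) = 0 ∨ IsUnit (a : ZMod (q i)) := by
    obtain ⟨c, hc⟩ := exists_symbEval_of_mem_X hq hq1 ha.1
    intro i
    have := symbEval_coord hq c i
    rwa [crt_eq_natCast_val, hc] at this
  have key : ∀ z : ℤ, ((∀ i, crt hq z i = 0 ∨ crt hq z i = -(a : ZMod (q i))) ∧
      ∃ i ∈ J' q a, crt hq z i = 0) → coeffFn m (theta m z) ∈ W := by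
    rintro z ⟨hz, i0, hi0, hz0⟩
    rw [← psi_mem_iff_coeffFn_theta_mem hhalf]
    refine hlow _ (fun i => ?_) ?_
    · rcases hz i with h | h
      · exact Or.inl h
      · rw [h, neg_eq_zero, IsUnit.neg_iff]
        exact hcoord i
    · refine (Finset.ssubset_iff_of_subset fun i hi => ?_).mpr
        ⟨i0, hi0, fun h => (mem_J'_val_iff hq _ _).mp h hz0⟩
      rw [mem_J'_val_iff hq] at hi
      have h := (hz i).resolve_left hi
      rw [J', Finset.mem_filter]
      refine ⟨Finset.mem_univ _, fun h' => hi ?_⟩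
      rw [h, (ZMod.natCast_eq_zero_iff a (q i)).mpr h', neg_zero]
  have h3 := h2 a ha hcard
  rw [hα, map_sub, map_add, map_add] at h3
  have h4 := (Submodule.sub_mem_iff_left W (coeffFn_normElt_mem hhalf)).mp h3
  rw [Submodule.add_mem_iff_left W (key w hw), Submodule.add_mem_iff_left W (key z hz)] at h4
  have := (psi_mem_iff_coeffFn_theta_mem hhalf (a : ℤ)).mpr h4
  rwa [Int.cast_natCast] at this

end Lattice

theorem alpha_mem_SPrime (b : ℕ) : alpha m q b ∈ SPrime m := by
  have h3 : ∀ a b c : ℤ, theta m a + theta m b + theta m c - normElt m ∈ SPrime m :=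
    fun _ _ _ => sub_mem (add_mem (add_mem (theta_mem_SPrime _) (theta_mem_SPrime _))
      (theta_mem_SPrime _)) normElt_mem_SPrime
  by_cases h : (J' q b).Nonempty
  · rw [alpha, dif_pos h]
    dsimp only
    by_cases h1 : 1 < (J' q b).card
    · rw [if_pos h1]; exact h3 _ _ _
    · rw [if_neg h1]
      split_ifs
      · rw [two_smul]; exact h3 _ _ _
      · exact h3 _ _ _
  · rw [alpha, dif_neg h]
    exact zero_mem _

/-- A generating family of `S'_m` with at most `φ(m) / 2 + 1` members is a basis. -/
theorem exists_basis (hm : 2 < m) {κ : Type*} [Finite κ] (F : κ → QG m)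
    (hF : ∀ k, F k ∈ SPrime m)
    (hspan : coeffLattice m ≤ Submodule.span ℤ (Set.range fun k => coeffFn m (F k)))
    (hcard : 2 * Nat.card κ ≤ m.totient + 2) :
    ∃ B : Module.Basis κ ℤ (SPrime m), ∀ k, (B k : QG m) = F k := by
  have := Fintype.ofFinite κ
  have hle : ∀ x ∈ coeffLattice m,
      x ∈ Submodule.span ℚ (Set.range fun k => coeffFn m (F k)) := fun x hx =>
    Submodule.span_subset_span ℤ ℚ _ (hspan hx)
  have hone : (fun _ => 1 : (ZMod m)ˣ → ℚ) ∈
      Submodule.span ℚ (Set.range fun k => coeffFn m (F k)) := by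
    have := Submodule.smul_mem _ (2 : ℚ) (hle _ half_mem_coeffLattice)
    rwa [smul_smul, show (2 : ℚ) * (1 / 2) = 1 by norm_num, one_smul] at this
  have hrank := totient_add_two_le_two_mul_finrank hm _
    (fun a => hle _ (psi_mem_coeffLattice a)) hone
  -- The span has dimension at least φ(m)/2 + 1, which is no less than the number of members, so
  -- none is redundant.
  have hli : LinearIndependent ℚ fun k => coeffFn m (F k) := by
    rw [linearIndependent_iff_card_le_finrank_span, Set.finrank, ← Nat.card_eq_fintype_card]
    omega
  have hliF : LinearIndependent ℤ F := by
    have h1 : LinearIndependent ℚ F := LinearIndependent.of_comp (coeffFn m) hli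
    exact h1.restrict_scalars fun a b h => by simpa using h
  let ι : SPrime m →ₗ[ℤ] QG m := (SPrime m).subtype.toIntLinearMap
  let v : κ → SPrime m := fun k => ⟨F k, hF k⟩
  have hliv : LinearIndependent ℤ v := LinearIndependent.of_comp ι hliF
  have htop : ⊤ ≤ Submodule.span ℤ (Set.range v) := by
    intro x _
    let L : SPrime m →ₗ[ℤ] ((ZMod m)ˣ → ℚ) := ((coeffFn m).restrictScalars ℤ).comp ι
    have hL : Function.Injective L := coeffFn_injective.comp Subtype.val_injective
    have h1 : L x ∈ (Submodule.span ℤ (Set.range v)).map L := by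
      rw [Submodule.map_span, ← Set.range_comp]
      exact hspan (coeffFn_mem_of_mem_SPrime x.2)
    obtain ⟨y, hy, hyx⟩ := h1
    rwa [← hL hyx]
  exact ⟨Module.Basis.mk hliv htop, fun k => by rw [Module.Basis.mk_apply]⟩

end Alpha

/-! ### The two bases -/

section Main

variable {m : ℕ} [NeZero m] {t : ℕ} {q : Fin t → ℕ} (hq : IsPrimePowerFactorization m q)

-- If some q_i were 2, the coprime product of the others would be odd, forcing m ≡ 2 modulo 4.
include hq in
theorem two_lt_q (hm4 : ¬ m ≡ 2 [MOD 4]) (i : Fin t) : 2 < q i := by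
  have h1 := (hq.isPrimePow i).one_lt
  refine lt_of_le_of_ne h1 fun h => hm4 ?_
  have h2 := Nat.div_mul_cancel (q_dvd hq i)
  have : NeZero (q i) := ⟨by omega⟩
  have hprod : q i * ∏ l ∈ Finset.univ.erase i, q l = m := by
    rw [Finset.mul_prod_erase _ _ (Finset.mem_univ i), hq.prod_eq]
  have hcop : (q i).Coprime (∏ l ∈ Finset.univ.erase i, q l) :=
    Nat.Coprime.prod_right fun l hl => hq.coprime i l (Finset.ne_of_mem_erase hl).symm
  rw [← h] at hcop hprod
  have hodd := Nat.coprime_two_left.mp hcop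
  obtain ⟨k, hk⟩ := hodd
  rw [hk] at hprod
  rw [← hprod, Nat.ModEq]
  omega

variable [∀ i, NeZero (q i)]

include hq in
theorem J'_div {j : Fin t} (hj : 1 < q j) : J' q (m / q j) = {j} := by
  have := J'_div_mul hq (j := j) (b := 1) (by rw [Nat.dvd_one]; omega)
  rwa [mul_one] at this

include hq in
theorem div_q_injective (hq1 : ∀ i, 1 < q i) : Function.Injective fun i => m / q i := by
  intro i j h
  have := congrArg (J' q) h
  simp only [J'_div hq (hq1 i), J'_div hq (hq1 j)] at this
  exact Finset.singleton_injective this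

include hq in
theorem exists_basis_fst (hm : 1 < m) (hq2 : ∀ i, 2 < q i) (hm2 : 2 < m) :
    ∃ B : Module.Basis
        ({b // b ∈ M' m q ∧ 1 < (J' q b).card} ⊕ {b // b ∈ M' m q ∧ (J' q b).card = 1} ⊕ Unit)
        ℤ (SPrime m),
      ∀ i, (B i : QG m) =
        Sum.elim (fun b => alpha m q b.1)
          (Sum.elim (fun b => theta m (b.1 : ℤ)) (fun _ => (1 / 2 : ℚ) • normElt m)) i := by
  have hq1 : ∀ i, 1 < q i := fun i => (by norm_num : 1 < 2).trans (hq2 i)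
  have hfin := M'_finite hq hq2
  have hfin1 : {b | b ∈ M' m q ∧ 1 < (J' q b).card}.Finite := hfin.subset fun _ h => h.1
  have hfin2 : {b | b ∈ M' m q ∧ (J' q b).card = 1}.Finite := hfin.subset fun _ h => h.1
  have : Finite {b // b ∈ M' m q ∧ 1 < (J' q b).card} := hfin1
  have : Finite {b // b ∈ M' m q ∧ (J' q b).card = 1} := hfin2
  refine exists_basis hm2 _ ?_ ?_ ?_
  · rintro (b | b | _)
    · exact alpha_mem_SPrime _
    · exact theta_mem_SPrime _
    · exact half_normElt_mem_SPrime
  · have hhalf : ((1 / 2 : ℚ) • fun _ => (1 : ℚ)) ∈ Submodule.span ℤ (Set.range fun k =>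
        coeffFn m (Sum.elim (fun b : {b // b ∈ M' m q ∧ 1 < (J' q b).card} => alpha m q b.1)
          (Sum.elim (fun b : {b // b ∈ M' m q ∧ (J' q b).card = 1} => theta m (b.1 : ℤ))
            (fun _ : Unit => (1 / 2 : ℚ) • normElt m)) k)) := by
      refine Submodule.subset_span ⟨Sum.inr (Sum.inr ()), ?_⟩
      funext u
      simp [coeffFn_normElt]
    refine coeffLattice_le hq hhalf hq2 (fun i b h1 h2 => ?_) (fun a ha hcard => ?_)
    · have hJ := J'_div_mul hq (not_dvd_of_le_totient (hq1 i) h1 h2)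
      have := (psi_mem_iff_coeffFn_theta_mem hhalf ((m / q i * b : ℕ) : ℤ)).mpr
        (Submodule.subset_span ⟨Sum.inr (Sum.inl ⟨m / q i * b,
          (mem_M'_iff hq).mpr (Or.inr ⟨i, b, h1, h2, rfl⟩), by rw [hJ, Finset.card_singleton]⟩), rfl⟩)
      rwa [Int.cast_natCast] at this
    · exact Submodule.subset_span
        ⟨Sum.inl ⟨a, (mem_M'_iff hq).mpr (Or.inl ⟨ha, hcard⟩), hcard⟩, rfl⟩
  · rw [Nat.card_sum, Nat.card_sum, Nat.card_unique (α := Unit)]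
    have h1 : Nat.card {b // b ∈ M' m q ∧ 1 < (J' q b).card} +
        Nat.card {b // b ∈ M' m q ∧ (J' q b).card = 1} ≤ (M' m q).ncard := by
      change {b | b ∈ M' m q ∧ 1 < (J' q b).card}.ncard +
        {b | b ∈ M' m q ∧ (J' q b).card = 1}.ncard ≤ _
      rw [← Set.ncard_union_eq _ hfin1 hfin2]
      · exact Set.ncard_le_ncard (Set.union_subset (fun _ h => h.1) fun _ h => h.1) hfin
      · rw [Set.disjoint_left]
        rintro b ⟨-, h⟩ ⟨-, h'⟩
        omega
    have := two_mul_ncard_M'_le hq hm hq2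
    omega

-- For a single coordinate only θ_m(m/q_i) is given directly; the other values are recovered from
-- the α's step by step.
include hq in
theorem exists_basis_snd (hm : 1 < m) (hq2 : ∀ i, 2 < q i) (hm2 : 2 < m) :
    ∃ B : Module.Basis
        ({b // b ∈ M' m q \ Set.range (fun i => m / q i)} ⊕ Fin t ⊕ Unit)
        ℤ (SPrime m),
      ∀ i, (B i : QG m) =
        Sum.elim (fun b => alpha m q b.1)
          (Sum.elim (fun i => theta m ((m / q i : ℕ) : ℤ))
            (fun _ => (1 / 2 : ℚ) • normElt m)) i := by
  have hq1 : ∀ i, 1 < q i := fun i => (by norm_num : 1 < 2).trans (hq2 i)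
  have hfin := M'_finite hq hq2
  have hfin1 : (M' m q \ Set.range (fun i => m / q i)).Finite := hfin.sdiff
  have : Finite {b // b ∈ M' m q \ Set.range (fun i => m / q i)} := hfin1
  refine exists_basis hm2 _ ?_ ?_ ?_
  · rintro (b | b | _)
    · exact alpha_mem_SPrime _
    · exact theta_mem_SPrime _
    · exact half_normElt_mem_SPrime
  · set W := Submodule.span ℤ (Set.range fun k =>
        coeffFn m (Sum.elim
          (fun b : {b // b ∈ M' m q \ Set.range (fun i => m / q i)} => alpha m q b.1)
          (Sum.elim (fun i => theta m ((m / q i : ℕ) : ℤ))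
            (fun _ : Unit => (1 / 2 : ℚ) • normElt m)) k)) with hW
    have hhalf : ((1 / 2 : ℚ) • fun _ => (1 : ℚ)) ∈ W := by
      refine Submodule.subset_span ⟨Sum.inr (Sum.inr ()), ?_⟩
      funext u
      simp [coeffFn_normElt]
    have halpha : ∀ b, b ∈ M' m q \ Set.range (fun i => m / q i) → coeffFn m (alpha m q b) ∈ W :=
      fun b hb => Submodule.subset_span ⟨Sum.inl ⟨b, hb⟩, rfl⟩
    have htheta : ∀ i, coeffFn m (theta m ((m / q i : ℕ) : ℤ)) ∈ W := fun i =>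
      Submodule.subset_span ⟨Sum.inr (Sum.inl i), rfl⟩
    refine coeffLattice_le hq hhalf hq2 (fun i b h1 h2 => ?_) (fun a ha hcard => ?_)
    · induction b, h1 using Nat.le_induction with
      | base =>
        have := (psi_mem_iff_coeffFn_theta_mem hhalf _).mpr (htheta i)
        rwa [Int.cast_natCast, ← mul_one (m / q i)] at this
      | succ b hb ih =>
        have ih' := ih (by omega)
        have hJ := J'_div_mul hq (not_dvd_of_le_totient (hq1 i) (by omega) h2)
        have hne : ∀ l, m / q l ≠ m / q i * (b + 1) := by
          intro l hl
          have h3 := J'_div hq (hq1 l)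
          rw [hl, hJ, Finset.singleton_inj] at h3
          subst h3
          have h4 : 0 < m / q i :=
            Nat.div_pos (Nat.le_of_dvd (NeZero.pos m) (q_dvd hq i)) (NeZero.pos _)
          have h5 : m / q i * 1 = m / q i * (b + 1) := by rw [mul_one, ← hl]
          have := Nat.eq_of_mul_eq_mul_left h4 h5
          omega
        have h3 := halpha (m / q i * (b + 1)) ⟨(mem_M'_iff hq).mpr
          (Or.inr ⟨i, b + 1, by omega, h2, rfl⟩), by rintro ⟨l, hl⟩; exact hne l hl⟩
        rw [alpha_of_J'_eq_singleton hq hJ (hne i).symm, map_sub, map_add, map_add,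
          Submodule.sub_mem_iff_left W (coeffFn_normElt_mem hhalf),
          Submodule.add_mem_iff_left W (htheta i)] at h3
        have e : ((m / q i * (b + 1) : ℕ) : ℤ) - ((m / q i : ℕ) : ℤ) = ((m / q i * b : ℕ) : ℤ) := by
          rw [Nat.mul_add, mul_one, Nat.cast_add, add_sub_cancel_right]
        have h5 := (psi_mem_iff_coeffFn_theta_mem hhalf ((m / q i * b : ℕ) : ℤ)).mp
          (by rwa [Int.cast_natCast])
        rw [e, Submodule.add_mem_iff_left W h5, ← psi_mem_iff_coeffFn_theta_mem hhalf, Int.cast_neg,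
          psi_neg, neg_mem_iff, Int.cast_natCast] at h3
        exact h3
    · refine halpha a ⟨(mem_M'_iff hq).mpr (Or.inl ⟨ha, hcard⟩), ?_⟩
      rintro ⟨l, rfl⟩
      rw [J'_div hq (hq1 l), Finset.card_singleton] at hcard
      omega
  · rw [Nat.card_sum, Nat.card_sum, Nat.card_unique (α := Unit)]
    have hsub : Set.range (fun i => m / q i) ⊆ M' m q := by
      rintro _ ⟨i, rfl⟩
      have h3 := Nat.totient_pos.mpr (NeZero.pos (q i))
      obtain ⟨f, hf⟩ := (Nat.totient_even (hq2 i)).two_dvd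
      exact (mem_M'_iff hq).mpr (Or.inr ⟨i, 1, le_rfl, by omega, (mul_one _).symm⟩)
    have h1 := Set.ncard_sdiff_add_ncard_of_subset hsub hfin
    have h2 : (Set.range (fun i => m / q i)).ncard = Nat.card (Fin t) :=
      (Nat.card_range_of_injective (div_q_injective hq hq1))
    have h3 : Nat.card {b // b ∈ M' m q \ Set.range (fun i => m / q i)} =
      (M' m q \ Set.range (fun i => m / q i)).ncard := rfl
    have := two_mul_ncard_M'_le hq hm hq2
    omega

end Main

end Stickelberger

end

theorem mainTheorem8 (m : ℕ) [NeZero m] (hm : 1 < m) (hm4 : ¬ m ≡ 2 [MOD 4])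
    (t : ℕ) (q : Fin t → ℕ) (hq : IsPrimePowerFactorization m q) :
    (∃ B : Module.Basis
        ({b // b ∈ M' m q ∧ 1 < (J' q b).card} ⊕ {b // b ∈ M' m q ∧ (J' q b).card = 1} ⊕ Unit)
        ℤ (SPrime m),
      ∀ i, (B i : QG m) =
        Sum.elim (fun b => alpha m q b.1)
          (Sum.elim (fun b => theta m (b.1 : ℤ)) (fun _ => (1 / 2 : ℚ) • normElt m)) i) ∧
    (∃ B : Module.Basis
        ({b // b ∈ M' m q \ Set.range (fun i => m / q i)} ⊕ Fin t ⊕ Unit)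
        ℤ (SPrime m),
      ∀ i, (B i : QG m) =
        Sum.elim (fun b => alpha m q b.1)
          (Sum.elim (fun i => theta m ((m / q i : ℕ) : ℤ)) (fun _ => (1 / 2 : ℚ) • normElt m)) i) ∧
    (∀ b : ℕ, 0 < b → b < m → IsShort (alpha m q b)) := by
  have hq2 := two_lt_q hq hm4
  have : ∀ i, NeZero (q i) := fun i => ⟨by have := hq2 i; omega⟩
  have hm2 : 2 < m := by
    refine lt_of_le_of_ne hm fun h => hm4 ?_
    rw [← h]
  exact ⟨exists_basis_fst hq hm hq2 hm2, exists_basis_snd hq hm hq2 hm2,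
    fun b hb hbm => isShort_alpha hq hq2 hb hbm⟩
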